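/- Let $N\ge 1$, let $\Omega\subset\mathbb{R}^N$ be a nonempty bounded open set (not necessarily connected), and let $p\in(2,2^*)$, where $2^*:=\frac{2N}{N-2}$ if $N\ge 3$ and $2^*:=\infty$ if $N=1,2$. Let $Q(x):=1$ for $x\in\Omega$ and $Q(x):=-1$ for $x\in\mathbb{R}^N\smallsetminus\Omega$, and for $\varepsilon>0$ put $Q_\varepsilon(x):=Q(x/\varepsilon)$. Let $H^1(\mathbb{R}^N)$ be the Sobolev space of real-valued functions with norm $\|v\|^2=\int_{\mathbb{R}^N}(|\nabla v|^2+v^2)$. A solution of $$-\Delta v+v=Q_\varepsilon(x)|v|^{p-2}v,\qquad v\in H^1(\mathbb{R}^N),\tag{1}$$ is a function $v\in H^1(\mathbb{R}^N)$ such that, for every $w\in H^1(\mathbb{R}^N)$, the function $Q_\varepsilon|v|^{p-2}vw$ is integrable and $$\int_{\mathbb{R}^N}(\nabla v\cdot\nabla w+vw)=\int_{\mathbb{R}^N}Q_\varepsilon|v|^{p-2}vw .$$ Then, for each $\varepsilon>0$, problem (1) has infinitely many solutions; in fact, it has a sequence of solutions that is unbounded in $H^1(\mathbb{R}^N)$.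 -/

import Mathlib

open MeasureTheory
open scoped ContDiff

noncomputable section

namespace SelfFocusing

/-- Euclidean space `ℝ^N`. -/
abbrev Space (N : ℕ) : Type := EuclideanSpace ℝ (Fin N)

/-- `g` is the weak gradient of `u` on `ℝ^N`: `∫ u ∇φ = - ∫ φ g` for every `φ ∈ C_c^∞(ℝ^N)`
(a vector identity, that is, `∫ u ∂ᵢφ = - ∫ φ gᵢ` for all `i`). -/
def IsWeakGradient {N : ℕ} (u : Space N → ℝ) (g : Space N → Space N) : Prop :=
  ∀ φ : Space N → ℝ, ContDiff ℝ ∞ φ → HasCompactSupport φ →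
    ∫ x, u x • gradient φ x = - ∫ x, φ x • g x

theorem continuous_gradient {N : ℕ} {φ : Space N → ℝ} (hφ : ContDiff ℝ ∞ φ) :
    Continuous (gradient φ) :=
  (InnerProductSpace.toDual ℝ (Space N)).symm.continuous.comp (hφ.continuous_fderiv (by simp))

theorem hasCompactSupport_gradient {N : ℕ} {φ : Space N → ℝ} (hφ : HasCompactSupport φ) :
    HasCompactSupport (gradient φ) :=
  (hφ.fderiv ℝ).comp_left (g := (InnerProductSpace.toDual ℝ (Space N)).symm) (map_zero _)

theorem integrable_smul_gradient {N : ℕ} (u : Lp ℝ 2 (volume : Measure (Space N)))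
    {φ : Space N → ℝ} (h1 : ContDiff ℝ ∞ φ) (h2 : HasCompactSupport φ) :
    Integrable (fun x => u x • gradient φ x) :=
  ((Lp.memLp u).locallyIntegrable (by norm_num)).integrable_smul_right_of_hasCompactSupport
    (continuous_gradient h1) (hasCompactSupport_gradient h2)

theorem integrable_test_smul {N : ℕ} (g : Lp (Space N) 2 (volume : Measure (Space N)))
    {φ : Space N → ℝ} (h1 : ContDiff ℝ ∞ φ) (h2 : HasCompactSupport φ) :
    Integrable (fun x => φ x • g x) :=
  ((Lp.memLp g).locallyIntegrable (by norm_num)).integrable_smul_left_of_hasCompactSupport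
    h1.continuous h2

/-- The Sobolev space `H^1(ℝ^N)` of real functions, realised as the space of pairs `(u, ∇u)` where
`u ∈ L^2(ℝ^N)` has a weak gradient `∇u ∈ L^2(ℝ^N; ℝ^N)`. As a subspace of the Hilbert sum
`L^2 ⊕ L^2` it carries the norm `‖u‖² = ∫ u² + ∫ |∇u|²`. An element is determined by `u`
(`H1.ext_fn`). -/
def H1 (N : ℕ) : Submodule ℝ (WithLp 2
    (Lp ℝ 2 (volume : Measure (Space N)) × Lp (Space N) 2 (volume : Measure (Space N)))) where
  carrier := {w | IsWeakGradient w.fst w.snd}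
  zero_mem' := by
    intro φ _ _
    have h1 : (fun x => ((0 : Lp ℝ 2 (volume : Measure (Space N))) x) • gradient φ x)
        =ᵐ[volume] fun _ => 0 := by
      filter_upwards [Lp.coeFn_zero ℝ 2 (volume : Measure (Space N))] with x hx
      rw [hx, Pi.zero_apply]
      simp
    have h2 : (fun x => φ x • (0 : Lp (Space N) 2 (volume : Measure (Space N))) x)
        =ᵐ[volume] fun _ => 0 := by
      filter_upwards [Lp.coeFn_zero (Space N) 2 (volume : Measure (Space N))] with x hx
      rw [hx, Pi.zero_apply]
      simp
    simp only [WithLp.zero_fst, WithLp.zero_snd]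
    rw [integral_congr_ae h1, integral_congr_ae h2]
    simp
  add_mem' := by
    intro v w hv hw φ h1 h2
    have e1 : (fun x => (v.fst + w.fst : Lp ℝ 2 (volume : Measure (Space N))) x • gradient φ x)
        =ᵐ[volume] fun x => v.fst x • gradient φ x + w.fst x • gradient φ x := by
      filter_upwards [Lp.coeFn_add v.fst w.fst] with x hx
      rw [hx, Pi.add_apply, add_smul]
    have e2 : (fun x => φ x • (v.snd + w.snd : Lp (Space N) 2 (volume : Measure (Space N))) x)
        =ᵐ[volume] fun x => φ x • v.snd x + φ x • w.snd x := by
      filter_upwards [Lp.coeFn_add v.snd w.snd] with x hx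
      rw [hx, Pi.add_apply, smul_add]
    simp only [WithLp.add_fst, WithLp.add_snd]
    rw [integral_congr_ae e1, integral_congr_ae e2,
      integral_add (integrable_smul_gradient _ h1 h2) (integrable_smul_gradient _ h1 h2),
      integral_add (integrable_test_smul _ h1 h2) (integrable_test_smul _ h1 h2),
      hv φ h1 h2, hw φ h1 h2, neg_add]
  smul_mem' := by
    intro c v hv φ h1 h2
    have e1 : (fun x => (c • v.fst : Lp ℝ 2 (volume : Measure (Space N))) x • gradient φ x)
        =ᵐ[volume] fun x => c • (v.fst x • gradient φ x) := by
      filter_upwards [Lp.coeFn_smul c v.fst] with x hx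
      simp [hx, mul_smul]
    have e2 : (fun x => φ x • (c • v.snd : Lp (Space N) 2 (volume : Measure (Space N))) x)
        =ᵐ[volume] fun x => c • (φ x • v.snd x) := by
      filter_upwards [Lp.coeFn_smul c v.snd] with x hx
      rw [hx, Pi.smul_apply, smul_comm]
    simp only [WithLp.smul_fst, WithLp.smul_snd]
    rw [integral_congr_ae e1, integral_congr_ae e2, integral_smul, integral_smul,
      hv φ h1 h2, smul_neg]

/-- The function `u` underlying an element of `H^1(ℝ^N)`, as an element of `L^2(ℝ^N)`. -/
def fn {N : ℕ} (v : H1 N) : Lp ℝ 2 (volume : Measure (Space N)) := v.1.fst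

/-- The weak gradient of an element of `H^1(ℝ^N)`. -/
def grad {N : ℕ} (v : H1 N) : Lp (Space N) 2 (volume : Measure (Space N)) := v.1.snd

/-- An element of `H^1(ℝ^N)` is determined by its underlying `L^2` function. -/
theorem H1.ext_fn {N : ℕ} {v w : H1 N} (h : fn v = fn w) : v = w := by
  have hg : grad v = grad w := by
    apply Lp.ext
    have hi := ae_eq_of_integral_contDiff_smul_eq (μ := volume) (f := grad v) (f' := grad w)
      ((Lp.memLp (grad v)).locallyIntegrable (by norm_num))
      ((Lp.memLp (grad w)).locallyIntegrable (by norm_num)) (by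
        intro φ h1 h2
        have hv : ∫ x, fn v x • gradient φ x = - ∫ x, φ x • grad v x := v.2 φ h1 h2
        have hw : ∫ x, fn w x • gradient φ x = - ∫ x, φ x • grad w x := w.2 φ h1 h2
        rw [h, hw] at hv
        exact (neg_injective hv).symm)
    exact hi
  apply Subtype.ext
  exact WithLp.ofLp_injective 2 (Prod.ext h hg)

/-- The norm of the subspace `H1 N` is the standard norm of `H^1(ℝ^N)`. -/
theorem H1.norm_sq_eq {N : ℕ} (v : H1 N) :
    ‖v‖ ^ 2 = ∫ x, (fn v x ^ 2 + ‖grad v x‖ ^ 2) := by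
  have h1 : ‖v‖ ^ 2 = ‖fn v‖ ^ 2 + ‖grad v‖ ^ 2 := WithLp.prod_norm_sq_eq_of_L2 v.1
  have i1 : Integrable (fun x => fn v x ^ 2) := (Lp.memLp (fn v)).integrable_sq
  have i2 : Integrable (fun x => ‖grad v x‖ ^ 2) := (Lp.memLp (grad v)).norm.integrable_sq
  rw [integral_add i1 i2, h1, ← real_inner_self_eq_norm_sq, ← real_inner_self_eq_norm_sq,
    L2.inner_def, L2.inner_def]
  simp only [real_inner_self_eq_norm_sq, Real.norm_eq_abs, sq_abs]

open Classical in
/-- The function `Q`, equal to `1` on `Ω` and to `-1` outside `Ω`. -/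
def Q {N : ℕ} (Ω : Set (Space N)) (x : Space N) : ℝ := if x ∈ Ω then 1 else -1

/-- The rescaled function `Q_ε(x) = Q(x / ε)`. -/
def Qeps {N : ℕ} (Ω : Set (Space N)) (ε : ℝ) (x : Space N) : ℝ := Q Ω (ε⁻¹ • x)

/-- `v ∈ H^1(ℝ^N)` is a (weak) solution of `-Δv + v = Q_ε |v|^{p-2} v`:
for every `w ∈ H^1(ℝ^N)` one has `∫ (∇v · ∇w + v w) = ∫ Q_ε |v|^{p-2} v w`, where the integral on
the right exists (the one on the left always does). -/
def IsSolution {N : ℕ} (Ω : Set (Space N)) (ε p : ℝ) (v : H1 N) : Prop :=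
  ∀ w : H1 N,
    Integrable (fun x => Qeps Ω ε x * |fn v x| ^ (p - 2) * fn v x * fn w x) ∧
    ∫ x, (inner ℝ (grad v x) (grad w x) + fn v x * fn w x) =
      ∫ x, Qeps Ω ε x * |fn v x| ^ (p - 2) * fn v x * fn w x

end SelfFocusing

end

/-! Let B = εΩ. On the unit sphere of H¹ put Φ(u) = ∫ Q_ε |u|^p = ⟨g(u), u⟩, where g(u) is the Riesz
representative of w ↦ ∫ Q_ε |u|^(p-2) u w. If ‖u‖ = 1 and g(u) = c u with c > 0, then by homogeneity
c^(-1/(p-2)) u is a solution, of norm c^(-1/(p-2)). Solutions of arbitrarily large norm therefore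
come from arbitrarily small positive eigenvalues c (`exists_small_eigenvalue`,
`exists_large_solution`).

These eigenvalues are minimax levels: c_k is the supremum of the lower bounds of Φ on odd continuous
images of the k-sphere. It is positive, because on the span of k+1 disjoint bumps supported in B the
functional is the p-th power of the L^p norm. It is at most δ for a suitable k: on the kernel of
suitable functionals R : H¹ → ℝ^k the L^p norm over B, hence Φ, is small, and by `borsuk_ulam` every
odd image of the k-sphere meets this kernel. It is an eigenvalue: one odd ascent step raises Φ by a
multiple of the squared tangential gradient (`exists_ascent`), so almost critical points exist near
the level c_k. They converge along a subsequence because g = gB - gC, where gB only sees the bounded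
set B and is compact, while gC comes from the complement and is monotone. A positive multiple of the
identity plus gC is strongly monotone, and this replaces compactness outside B
(`exists_eigenvector_of_palaisSmale`).

The analytic input is the embedding of H¹ in L^p and its smallness on subspaces of finite
codimension over B. Both come from averages over dyadic cubes. An L² Poincaré inequality gives an
error O(2^(-j)), passing to L^p costs 2^(jN(1/2-1/p)), and the product is summable exactly when
N(1/2-1/p) < 1, which is the subcriticality of p. Over B the averages involve finitely many cubes.

Borsuk–Ulam is derived from a Tucker lemma (`exists_complementary`) proved by mod 2 chains: a 2×2
matrix over 𝔽₂, attached to the signs of the labels of a simplex, detects alternating simplices, and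
its coboundary is a commutator with an invertible swap matrix. -/

open Filter Topology

namespace SelfFocusing

/-! ### A mod 2 chain argument for the Borsuk–Ulam theorem -/

section Chains

variable {V W M : Type*} [AddCommMonoid M]

/-- The codimension one faces of an ordered simplex. -/
def faces : List V → List (List V)
  | [] => []
  | x :: l => l :: (faces l).map (x :: ·)

/-- The prism between the images of an ordered simplex under two maps. -/
def prism (g g' : V → W) : List V → List (List W)
  | [] => []
  | x :: l => (g x :: g' x :: l.map g') :: (prism g g' l).map (g x :: ·)

/-- The value of a cochain `φ` on a chain `c`. -/
def pair (c : List (List V)) (φ : List V → M) : M := (c.map φ).sum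

/-- The coboundary of a cochain. -/
def cobd (φ : List V → M) (l : List V) : M := pair (faces l) φ

@[simp] theorem pair_nil (φ : List V → M) : pair [] φ = 0 := rfl

@[simp] theorem pair_cons (l : List V) (c : List (List V)) (φ : List V → M) :
    pair (l :: c) φ = φ l + pair c φ := by simp [pair]

@[simp] theorem pair_append (c d : List (List V)) (φ : List V → M) :
    pair (c ++ d) φ = pair c φ + pair d φ := by simp [pair]

theorem pair_map (c : List (List V)) (f : List V → List W) (φ : List W → M) :
    pair (c.map f) φ = pair c (fun l => φ (f l)) := by simp [pair, Function.comp_def]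

theorem pair_flatMap (c : List (List V)) (f : List V → List (List W)) (φ : List W → M) :
    pair (c.flatMap f) φ = pair c (fun l => pair (f l) φ) := by
  induction c with
  | nil => simp
  | cons l c ih => simp [ih]

theorem pair_add (c : List (List V)) (φ ψ : List V → M) :
    pair c (fun l => φ l + ψ l) = pair c φ + pair c ψ := by
  induction c with
  | nil => simp
  | cons l c ih => simp only [pair_cons, ih]; exact add_add_add_comm _ _ _ _

theorem pair_congr {c : List (List V)} {φ ψ : List V → M} (h : ∀ l ∈ c, φ l = ψ l) :
    pair c φ = pair c ψ := by
  unfold pair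
  rw [List.map_congr_left h]

theorem pair_zero (c : List (List V)) : pair c (fun _ => (0 : M)) = 0 := by
  simp [pair]

theorem cobd_nil (φ : List V → M) : cobd φ [] = 0 := rfl

theorem cobd_cons (φ : List V → M) (x : V) (l : List V) :
    cobd φ (x :: l) = φ l + cobd (fun l => φ (x :: l)) l := by
  simp [cobd, faces, pair_map]

theorem faces_map (f : V → W) (l : List V) :
    faces (l.map f) = (faces l).map (List.map f) := by
  induction l with
  | nil => rfl
  | cons x l ih => simp [faces, ih, Function.comp_def]

theorem cobd_map (f : V → W) (φ : List W → M) (l : List V) :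
    cobd φ (l.map f) = cobd (fun l => φ (l.map f)) l := by
  simp [cobd, faces_map, pair_map]

theorem cobd_add (φ ψ : List V → M) (l : List V) :
    cobd (fun l => φ l + ψ l) l = cobd φ l + cobd ψ l := pair_add _ _ _

/-- The prism operator is a chain homotopy modulo 2. -/
theorem prism_homotopy (h2 : ∀ a : M, a + a = 0) (g g' : V → W) (l : List V) (φ : List W → M) :
    pair (prism g g' l) (cobd φ) + cobd (fun q => pair (prism g g' q) φ) l =
      φ (l.map g) + φ (l.map g') := by
  induction l generalizing φ with
  | nil => simp [prism, cobd_nil, h2]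
  | cons x l ih =>
    have ih' := ih (fun q => φ (g x :: q))
    simp only [prism, pair_cons, pair_map, cobd_cons, cobd_map, pair_add, cobd_add, List.map_cons]
      at ih' ⊢
    generalize pair (prism g g' l) φ = a at *
    generalize cobd (fun l ↦ φ (g x :: g' x :: List.map g' l)) l = b at *
    -- The terms a and b, coming from the faces interior to the prism, each occur twice and cancel
    -- modulo 2.
    have : ∀ s t u v w y z : M, s + t = u + v →
        w + (v + b) + (a + s) + (a + (b + t)) = u + w := by
      intro s t u v w y z h
      calc _ = (a + a) + (b + b) + w + v + (s + t) := by abel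
        _ = u + w + (v + v) := by rw [h, h2, h2]; abel
        _ = _ := by rw [h2, add_zero]
    exact this _ _ _ _ _ a a ih'

end Chains

/-! ### The alternating cochain -/

section Labels

open Matrix

theorem cobd_perm {V M : Type*} [AddCommMonoid M] {l l' : List V} (h : l.Perm l') :
    ∀ φ : List V → M, (∀ a b, a.Perm b → φ a = φ b) → cobd φ l = cobd φ l' := by
  induction h with
  | nil => intros; rfl
  | cons x hl ih =>
    intro φ hφ
    rw [cobd_cons, cobd_cons, hφ _ _ hl, ih _ fun a b hab => hφ _ _ (hab.cons x)]
  | swap x y l =>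
    intro φ hφ
    simp only [cobd_cons]
    rw [add_left_comm]
    congr 2
    exact pair_congr fun q _ => hφ _ _ (List.Perm.swap _ _ _)
  | trans _ _ ih1 ih2 => intro φ hφ; rw [ih1 φ hφ, ih2 φ hφ]

abbrev Mat2 := Matrix (Fin 2) (Fin 2) (ZMod 2)

/-- The swap matrix. -/
def swapMat : Mat2 := !![0, 1; 1, 0]

/-- The matrix unit attached to a sign. -/
def signMat (b : Bool) : Mat2 := if b then !![0, 1; 0, 0] else !![0, 0; 1, 0]

theorem mat2_add_self (a : Mat2) : a + a = 0 := by
  ext i j; exact CharTwo.add_self_eq_zero _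

theorem swapMat_mul_self : swapMat * swapMat = 1 := by decide

theorem signMat_comm (b : Bool) : swapMat * signMat b + signMat b * swapMat = 1 := by
  cases b <;> decide

theorem signMat_not (b : Bool) : signMat (!b) = swapMat * signMat b * swapMat := by
  cases b <;> decide

theorem signMat_add_not (b : Bool) : signMat b + signMat (!b) = swapMat := by
  cases b <;> decide

theorem signMat_mul_self (b : Bool) : signMat b * signMat b = 0 := by
  cases b <;> decide

/-- The product of the matrices of a word of signs. -/
def wordMat (l : List Bool) : Mat2 := (l.map signMat).prod

/-- Deleting a letter b replaces its matrix by 1 = S·E_b + E_b·S, where S is the swap matrix. The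
sum over all positions telescopes modulo 2, and only the terms with S at the two ends survive. -/
theorem cobd_wordMat (l : List Bool) :
    cobd wordMat l = swapMat * wordMat l + wordMat l * swapMat := by
  -- The left factor a carries the letters already read, so that the induction goes through.
  suffices h : ∀ a : Mat2, cobd (fun l => a * wordMat l) l =
      a * (swapMat * wordMat l + wordMat l * swapMat) by simpa using h 1
  induction l with
  | nil => intro a; simp [wordMat, cobd_nil, mat2_add_self]
  | cons b l ih =>
    intro a
    have h1 : ∀ q, wordMat (b :: q) = signMat b * wordMat q := fun q => by simp [wordMat]
    rw [cobd_cons]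
    simp only [h1, ← mul_assoc]
    rw [ih]
    have h2 : wordMat l = (swapMat * signMat b + signMat b * swapMat) * wordMat l := by
      rw [signMat_comm, one_mul]
    calc a * wordMat l + a * signMat b * (swapMat * wordMat l + wordMat l * swapMat)
        = a * ((swapMat * signMat b + signMat b * swapMat) * wordMat l)
          + a * signMat b * (swapMat * wordMat l + wordMat l * swapMat) := by rw [← h2]
      _ = a * swapMat * signMat b * wordMat l + a * signMat b * wordMat l * swapMat
          + (a * signMat b * swapMat * wordMat l + a * signMat b * swapMat * wordMat l) := by
          noncomm_ring
      _ = _ := by rw [mat2_add_self]; noncomm_ring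

theorem wordMat_not (l : List Bool) :
    wordMat (l.map (!·)) = swapMat * wordMat l * swapMat := by
  induction l with
  | nil => simp [wordMat, swapMat_mul_self]
  | cons b l ih =>
    have h1 : ∀ b q, wordMat (b :: q) = signMat b * wordMat q := fun b q => by simp [wordMat]
    rw [List.map_cons, h1, h1, ih, signMat_not]
    calc swapMat * signMat b * swapMat * (swapMat * wordMat l * swapMat)
        = swapMat * signMat b * (swapMat * swapMat) * wordMat l * swapMat := by noncomm_ring
      _ = _ := by rw [swapMat_mul_self]; noncomm_ring

theorem wordMat_eq_zero_of_infix {l : List Bool} {b : Bool} (h : [b, b] <:+: l) :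
    wordMat l = 0 := by
  obtain ⟨s, t, rfl⟩ := h
  simp [wordMat, ← mul_assoc, signMat_mul_self]

/-- The opposite label. -/
def flipLabel {m : ℕ} (a : Fin m ×ₗ Bool) : Fin m ×ₗ Bool := toLex ((ofLex a).1, !(ofLex a).2)

/-- The matrix of the signs of a list of labels, read in increasing order of the labels. -/
def labelMat {m : ℕ} (l : List (Fin m ×ₗ Bool)) : Mat2 :=
  wordMat ((l.insertionSort (· ≤ ·)).map fun a => (ofLex a).2)

theorem insertionSort_eq_of_perm {α : Type*} [LinearOrder α] {l l' : List α} (h : l.Perm l') :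
    l.insertionSort (· ≤ ·) = l'.insertionSort (· ≤ ·) :=
  (((List.perm_insertionSort _ l).trans h).trans
    (List.perm_insertionSort _ l').symm).eq_of_pairwise (fun _ _ _ _ h1 h2 => le_antisymm h1 h2)
    (List.pairwise_insertionSort _ l) (List.pairwise_insertionSort _ l')

theorem mem_faces_sublist {V : Type*} {l q : List V} (h : q ∈ faces l) : q.Sublist l := by
  induction l generalizing q with
  | nil => simp [faces] at h
  | cons x l ih =>
    simp only [faces, List.mem_cons, List.mem_map] at h
    rcases h with rfl | ⟨q, hq, rfl⟩
    · exact List.sublist_cons_self _ _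
    · exact (ih hq).cons_cons x

/-- The cochain is symmetric in the vertices, so the list may be sorted first; faces of a sorted
list are sorted, which reduces the claim to words of signs. -/
theorem cobd_labelMat {m : ℕ} (l : List (Fin m ×ₗ Bool)) :
    cobd labelMat l = swapMat * labelMat l + labelMat l * swapMat := by
  rw [cobd_perm (List.perm_insertionSort (· ≤ ·) l).symm labelMat
    (fun a b hab => by rw [labelMat, labelMat, insertionSort_eq_of_perm hab])]
  conv_rhs => rw [labelMat, ← cobd_wordMat, cobd_map]
  refine pair_congr fun q hq => ?_
  rw [labelMat, (List.pairwise_insertionSort (· ≤ ·) l).sublist (mem_faces_sublist hq)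
    |>.insertionSort_eq]

/-- Without complementary pairs, two labels with the same index are equal, so flipping all signs
preserves the sorted order and only negates the word of signs. -/
theorem labelMat_flip {m : ℕ} {l : List (Fin m ×ₗ Bool)}
    (hl : ∀ a ∈ l, ∀ b ∈ l, a ≠ flipLabel b) :
    labelMat (l.map flipLabel) = swapMat * labelMat l * swapMat := by
  have h1 : (l.map flipLabel).insertionSort (· ≤ ·) =
      (l.insertionSort (· ≤ ·)).map flipLabel := by
    refine ((List.perm_insertionSort _ _).trans
      ((List.perm_insertionSort (· ≤ ·) l).map flipLabel).symm).eq_of_pairwise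
      (fun _ _ _ _ h1 h2 => le_antisymm h1 h2) (List.pairwise_insertionSort _ _) ?_
    rw [List.pairwise_map]
    refine (List.pairwise_insertionSort (· ≤ ·) l).imp_of_mem fun {a b} ha hb hab => ?_
    rw [List.mem_insertionSort] at ha hb
    rcases Prod.Lex.le_iff.1 hab with h | ⟨h, h'⟩
    · exact Prod.Lex.le_iff.2 (Or.inl h)
    · have h3 : (ofLex a).2 = (ofLex b).2 := by
        by_contra hne
        apply hl a ha b hb
        apply ofLex.injective
        refine Prod.ext h ?_
        simp only [flipLabel, ofLex_toLex]
        revert hne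
        cases (ofLex a).2 <;> cases (ofLex b).2 <;> simp
      refine Prod.Lex.le_iff.2 (Or.inr ⟨h, ?_⟩)
      simp [flipLabel, h3]
  rw [labelMat, h1, labelMat, ← wordMat_not, List.map_map, List.map_map]
  rfl

theorem exists_infix_of_not_nodup {α : Type*} [LinearOrder α] {l : List α}
    (hs : l.Pairwise (· ≤ ·)) (h : ¬ l.Nodup) : ∃ a, [a, a] <:+: l := by
  induction l with
  | nil => simp at h
  | cons x l ih =>
    rw [List.pairwise_cons] at hs
    by_cases hx : x ∈ l
    · cases l with
      | nil => simp at hx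
      | cons y l =>
        have hxy : x ≤ y := hs.1 y (by simp)
        have hyx : y ≤ x := by
          rcases List.mem_cons.1 hx with h | h
          · exact h.ge
          · exact (List.pairwise_cons.1 hs.2).1 x h
        obtain rfl := le_antisymm hxy hyx
        exact ⟨x, [], l, rfl⟩
    · rw [List.nodup_cons] at h
      obtain ⟨a, ha⟩ := ih hs.2 (fun h' => h ⟨hx, h'⟩)
      exact ⟨a, ha.trans (List.suffix_cons x l).isInfix⟩

/-- By the pigeonhole principle some index repeats, and without complementary pairs the whole label
repeats. After sorting, two equal signs are adjacent, and the square of a sign matrix is zero. -/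
theorem labelMat_eq_zero {m : ℕ} {l : List (Fin m ×ₗ Bool)}
    (hl : ∀ a ∈ l, ∀ b ∈ l, a ≠ flipLabel b) (hm : m < l.length) : labelMat l = 0 := by
  have hnd : ¬ l.Nodup := by
    intro hnd
    have h1 : (l.map fun a => (ofLex a).1).Nodup := by
      rw [List.nodup_map_iff_inj_on hnd]
      intro a ha b hb hab
      by_contra hne
      apply hl a ha b hb
      apply ofLex.injective
      refine Prod.ext hab ?_
      simp only [flipLabel, ofLex_toLex]
      have : (ofLex a).2 ≠ (ofLex b).2 := fun h => hne (ofLex.injective (Prod.ext hab h))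
      revert this
      cases (ofLex a).2 <;> cases (ofLex b).2 <;> simp
    have := h1.length_le_card
    simp at this
    omega
  obtain ⟨a, ha⟩ := exists_infix_of_not_nodup (List.pairwise_insertionSort (· ≤ ·) l)
    (fun h => hnd ((List.perm_insertionSort _ l).nodup_iff.1 h))
  refine wordMat_eq_zero_of_infix (b := (ofLex a).2) ?_
  simpa using ha.map fun a => (ofLex a).2

/-- Tucker's lemma for a sequence of chains modelling the hemispheres of an antipodal sphere. -/
theorem exists_complementary {V : Type*} {m n : ℕ} (hmn : m ≤ n) (T : V → V)
    (lab : V → Fin m ×ₗ Bool) (h : ℕ → List (List V)) (e : V) (h0 : h 0 = [[e]])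
    (hT : ∀ k ≤ n, ∀ l ∈ h k, ∀ x ∈ l, lab (T x) = flipLabel (lab x))
    (hbd : ∀ k < n, ∀ φ : List V → Mat2,
      pair (h (k + 1)) (cobd φ) = pair (h k) φ + pair (h k) fun l => φ (l.map T))
    (hlen : ∀ l ∈ h n, l.length = n + 1) :
    ∃ k ≤ n, ∃ l ∈ h k, ∃ x ∈ l, ∃ y ∈ l, lab x = flipLabel (lab y) := by
  by_contra hcon
  push Not at hcon
  set w : List V → Mat2 := fun l => labelMat (l.map lab) with hw
  have hflip : ∀ k ≤ n, pair (h k) (fun l => w (l.map T)) =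
      swapMat * pair (h k) w * swapMat := by
    intro k hk
    have h1 : pair (h k) (fun l => w (l.map T)) = pair (h k) fun l => swapMat * w l * swapMat := by
      refine pair_congr fun l hl => ?_
      rw [hw]
      beta_reduce
      rw [← labelMat_flip, List.map_map, List.map_map]
      · congr 1
        refine List.map_congr_left fun x hx => ?_
        exact hT k hk l hl x hx
      · simp only [List.mem_map]
        rintro _ ⟨x, hx, rfl⟩ _ ⟨y, hy, rfl⟩
        exact hcon k hk l hl x hx y hy
    rw [h1, pair, pair, ← List.sum_map_mul_left, ← List.sum_map_mul_right]
  have hcobd : ∀ l : List V, cobd w l = swapMat * w l + w l * swapMat := by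
    intro l
    rw [hw]
    beta_reduce
    rw [← cobd_labelMat, cobd_map]
  have hpc : ∀ k, pair (h k) (cobd w) = swapMat * pair (h k) w + pair (h k) w * swapMat := by
    intro k
    rw [pair_congr (fun l _ => hcobd l), pair_add, pair, pair, pair, ← List.sum_map_mul_left,
      ← List.sum_map_mul_right]
  -- With W_k the value of w on the k-th hemisphere and S the swap matrix, the boundary relation
  -- reads S W_(k+1) + W_(k+1) S = W_k + S W_k S; multiplying by S on the left gives the recursion.
  have hz : ∀ k ≤ n, pair (h k) w + swapMat * pair (h k) w * swapMat = swapMat ^ (k + 1) := by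
    intro k
    induction k with
    | zero =>
      intro _
      have h1 : w [e] = signMat (ofLex (lab e)).2 := by simp [hw, labelMat, wordMat]
      rw [h0, pair_cons, pair_nil, add_zero, h1, ← signMat_not, signMat_add_not, zero_add, pow_one]
    | succ k ih =>
      intro hk
      have h1 := hbd k (by omega) w
      rw [hpc, hflip k (by omega), ih (by omega)] at h1
      calc _ = (swapMat * swapMat) * pair (h (k + 1)) w + swapMat * pair (h (k + 1)) w * swapMat := by
            rw [swapMat_mul_self, one_mul]
        _ = swapMat * (swapMat * pair (h (k + 1)) w + pair (h (k + 1)) w * swapMat) := by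
            noncomm_ring
        _ = _ := by rw [h1, pow_succ' swapMat (k + 1)]
  -- A top simplex has n + 1 > m vertices, so W_n = 0, whereas the recursion makes a power of the
  -- invertible swap matrix out of it.
  have hw0 : pair (h n) w = 0 := by
    rw [← pair_zero (h n)]
    refine pair_congr fun l hl => labelMat_eq_zero ?_ ?_
    · simp only [List.mem_map]
      rintro _ ⟨x, hx, rfl⟩ _ ⟨y, hy, rfl⟩
      exact hcon n le_rfl l hl x hx y hy
    · rw [List.length_map, hlen l hl]; omega
  have h3 := hz n le_rfl
  rw [hw0, mul_zero, zero_mul, add_zero] at h3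
  have h4 : IsUnit (swapMat ^ (n + 1)) :=
    (IsUnit.of_mul_eq_one (a := swapMat) swapMat swapMat_mul_self).pow _
  rw [← h3] at h4
  exact not_isUnit_zero h4

end Labels

/-! ### Subdivided hemispheres and the Borsuk–Ulam theorem -/

section Sphere

theorem mem_prism {V W : Type*} {g g' : V → W} {l : List V} {q : List W} (h : q ∈ prism g g' l) :
    q.length = l.length + 1 ∧ ∀ y ∈ q, ∃ x ∈ l, y = g x ∨ y = g' x := by
  induction l generalizing q with
  | nil => simp [prism] at h
  | cons x l ih =>
    simp only [prism, List.mem_cons, List.mem_map] at h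
    rcases h with rfl | ⟨q, hq, rfl⟩
    · refine ⟨by simp, fun y hy => ?_⟩
      simp only [List.mem_cons, List.mem_map] at hy
      rcases hy with rfl | rfl | ⟨z, hz, rfl⟩
      · exact ⟨x, by simp, Or.inl rfl⟩
      · exact ⟨x, by simp, Or.inr rfl⟩
      · exact ⟨z, by simp [hz], Or.inr rfl⟩
    · obtain ⟨h1, h2⟩ := ih hq
      refine ⟨by simp [h1], fun y hy => ?_⟩
      rcases List.mem_cons.1 hy with rfl | hy
      · exact ⟨x, by simp, Or.inl rfl⟩
      · obtain ⟨z, hz, h⟩ := h2 y hy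
        exact ⟨z, by simp [hz], h⟩

theorem sum_range_telescope_two {M : Type*} [AddCommMonoid M] (h2 : ∀ a : M, a + a = 0)
    (a : ℕ → M) (n : ℕ) : ((List.range n).map fun j => a j + a (j + 1)).sum = a 0 + a n := by
  induction n with
  | zero => simp [h2]
  | succ n ih =>
    rw [List.range_succ, List.map_append, List.sum_append, ih]
    simp only [List.map_cons, List.map_nil, List.sum_cons, List.sum_nil, add_zero]
    rw [add_assoc, ← add_assoc (a n), h2, zero_add]

variable {E : Type*} [NormedAddCommGroup E] [InnerProductSpace ℝ E]

/-- The map moving the unit sphere towards the pole `v` along meridians, at time `j / M`. -/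
noncomputable def meridian (v : E) (M j : ℕ) (x : E) : E :=
  Real.cos (Real.pi / 2 * (j / M)) • x + Real.sin (Real.pi / 2 * (j / M)) • v

/-- Finely subdivided hemispheres, spanned successively by the vectors `e 0, e 1, …`. -/
noncomputable def hemisphere (e : ℕ → E) (M : ℕ) : ℕ → List (List E)
  | 0 => [[e 0]]
  | k + 1 => (List.range M).flatMap fun j =>
      (hemisphere e M k ++ (hemisphere e M k).map (List.map Neg.neg)).flatMap
        (prism (meridian (e (k + 1)) M j) (meridian (e (k + 1)) M (j + 1)))

/-- The boundary of a hemisphere is the sphere one dimension lower. The prism homotopies over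
successive times telescope, and their side terms vanish because the lower sphere is a cycle (`hc`).
At time M everything has collapsed to the pole, so the two halves of the sphere give equal terms
that cancel modulo 2. -/
theorem pair_hemisphere_succ {A : Type*} [AddCommMonoid A] (h2 : ∀ a : A, a + a = 0)
    (e : ℕ → E) {M : ℕ} (hM : 0 < M) (k : ℕ)
    (hc : ∀ ψ : List E → A, pair (hemisphere e M k) (cobd ψ) +
      pair (hemisphere e M k) (cobd fun l => ψ (l.map Neg.neg)) = 0) (φ : List E → A) :
    pair (hemisphere e M (k + 1)) (cobd φ) =
      pair (hemisphere e M k) φ + pair (hemisphere e M k) fun l => φ (l.map Neg.neg) := by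
  set c := hemisphere e M k ++ (hemisphere e M k).map (List.map Neg.neg) with hcdef
  set g : ℕ → E → E := meridian (e (k + 1)) M with hg
  have hpc : ∀ ψ : List E → A, pair c ψ =
      pair (hemisphere e M k) ψ + pair (hemisphere e M k) fun l => ψ (l.map Neg.neg) := by
    intro ψ
    rw [hcdef, pair_append, pair_map]
  have h1 : pair (hemisphere e M (k + 1)) (cobd φ) =
      ((List.range M).map fun j => pair c (fun l => φ (l.map (g j))) +
        pair c (fun l => φ (l.map (g (j + 1))))).sum := by
    have h3 : ∀ r : List ℕ, pair (r.flatMap fun j => c.flatMap (prism (g j) (g (j + 1))))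
        (cobd φ) = (r.map fun j => pair c (fun l => φ (l.map (g j))) +
          pair c (fun l => φ (l.map (g (j + 1))))).sum := by
      intro r
      induction r with
      | nil => simp
      | cons j r ih =>
        rw [List.flatMap_cons, pair_append, ih, List.map_cons, List.sum_cons]
        congr 1
        rw [pair_flatMap, ← pair_add]
        rw [← pair_congr (fun l _ => prism_homotopy h2 (g j) (g (j + 1)) l φ), pair_add]
        have h4 : pair c (fun l => cobd (fun q => pair (prism (g j) (g (j + 1)) q) φ) l) = 0 := by
          rw [hpc]
          simp only [cobd_map]
          exact hc _
        rw [h4, add_zero]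
    exact h3 _
  rw [h1, sum_range_telescope_two h2 fun j => pair c (fun l => φ (l.map (g j)))]
  have h5 : g 0 = id := by
    ext x
    simp [hg, meridian]
  have h6 : g M = fun _ => e (k + 1) := by
    ext x
    have : (M : ℝ) ≠ 0 := by positivity
    simp [hg, meridian, this]
  have h7 : pair c (fun l => φ (l.map (g M))) = 0 := by
    rw [hpc, h6]
    simp only [List.map_map]
    exact h2 _
  rw [h7, add_zero, hpc, h5]
  simp

theorem pair_hemisphere_cycle {A : Type*} [AddCommMonoid A] (h2 : ∀ a : A, a + a = 0)
    (e : ℕ → E) {M : ℕ} (hM : 0 < M) (k : ℕ) (ψ : List E → A) :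
    pair (hemisphere e M k) (cobd ψ) +
      pair (hemisphere e M k) (cobd fun l => ψ (l.map Neg.neg)) = 0 := by
  induction k generalizing ψ with
  -- The chain complex is augmented: the only face of a vertex is the empty list, and the two
  -- contributions cancel.
  | zero => simp [hemisphere, cobd_cons, cobd_nil, h2]
  | succ k ih =>
    rw [pair_hemisphere_succ h2 e hM k ih, pair_hemisphere_succ h2 e hM k ih]
    have : ∀ l : List E, (l.map Neg.neg).map Neg.neg = l := fun l => by simp
    simp only [this]
    rw [add_comm (pair (hemisphere e M k) fun l => ψ (l.map Neg.neg))]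
    exact h2 _

/-- Neighbouring times differ by an angle at most π/(2M) ≤ 2/M; sine and cosine are 1-Lipschitz and
contribute 2/M each. -/
theorem norm_meridian_sub_le {v x y : E} (hv : ‖v‖ = 1) (hy : ‖y‖ = 1) (M i j : ℕ)
    (hij : |(i : ℝ) - j| ≤ 1) :
    ‖meridian v M i x - meridian v M j y‖ ≤ ‖x - y‖ + 4 / M := by
  set s := Real.pi / 2 * (i / M) with hs
  set t := Real.pi / 2 * (j / M) with ht
  have hst : |s - t| ≤ 2 / M := by
    have : s - t = Real.pi / 2 / M * ((i : ℝ) - j) := by rw [hs, ht]; ring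
    rw [this, abs_mul, abs_of_nonneg (by positivity)]
    calc Real.pi / 2 / M * |(i : ℝ) - j| ≤ Real.pi / 2 / M * 1 := by gcongr
      _ ≤ 2 / M := by rw [mul_one]; gcongr; linarith [Real.pi_le_four]
  have hc : |Real.cos s - Real.cos t| ≤ 2 / M := (Real.abs_cos_sub_cos_le s t).trans hst
  have hsn : |Real.sin s - Real.sin t| ≤ 2 / M := (Real.abs_sin_sub_sin_le s t).trans hst
  have h1 : meridian v M i x - meridian v M j y = Real.cos s • (x - y) +
      (Real.cos s - Real.cos t) • y + (Real.sin s - Real.sin t) • v := by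
    simp only [meridian, ← hs, ← ht]
    module
  rw [h1]
  calc _ ≤ ‖Real.cos s • (x - y)‖ + ‖(Real.cos s - Real.cos t) • y‖ +
        ‖(Real.sin s - Real.sin t) • v‖ := norm_add₃_le
    _ ≤ 1 * ‖x - y‖ + 2 / M + 2 / M := by
        rw [norm_smul, norm_smul, norm_smul, hv, hy, mul_one, mul_one]
        simp only [Real.norm_eq_abs]
        gcongr
        exact Real.abs_cos_le_one s
    _ = _ := by ring

theorem norm_meridian {v x : E} (hv : ‖v‖ = 1) (hx : ‖x‖ = 1) (hxv : inner ℝ x v = 0) (M j : ℕ) :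
    ‖meridian v M j x‖ = 1 := by
  rw [← sq_eq_sq₀ (norm_nonneg _) zero_le_one, meridian, norm_add_sq_real, norm_smul, norm_smul,
    inner_smul_left, inner_smul_right, hxv, hv, hx]
  simp

/-- The three invariants are proved together: orthogonality to the later poles keeps the next
meridians on the sphere, and each prism construction adds at most 4/M to the diameter of a simplex.
-/
theorem mem_hemisphere {e : ℕ → E} {M n : ℕ}
    (he : ∀ i ≤ n, ∀ j ≤ n, inner ℝ (e i) (e j) = if i = j then (1 : ℝ) else 0)
    {k : ℕ} (hk : k ≤ n) {l : List E} (hl : l ∈ hemisphere e M k) :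
    l.length = k + 1 ∧ (∀ x ∈ l, ‖x‖ = 1 ∧ ∀ i ≤ n, k < i → inner ℝ x (e i) = 0) ∧
      ∀ x ∈ l, ∀ y ∈ l, ‖x - y‖ ≤ k * (4 / M) := by
  have hn : ∀ i ≤ n, ‖e i‖ = 1 := fun i hi => by
    rw [← sq_eq_sq₀ (norm_nonneg _) zero_le_one, ← real_inner_self_eq_norm_sq, he i hi i hi]
    simp
  induction k generalizing l with
  | zero =>
    simp only [hemisphere, List.mem_singleton] at hl
    subst hl
    refine ⟨rfl, ?_, ?_⟩
    · simp only [List.mem_singleton, forall_eq]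
      refine ⟨hn 0 hk, fun i hi h0 => ?_⟩
      rw [he 0 hk i hi, if_neg (by omega)]
    · simp
  | succ k ih =>
    simp only [hemisphere, List.mem_flatMap, List.mem_append, List.mem_map] at hl
    obtain ⟨j, -, l', hl', hl⟩ := hl
    have hP : l'.length = k + 1 ∧ (∀ x ∈ l', ‖x‖ = 1 ∧ ∀ i ≤ n, k < i → inner ℝ x (e i) = 0) ∧
        ∀ x ∈ l', ∀ y ∈ l', ‖x - y‖ ≤ k * (4 / M) := by
      rcases hl' with hl' | ⟨l'', hl'', rfl⟩
      · exact ih (by omega) hl'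
      · obtain ⟨h1, h2, h3⟩ := ih (by omega) hl''
        refine ⟨by simpa using h1, ?_, ?_⟩
        · simp only [List.mem_map]
          rintro _ ⟨x, hx, rfl⟩
          refine ⟨by rw [norm_neg]; exact (h2 x hx).1, fun i hi hki => ?_⟩
          rw [inner_neg_left, (h2 x hx).2 i hi hki, neg_zero]
        · simp only [List.mem_map]
          rintro _ ⟨x, hx, rfl⟩ _ ⟨y, hy, rfl⟩
          rw [neg_sub_neg, norm_sub_rev]
          exact h3 x hx y hy
    obtain ⟨h1, h2, h3⟩ := hP
    obtain ⟨q1, q2⟩ := mem_prism hl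
    have q3 : ∀ y ∈ l, ∃ x ∈ l', ∃ i : ℕ, (i = j ∨ i = j + 1) ∧
        y = meridian (e (k + 1)) M i x := by
      intro y hy
      obtain ⟨x, hx, rfl | rfl⟩ := q2 y hy
      exacts [⟨x, hx, j, Or.inl rfl, rfl⟩, ⟨x, hx, j + 1, Or.inr rfl, rfl⟩]
    refine ⟨by rw [q1, h1], fun y hy => ?_, fun y hy z hz => ?_⟩
    · obtain ⟨x, hx, i, -, rfl⟩ := q3 y hy
      obtain ⟨hx1, hx2⟩ := h2 x hx
      refine ⟨norm_meridian (hn _ hk) hx1 (hx2 _ hk (by omega)) M i, fun i' hi' hki => ?_⟩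
      rw [meridian, inner_add_left, inner_smul_left, inner_smul_left, hx2 i' hi' (by omega),
        he _ hk i' hi', if_neg (by omega)]
      simp
    · obtain ⟨x, hx, i, hi, rfl⟩ := q3 y hy
      obtain ⟨x', hx', i', hi', rfl⟩ := q3 z hz
      have h4 : |(i : ℝ) - i'| ≤ 1 := by
        rcases hi with rfl | rfl <;> rcases hi' with rfl | rfl <;> simp
      refine (norm_meridian_sub_le (hn _ hk) (h2 x' hx').1 M i i' h4).trans ?_
      have := h3 x hx x' hx'
      push_cast
      linarith

/-- The Borsuk–Ulam theorem. -/
theorem borsuk_ulam (n : ℕ) (f : EuclideanSpace ℝ (Fin (n + 1)) → Fin n → ℝ)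
    (hf : ContinuousOn f (Metric.sphere 0 1))
    (hodd : ∀ x ∈ Metric.sphere (0 : EuclideanSpace ℝ (Fin (n + 1))) 1, f (-x) = -f x) :
    ∃ x ∈ Metric.sphere (0 : EuclideanSpace ℝ (Fin (n + 1))) 1, f x = 0 := by
  by_contra! hne
  have hS : IsCompact (Metric.sphere (0 : EuclideanSpace ℝ (Fin (n + 1))) 1) := isCompact_sphere 0 1
  have hSne : (Metric.sphere (0 : EuclideanSpace ℝ (Fin (n + 1))) 1).Nonempty :=
    ⟨EuclideanSpace.single 0 1, by simp⟩
  obtain ⟨x₀, hx₀, hmin⟩ := hS.exists_isMinOn hSne hf.norm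
  set c := ‖f x₀‖ with hc
  have hc0 : 0 < c := norm_pos_iff.2 (hne x₀ hx₀)
  have hcle : ∀ x ∈ Metric.sphere (0 : EuclideanSpace ℝ (Fin (n + 1))) 1, c ≤ ‖f x‖ :=
    fun x hx => hmin hx
  have hnonempty : Nonempty (Fin n) := by
    by_contra h
    rw [not_nonempty_iff] at h
    exact hne x₀ hx₀ (Subsingleton.elim _ _)
  have hex : ∀ x ∈ Metric.sphere (0 : EuclideanSpace ℝ (Fin (n + 1))) 1, ∃ i, c ≤ |f x i| := by
    intro x hx
    by_contra! h
    exact absurd (hcle x hx) (not_le.2 ((pi_norm_lt_iff hc0).2 h))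
  obtain ⟨δ, hδ, huc⟩ := Metric.uniformContinuousOn_iff.1
    (hS.uniformContinuousOn_of_continuous hf) c hc0
  -- The choice depends only on the absolute values of the coordinates, so antipodal points get the
  -- same index and labels flip exactly.
  let idx : (Fin n → ℝ) → Fin n := fun b => Classical.epsilon fun i => c ≤ |b i|
  have hidx : ∀ x ∈ Metric.sphere (0 : EuclideanSpace ℝ (Fin (n + 1))) 1,
      c ≤ |f x (idx (f x))| := fun x hx => Classical.epsilon_spec (hex x hx)
  have hidx_neg : ∀ b, idx (-b) = idx b := fun b => by simp [idx]
  let lab : EuclideanSpace ℝ (Fin (n + 1)) → Fin n ×ₗ Bool := fun x =>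
    toLex (idx (f x), decide (0 < f x (idx (f x))))
  -- This M makes the mesh n · 4/M smaller than the modulus of continuity δ.
  obtain ⟨M, hM⟩ := exists_nat_gt (4 * n / δ)
  have hM0 : 0 < M := by
    have : (0 : ℝ) < M := lt_of_le_of_lt (by positivity) hM
    exact_mod_cast this
  let e : ℕ → EuclideanSpace ℝ (Fin (n + 1)) := fun i => EuclideanSpace.single (Fin.ofNat (n + 1) i) 1
  have he : ∀ i ≤ n, ∀ j ≤ n, inner ℝ (e i) (e j) = if i = j then (1 : ℝ) else 0 := by
    intro i hi j hj
    have h1 : (Fin.ofNat (n + 1) i = Fin.ofNat (n + 1) j) ↔ i = j := by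
      rw [Fin.ext_iff, Fin.val_ofNat, Fin.val_ofNat, Nat.mod_eq_of_lt (by omega),
        Nat.mod_eq_of_lt (by omega)]
    by_cases hij : i = j
    · subst hij
      simp [e]
    · have : Fin.ofNat (n + 1) i ≠ Fin.ofNat (n + 1) j := fun h => hij (h1.1 h)
      simpa [e, hij, EuclideanSpace.inner_single_left] using this
  have hmem : ∀ k ≤ n, ∀ l ∈ hemisphere e M k, ∀ x ∈ l,
      x ∈ Metric.sphere (0 : EuclideanSpace ℝ (Fin (n + 1))) 1 := fun k hk l hl x hx =>
    mem_sphere_zero_iff_norm.2 ((mem_hemisphere he hk hl).2.1 x hx).1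
  obtain ⟨k, hk, l, hl, x, hx, y, hy, hxy⟩ := exists_complementary le_rfl Neg.neg lab
    (hemisphere e M) (e 0) rfl
    (by
      intro k hk l hl x hx
      have hxS := hmem k hk l hl x hx
      have hi := hidx x hxS
      simp only [lab, flipLabel, ofLex_toLex, hodd x hxS, hidx_neg, Pi.neg_apply]
      congr 2
      have h0 : f x (idx (f x)) ≠ 0 := abs_pos.1 (hc0.trans_le hi)
      rcases lt_or_gt_of_ne h0 with h | h
      · simp [h, not_lt.2 h.le]
      · simp [h, h.le])
    (fun k _ φ => pair_hemisphere_succ mat2_add_self e hM0 k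
      (pair_hemisphere_cycle mat2_add_self e hM0 k) φ)
    (fun l hl => (mem_hemisphere he le_rfl hl).1)
  have hxS := hmem k hk l hl x hx
  have hyS := hmem k hk l hl y hy
  have hd : dist x y < δ := by
    rw [dist_eq_norm]
    refine ((mem_hemisphere he hk hl).2.2 x hx y hy).trans_lt ?_
    have hMp : (0 : ℝ) < M := by exact_mod_cast hM0
    rw [div_lt_iff₀ hδ] at hM
    rw [mul_div_assoc', div_lt_iff₀ hMp]
    have : (k : ℝ) ≤ n := by exact_mod_cast hk
    nlinarith
  have h1 := huc x hxS y hyS hd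
  have h2 := ofLex.injective.eq_iff.2 hxy
  simp only [lab, flipLabel, ofLex_toLex, Prod.mk.injEq] at h2
  have h3 := hidx x hxS
  have h4 := hidx y hyS
  rw [← h2.1] at h4
  have h5 := (dist_pi_lt_iff hc0).1 h1 (idx (f x))
  rw [Real.dist_eq] at h5
  rw [← h2.1] at h2
  replace h2 := h2.2
  generalize f x (idx (f x)) = a at *
  generalize f y (idx (f x)) = b at *
  -- Complementary labels give a common coordinate with opposite signs and absolute values at least
  -- c, contradicting |a - b| < c.
  by_cases ha : 0 < a <;> by_cases hb : 0 < b <;> simp [ha, hb] at h2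
  · rw [abs_of_nonpos (not_lt.1 hb)] at h4
    rw [abs_of_pos ha] at h3
    linarith [le_abs_self (a - b)]
  · rw [abs_of_nonpos (not_lt.1 ha)] at h3
    rw [abs_of_pos hb] at h4
    linarith [neg_abs_le (a - b)]

end Sphere

/-! ### The power nonlinearity -/

section Pointwise

/-- The odd power function `t ↦ |t|^(p-2) t`. -/
noncomputable def oddPow (p t : ℝ) : ℝ := |t| ^ (p - 2) * t

variable {p : ℝ}

theorem hasDerivAt_oddPow (hp : 2 < p) (t : ℝ) :
    HasDerivAt (oddPow p) ((p - 1) * |t| ^ (p - 2)) t := by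
  rcases eq_or_ne t 0 with rfl | ht
  · rw [hasDerivAt_iff_tendsto_slope_zero]
    have h1 : Filter.Tendsto (fun t : ℝ => |t| ^ (p - 2)) (nhdsWithin 0 {0}ᶜ) (nhds 0) := by
      have h2 : ContinuousAt (fun t : ℝ => |t| ^ (p - 2)) 0 :=
        continuous_abs.continuousAt.rpow_const (Or.inr (by linarith))
      have h3 := h2.tendsto
      rw [abs_zero, Real.zero_rpow (by linarith)] at h3
      exact h3.mono_left nhdsWithin_le_nhds
    have h0 : (p - 1) * |(0 : ℝ)| ^ (p - 2) = 0 := by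
      rw [abs_zero, Real.zero_rpow (by linarith), mul_zero]
    rw [h0]
    refine h1.congr' ?_
    filter_upwards [self_mem_nhdsWithin] with s hs
    have hs0 : s ≠ 0 := hs
    simp only [oddPow, zero_add, mul_zero, sub_zero, smul_eq_mul]
    field_simp
  · have h1 := ((hasDerivAt_abs ht).rpow_const (p := p - 2) (Or.inl (abs_ne_zero.2 ht))).mul
      (hasDerivAt_id t)
    refine h1.congr_deriv ?_
    have h2 : |t| ^ (p - 2) = |t| ^ (p - 2 - 1) * |t| := by
      rw [← Real.rpow_add_one (abs_ne_zero.2 ht)]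
      ring_nf
    simp only [id, mul_one]
    rw [h2]
    have h3 : (SignType.sign t : ℝ) * t = |t| := by
      rcases lt_or_gt_of_ne ht with h | h
      · simp [h, abs_of_neg h]
      · simp [h, abs_of_pos h]
    linear_combination (p - 2) * |t| ^ (p - 2 - 1) * h3

theorem continuous_oddPow (hp : 2 < p) : Continuous (oddPow p) :=
  continuous_iff_continuousAt.2 fun t => (hasDerivAt_oddPow hp t).continuousAt

theorem oddPow_neg (t : ℝ) : oddPow p (-t) = -oddPow p t := by simp [oddPow]

theorem abs_oddPow (t : ℝ) : |oddPow p t| = |t| ^ (p - 2) * |t| := by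
  rw [oddPow, abs_mul, abs_of_nonneg (by positivity)]

theorem oddPow_mul_self (hp : 2 < p) (t : ℝ) : oddPow p t * t = |t| ^ p := by
  rw [oddPow, mul_assoc, ← sq, ← sq_abs, ← Real.rpow_two,
    ← Real.rpow_add_of_nonneg (abs_nonneg t) (by linarith) (by norm_num)]
  ring_nf

theorem abs_oddPow_sub_le (hp : 2 < p) (a b : ℝ) :
    |oddPow p a - oddPow p b| ≤ (p - 1) * (|a| + |b|) ^ (p - 2) * |a - b| := by
  have h := Convex.norm_image_sub_le_of_norm_hasDerivWithin_le (𝕜 := ℝ) (f := oddPow p)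
    (f' := fun t => (p - 1) * |t| ^ (p - 2)) (s := Set.uIcc b a) (x := b) (y := a)
    (C := (p - 1) * (|a| + |b|) ^ (p - 2))
    (fun t _ => (hasDerivAt_oddPow hp t).hasDerivWithinAt)
    (fun t ht => by
      have ht' : |t| ≤ |a| + |b| := by
        rw [Set.mem_uIcc] at ht
        rw [abs_le]
        rcases ht with ht | ht <;> constructor <;>
        linarith [neg_abs_le a, neg_abs_le b, le_abs_self a, le_abs_self b, abs_nonneg a,
          abs_nonneg b]
      have h1 : (0 : ℝ) ≤ p - 1 := by linarith
      rw [Real.norm_eq_abs, abs_of_nonneg (mul_nonneg h1 (by positivity))]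
      have : 0 ≤ p - 2 := by linarith
      gcongr)
    (convex_uIcc b a) Set.left_mem_uIcc Set.right_mem_uIcc
  simpa only [Real.norm_eq_abs] using h

theorem oddPow_monotone (hp : 2 < p) : Monotone (oddPow p) := by
  refine monotone_of_deriv_nonneg (fun t => (hasDerivAt_oddPow hp t).differentiableAt) fun t => ?_
  rw [(hasDerivAt_oddPow hp t).deriv]
  exact mul_nonneg (by linarith) (by positivity)

theorem oddPow_sub_mul_sub_nonneg (hp : 2 < p) (a b : ℝ) :
    0 ≤ (oddPow p a - oddPow p b) * (a - b) := by
  rcases le_total a b with h | h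
  · exact mul_nonneg_of_nonpos_of_nonpos (by linarith [oddPow_monotone hp h]) (by linarith)
  · exact mul_nonneg (by linarith [oddPow_monotone hp h]) (by linarith)

/-- Mean value inequality for t ↦ |t|^p - p·`oddPow p a`·t between a and a + b: its derivative is p
times a difference of odd powers, which `abs_oddPow_sub_le` controls. This form avoids a second
derivative of |t|^p. -/
theorem abs_rpow_add_sub_le (hp : 2 < p) (a b : ℝ) :
    |(|a + b| ^ p - |a| ^ p - p * (oddPow p a * b))| ≤
      p * (p - 1) * ((|a| + |a| + |b|) ^ (p - 2) * |b| * |b|) := by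
  have h := Convex.norm_image_sub_le_of_norm_hasDerivWithin_le (𝕜 := ℝ)
    (f := fun t => |t| ^ p - p * oddPow p a * t)
    (f' := fun t => p * |t| ^ (p - 2) * t - p * oddPow p a * 1) (s := Set.uIcc a (a + b))
    (x := a) (y := a + b) (C := p * ((p - 1) * (|a| + |a| + |b|) ^ (p - 2) * |b|))
    (fun t _ => ((hasDerivAt_abs_rpow t (by linarith)).sub
      ((hasDerivAt_id t).const_mul (p * oddPow p a))).hasDerivWithinAt)
    (fun t ht => by
      have ht' : |t - a| ≤ |b| := by
        rw [Set.mem_uIcc] at ht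
        rw [abs_le]
        rcases ht with ht | ht <;> constructor <;>
        linarith [neg_abs_le b, le_abs_self b, abs_nonneg b]
      have ht2 : |t| ≤ |a| + |b| := by
        have := abs_sub_abs_le_abs_sub t a
        linarith
      have h1 : p * |t| ^ (p - 2) * t - p * oddPow p a * 1 = p * (oddPow p t - oddPow p a) := by
        simp only [oddPow]; ring
      have h0 : (0 : ℝ) ≤ p := by linarith
      have h2 : (0 : ℝ) ≤ p - 1 := by linarith
      have h3 : (0 : ℝ) ≤ p - 2 := by linarith
      rw [h1, Real.norm_eq_abs, abs_mul, abs_of_nonneg h0]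
      refine mul_le_mul_of_nonneg_left ((abs_oddPow_sub_le hp t a).trans ?_) h0
      have : |t| + |a| ≤ |a| + |a| + |b| := by linarith
      gcongr)
    (convex_uIcc a (a + b)) Set.left_mem_uIcc Set.right_mem_uIcc
  rw [Real.norm_eq_abs, Real.norm_eq_abs] at h
  have e1 : |a + b| ^ p - p * oddPow p a * (a + b) - (|a| ^ p - p * oddPow p a * a) =
      |a + b| ^ p - |a| ^ p - p * (oddPow p a * b) := by ring
  have e2 : a + b - a = b := by ring
  rw [e1, e2] at h
  refine h.trans (le_of_eq (by ring))

end Pointwise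

/-! ### Hölder estimates for the nonlinearity on L^p -/

section Holder

variable {X : Type*} [MeasurableSpace X] {μ : Measure X} {p : ℝ} [Fact (1 ≤ ENNReal.ofReal p)]

theorem Lp_lintegral_rpow (hp : 2 < p) (f : Lp ℝ (ENNReal.ofReal p) μ) :
    ∫⁻ x, ‖f x‖ₑ ^ p ∂μ = ENNReal.ofReal (‖f‖ ^ p) := by
  have h0 : 0 < p := by linarith
  have h1 := eLpNorm_eq_lintegral_rpow_enorm_toReal (μ := μ) (f := f) (p := ENNReal.ofReal p)
    (by simpa using h0) ENNReal.ofReal_ne_top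
  rw [ENNReal.toReal_ofReal h0.le] at h1
  have h2 : ENNReal.ofReal ‖f‖ = (∫⁻ x, ‖f x‖ₑ ^ p ∂μ) ^ (1 / p) := by
    rw [← h1, Lp.norm_def, ENNReal.ofReal_toReal (Lp.eLpNorm_ne_top f)]
  rw [← ENNReal.ofReal_rpow_of_nonneg (norm_nonneg f) h0.le, h2, ← ENNReal.rpow_mul,
    one_div_mul_cancel h0.ne', ENNReal.rpow_one]

/-- Hölder's inequality applied to the p-th powers of the three functions, with weights (p-2)/p,
1/p, 1/p. -/
theorem lintegral_holder_three (hp : 2 < p) (F g h : Lp ℝ (ENNReal.ofReal p) μ) :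
    ∫⁻ x, ENNReal.ofReal (|F x| ^ (p - 2) * |g x| * |h x|) ∂μ ≤
      ENNReal.ofReal (‖F‖ ^ (p - 2) * ‖g‖ * ‖h‖) := by
  have h0 : 0 < p := by linarith
  have key := ENNReal.lintegral_prod_norm_pow_le (μ := μ) (Finset.univ : Finset (Fin 3))
    (f := ![fun x => ‖F x‖ₑ ^ p, fun x => ‖g x‖ₑ ^ p, fun x => ‖h x‖ₑ ^ p])
    (p := ![(p - 2) / p, 1 / p, 1 / p])
    (by
      intro i _
      fin_cases i
      · exact (Lp.aestronglyMeasurable F).enorm.pow_const p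
      · exact (Lp.aestronglyMeasurable g).enorm.pow_const p
      · exact (Lp.aestronglyMeasurable h).enorm.pow_const p)
    (by simp [Fin.sum_univ_three]; field_simp; ring)
    (by
      intro i _
      fin_cases i
      · exact div_nonneg (by linarith) h0.le
      · exact div_nonneg zero_le_one h0.le
      · exact div_nonneg zero_le_one h0.le)
  simp only [Fin.prod_univ_three, Matrix.cons_val_zero, Matrix.cons_val_one,
    Matrix.cons_val, ← ENNReal.rpow_mul, Lp_lintegral_rpow hp] at key
  have e1 : p * ((p - 2) / p) = p - 2 := by field_simp
  have e2 : p * (1 / p) = 1 := by field_simp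
  have e3 : ∀ f : Lp ℝ (ENNReal.ofReal p) μ, ∀ s : ℝ, 0 ≤ s →
      ENNReal.ofReal (‖f‖ ^ p) ^ s = ENNReal.ofReal (‖f‖ ^ (p * s)) := by
    intro f s hs
    rw [ENNReal.ofReal_rpow_of_nonneg (by positivity) hs, Real.rpow_mul (norm_nonneg f)]
  have h2 : 0 ≤ p - 2 := by linarith
  rw [e3 F _ (div_nonneg h2 h0.le), e3 g _ (by positivity), e3 h _ (by positivity), e1, e2] at key
  simp only [ENNReal.rpow_one, Real.rpow_one] at key
  rw [← ENNReal.ofReal_mul (by positivity), ← ENNReal.ofReal_mul (by positivity)] at key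
  refine le_trans (le_of_eq ?_) key
  refine lintegral_congr fun x => ?_
  rw [ENNReal.ofReal_mul (by positivity), ENNReal.ofReal_mul (by positivity),
    ← ENNReal.ofReal_rpow_of_nonneg (abs_nonneg _) h2]
  simp only [← Real.norm_eq_abs, ofReal_norm]

theorem integrable_holder_three (hp : 2 < p) (F g h : Lp ℝ (ENNReal.ofReal p) μ) :
    Integrable (fun x => |F x| ^ (p - 2) * |g x| * |h x|) μ := by
  have hm : AEStronglyMeasurable (fun x => |F x| ^ (p - 2) * |g x| * |h x|) μ :=
    ((((Lp.aestronglyMeasurable F).norm.aemeasurable.pow_const (p - 2)).mul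
      (Lp.aestronglyMeasurable g).norm.aemeasurable).mul
      (Lp.aestronglyMeasurable h).norm.aemeasurable).aestronglyMeasurable
  refine ⟨hm, ?_⟩
  rw [hasFiniteIntegral_iff_ofReal (Filter.Eventually.of_forall fun x => by positivity)]
  exact (lintegral_holder_three hp F g h).trans_lt ENNReal.ofReal_lt_top

theorem integral_holder_three (hp : 2 < p) (F g h : Lp ℝ (ENNReal.ofReal p) μ) :
    ∫ x, |F x| ^ (p - 2) * |g x| * |h x| ∂μ ≤ ‖F‖ ^ (p - 2) * ‖g‖ * ‖h‖ := by
  rw [integral_eq_lintegral_of_nonneg_ae (Filter.Eventually.of_forall fun x => by positivity)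
    (integrable_holder_three hp F g h).1]
  exact ENNReal.toReal_le_of_le_ofReal (by positivity) (lintegral_holder_three hp F g h)

variable {q : X → ℝ}

theorem integrable_force (hp : 2 < p) (hq : Measurable q) (hq1 : ∀ x, |q x| ≤ 1)
    (U W : Lp ℝ (ENNReal.ofReal p) μ) :
    Integrable (fun x => q x * oddPow p (U x) * W x) μ := by
  refine (integrable_holder_three hp U U W).mono' ?_ (Filter.Eventually.of_forall fun x => ?_)
  · exact (hq.aestronglyMeasurable.mul ((continuous_oddPow hp).comp_aestronglyMeasurable
      (Lp.aestronglyMeasurable U))).mul (Lp.aestronglyMeasurable W)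
  · rw [Real.norm_eq_abs, abs_mul, abs_mul, abs_oddPow]
    have := hq1 x
    calc |q x| * (|U x| ^ (p - 2) * |U x|) * |W x| ≤ 1 * (|U x| ^ (p - 2) * |U x|) * |W x| := by
          gcongr
      _ = _ := by ring

/-- The functional `W ↦ ∫ q |U|^(p-2) U W`. -/
noncomputable def force (hp : 2 < p) (hq : Measurable q) (hq1 : ∀ x, |q x| ≤ 1)
    (U : Lp ℝ (ENNReal.ofReal p) μ) : Lp ℝ (ENNReal.ofReal p) μ →L[ℝ] ℝ :=
  LinearMap.mkContinuous
    { toFun := fun W => ∫ x, q x * oddPow p (U x) * W x ∂μ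
      map_add' := by
        intro W Z
        rw [← integral_add (integrable_force hp hq hq1 U W) (integrable_force hp hq hq1 U Z)]
        refine integral_congr_ae ?_
        filter_upwards [Lp.coeFn_add W Z] with x hx
        rw [hx, Pi.add_apply, mul_add]
      map_smul' := by
        intro c W
        rw [RingHom.id_apply, smul_eq_mul, ← integral_const_mul]
        refine integral_congr_ae ?_
        filter_upwards [Lp.coeFn_smul c W] with x hx
        rw [hx, Pi.smul_apply, smul_eq_mul]
        ring }
    (‖U‖ ^ (p - 2) * ‖U‖)
    (by
      intro W
      refine (norm_integral_le_integral_norm _).trans ?_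
      refine (integral_mono (integrable_force hp hq hq1 U W).norm
        (integrable_holder_three hp U U W) fun x => ?_).trans (integral_holder_three hp U U W)
      simp only [Real.norm_eq_abs, abs_mul, abs_oddPow]
      have := hq1 x
      calc |q x| * (|U x| ^ (p - 2) * |U x|) * |W x| ≤ 1 * (|U x| ^ (p - 2) * |U x|) * |W x| := by
            gcongr
        _ = _ := by ring)

theorem force_apply (hp : 2 < p) (hq : Measurable q) (hq1 : ∀ x, |q x| ≤ 1)
    (U W : Lp ℝ (ENNReal.ofReal p) μ) :
    force hp hq hq1 U W = ∫ x, q x * oddPow p (U x) * W x ∂μ := rfl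

theorem norm_force_le (hp : 2 < p) (hq : Measurable q) (hq1 : ∀ x, |q x| ≤ 1)
    (U : Lp ℝ (ENNReal.ofReal p) μ) : ‖force hp hq hq1 U‖ ≤ ‖U‖ ^ (p - 2) * ‖U‖ :=
  LinearMap.mkContinuous_norm_le _ (by positivity) _

theorem force_smul (hp : 2 < p) (hq : Measurable q) (hq1 : ∀ x, |q x| ≤ 1) {t : ℝ} (ht : 0 ≤ t)
    (U : Lp ℝ (ENNReal.ofReal p) μ) :
    force hp hq hq1 (t • U) = (t ^ (p - 2) * t) • force hp hq hq1 U := by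
  ext W
  rw [smul_apply, force_apply, force_apply, smul_eq_mul,
    ← integral_const_mul]
  refine integral_congr_ae ?_
  filter_upwards [Lp.coeFn_smul t U] with x hx
  rw [hx, Pi.smul_apply, smul_eq_mul, oddPow, oddPow, abs_mul, abs_of_nonneg ht,
    Real.mul_rpow ht (abs_nonneg _)]
  ring

theorem force_neg (hp : 2 < p) (hq : Measurable q) (hq1 : ∀ x, |q x| ≤ 1)
    (U : Lp ℝ (ENNReal.ofReal p) μ) :
    force hp hq hq1 (-U) = -force hp hq hq1 U := by
  ext W
  rw [neg_apply, force_apply, force_apply, ← integral_neg]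
  refine integral_congr_ae ?_
  filter_upwards [Lp.coeFn_neg U] with x hx
  rw [hx, Pi.neg_apply, oddPow_neg]
  ring

theorem force_sub_apply (hp : 2 < p) (hq : Measurable q) (hq1 : ∀ x, |q x| ≤ 1)
    (U V W : Lp ℝ (ENNReal.ofReal p) μ) : (force hp hq hq1 U - force hp hq hq1 V) W =
      ∫ x, q x * (oddPow p (U x) - oddPow p (V x)) * W x ∂μ := by
  rw [sub_apply, force_apply, force_apply,
    ← integral_sub (integrable_force hp hq hq1 U W) (integrable_force hp hq hq1 V W)]
  congr 1
  ext x
  ring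

/-- The force depends in a Lipschitz way on the part of the function seen by the weight. -/
theorem norm_force_sub_le (hp : 2 < p) (hq : Measurable q) (hq1 : ∀ x, |q x| ≤ 1)
    (U V Z : Lp ℝ (ENNReal.ofReal p) μ) (hZ : ∀ᵐ x ∂μ, |q x| * |U x - V x| ≤ |Z x|) :
    ‖force hp hq hq1 U - force hp hq hq1 V‖ ≤ (p - 1) * (‖U‖ + ‖V‖) ^ (p - 2) * ‖Z‖ := by
  have hp1 : (0 : ℝ) ≤ p - 1 := by linarith
  have hp2 : (0 : ℝ) ≤ p - 2 := by linarith
  refine ContinuousLinearMap.opNorm_le_bound _ (by positivity) fun W => ?_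
  rw [force_sub_apply]
  have hae : ∀ᵐ x ∂μ, ‖q x * (oddPow p (U x) - oddPow p (V x)) * W x‖ ≤
      (p - 1) * (|(|U| + |V| : Lp ℝ (ENNReal.ofReal p) μ) x| ^ (p - 2) * |Z x| * |W x|) := by
    filter_upwards [hZ, Lp.coeFn_add |U| |V|, Lp.coeFn_abs U, Lp.coeFn_abs V] with x h1 h2 h3 h4
    rw [h2, Pi.add_apply, h3, h4, abs_of_nonneg (a := |U x| + |V x|) (by positivity),
      Real.norm_eq_abs, abs_mul, abs_mul]
    calc |q x| * |oddPow p (U x) - oddPow p (V x)| * |W x|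
        ≤ |q x| * ((p - 1) * (|U x| + |V x|) ^ (p - 2) * |U x - V x|) * |W x| := by
          gcongr
          exact abs_oddPow_sub_le hp _ _
      _ = (p - 1) * ((|U x| + |V x|) ^ (p - 2) * (|q x| * |U x - V x|) * |W x|) := by ring
      _ ≤ _ := by gcongr
  refine (norm_integral_le_of_norm_le ((integrable_holder_three hp _ Z W).const_mul _) hae).trans ?_
  rw [integral_const_mul]
  have h5 : ‖(|U| + |V| : Lp ℝ (ENNReal.ofReal p) μ)‖ ≤ ‖U‖ + ‖V‖ :=
    (norm_add_le _ _).trans (by rw [norm_abs_eq_norm, norm_abs_eq_norm])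
  calc _ ≤ (p - 1) * (‖(|U| + |V| : Lp ℝ (ENNReal.ofReal p) μ)‖ ^ (p - 2) * ‖Z‖ * ‖W‖) := by
        gcongr
        exact integral_holder_three hp _ Z W
    _ ≤ (p - 1) * ((‖U‖ + ‖V‖) ^ (p - 2) * ‖Z‖ * ‖W‖) := by gcongr
    _ = _ := by ring

theorem force_sub_apply_sub_nonneg (hp : 2 < p) (hq : Measurable q) (hq1 : ∀ x, |q x| ≤ 1)
    (hq0 : ∀ x, 0 ≤ q x) (U V : Lp ℝ (ENNReal.ofReal p) μ) :
    0 ≤ (force hp hq hq1 U - force hp hq hq1 V) (U - V) := by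
  rw [force_sub_apply]
  refine integral_nonneg_of_ae ?_
  filter_upwards [Lp.coeFn_sub U V] with x hx
  rw [hx, Pi.sub_apply, mul_assoc]
  exact mul_nonneg (hq0 x) (oddPow_sub_mul_sub_nonneg hp _ _)

/-- The second order Taylor estimate for `U ↦ ∫ q |U|^p`. -/
theorem force_taylor (hp : 2 < p) (hq : Measurable q) (hq1 : ∀ x, |q x| ≤ 1)
    (U V : Lp ℝ (ENNReal.ofReal p) μ) :
    force hp hq hq1 U U + p * force hp hq hq1 U V -
      p * (p - 1) * ((‖U‖ + ‖U‖ + ‖V‖) ^ (p - 2) * ‖V‖ * ‖V‖) ≤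
      force hp hq hq1 (U + V) (U + V) := by
  have hp0 : (0 : ℝ) ≤ p := by linarith
  have hp1 : (0 : ℝ) ≤ p - 1 := by linarith
  have hp2 : (0 : ℝ) ≤ p - 2 := by linarith
  set F : Lp ℝ (ENNReal.ofReal p) μ := |U| + |U| + |V| with hF
  have hFn : ‖F‖ ≤ ‖U‖ + ‖U‖ + ‖V‖ :=
    norm_add₃_le.trans (by rw [norm_abs_eq_norm, norm_abs_eq_norm])
  have h1 : ∫ x, (q x * oddPow p (U x) * U x + p * (q x * oddPow p (U x) * V x) -
      p * (p - 1) * (|F x| ^ (p - 2) * |V x| * |V x|)) ∂μ ≤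
      ∫ x, q x * oddPow p ((U + V : Lp ℝ (ENNReal.ofReal p) μ) x) *
        (U + V : Lp ℝ (ENNReal.ofReal p) μ) x ∂μ := by
    refine integral_mono_ae (((integrable_force hp hq hq1 U U).add
      ((integrable_force hp hq hq1 U V).const_mul p)).sub
      ((integrable_holder_three hp F V V).const_mul _)) (integrable_force hp hq hq1 _ _) ?_
    filter_upwards [Lp.coeFn_add U V, Lp.coeFn_add (|U| + |U|) |V|, Lp.coeFn_add |U| |U|,
      Lp.coeFn_abs U, Lp.coeFn_abs V] with x h1 h2 h3 h4 h5
    simp only [hF, h2, Pi.add_apply, h3, h4, h5, h1]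
    rw [mul_assoc, oddPow_mul_self hp, mul_assoc (q x) (oddPow p (U x + V x)), oddPow_mul_self hp,
      abs_of_nonneg (a := |U x| + |U x| + |V x|) (by positivity)]
    have h6 := abs_rpow_add_sub_le hp (U x) (V x)
    set r := |U x + V x| ^ p - |U x| ^ p - p * (oddPow p (U x) * V x) with hr
    have h7 : |q x * r| ≤ |r| := by
      rw [abs_mul]
      exact mul_le_of_le_one_left (abs_nonneg _) (hq1 x)
    have h8 := neg_abs_le (q x * r)
    have h9 : q x * r = q x * |U x + V x| ^ p - q x * |U x| ^ p -
      p * (q x * oddPow p (U x) * V x) := by rw [hr]; ring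
    linarith
  rw [integral_sub, integral_add, integral_const_mul, integral_const_mul] at h1
  · have h2 := integral_holder_three hp F V V
    have h3 : p * (p - 1) * ∫ x, |F x| ^ (p - 2) * |V x| * |V x| ∂μ ≤
        p * (p - 1) * ((‖U‖ + ‖U‖ + ‖V‖) ^ (p - 2) * ‖V‖ * ‖V‖) := by
      refine mul_le_mul_of_nonneg_left (h2.trans ?_) (by positivity)
      gcongr
    simp only [force_apply]
    linarith
  · exact integrable_force hp hq hq1 U U
  · exact (integrable_force hp hq hq1 U V).const_mul p
  · exact (integrable_force hp hq hq1 U U).add ((integrable_force hp hq hq1 U V).const_mul p)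
  · exact (integrable_holder_three hp F V V).const_mul _

end Holder

/-! ### Critical points of an even functional on the unit sphere of a Hilbert space -/

section Abstract

variable {H : Type*} [NormedAddCommGroup H] [InnerProductSpace ℝ H]

/-- The tangential part of the vector field `g`. -/
noncomputable def tangential (g : H → H) (u : H) : H := g u - inner ℝ (g u) u • u

/-- One ascent step along `g` on the unit sphere. -/
noncomputable def ascent (g : H → H) (s : ℝ) (u : H) : H :=
  ‖u + s • tangential g u‖⁻¹ • (u + s • tangential g u)

variable {g : H → H}

theorem inner_tangential {u : H} (hu : ‖u‖ = 1) : inner ℝ (tangential g u) u = 0 := by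
  rw [tangential, inner_sub_left, inner_smul_left, real_inner_self_eq_norm_sq, hu]
  simp

theorem inner_tangential' {u : H} (hu : ‖u‖ = 1) :
    inner ℝ (g u) (tangential g u) = ‖tangential g u‖ ^ 2 := by
  have h1 : g u = tangential g u + inner ℝ (g u) u • u := by rw [tangential]; abel
  nth_rw 1 [h1]
  rw [inner_add_left, inner_smul_left, real_inner_self_eq_norm_sq,
    real_inner_comm (tangential g u) u, inner_tangential hu]
  simp

theorem norm_sq_add_tangential {u : H} (hu : ‖u‖ = 1) (s : ℝ) :
    ‖u + s • tangential g u‖ ^ 2 = 1 + s ^ 2 * ‖tangential g u‖ ^ 2 := by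
  rw [norm_add_sq_real, inner_smul_right, real_inner_comm, inner_tangential hu, hu, norm_smul,
    mul_pow, Real.norm_eq_abs, sq_abs]
  ring

theorem norm_add_tangential_pos {u : H} (hu : ‖u‖ = 1) (s : ℝ) :
    0 < ‖u + s • tangential g u‖ := by
  have h := norm_sq_add_tangential (g := g) hu s
  by_contra h0
  have h1 : ‖u + s • tangential g u‖ = 0 := le_antisymm (not_lt.1 h0) (norm_nonneg _)
  rw [h1] at h
  have : 0 ≤ s ^ 2 * ‖tangential g u‖ ^ 2 := by positivity
  linarith

theorem norm_ascent {u : H} (hu : ‖u‖ = 1) (s : ℝ) : ‖ascent g s u‖ = 1 := by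
  rw [ascent, norm_smul, norm_inv, norm_norm, inv_mul_cancel₀ (norm_add_tangential_pos hu s).ne']

theorem ascent_neg (hodd : ∀ u, g (-u) = -g u) (s : ℝ) (u : H) :
    ascent g s (-u) = -ascent g s u := by
  have h1 : tangential g (-u) = -tangential g u := by
    rw [tangential, tangential, hodd, inner_neg_neg, smul_neg]
    abel
  have h2 : -u + s • tangential g (-u) = -(u + s • tangential g u) := by
    rw [h1, smul_neg]; abel
  rw [ascent, ascent, h2, norm_neg, smul_neg]

theorem continuousOn_tangential (hg : ContinuousOn g (Metric.sphere 0 1)) :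
    ContinuousOn (tangential g) (Metric.sphere 0 1) :=
  hg.sub ((hg.inner continuousOn_id).smul continuousOn_id)

theorem continuousOn_ascent (hg : ContinuousOn g (Metric.sphere 0 1)) (s : ℝ) :
    ContinuousOn (ascent g s) (Metric.sphere 0 1) := by
  have h1 : ContinuousOn (fun u => u + s • tangential g u) (Metric.sphere 0 1) :=
    continuousOn_id.add ((continuousOn_tangential hg).const_smul s)
  exact (h1.norm.inv₀ fun u hu =>
    (norm_add_tangential_pos (mem_sphere_zero_iff_norm.1 hu) s).ne').smul h1

/-- A short ascent step increases the functional by a multiple of the squared tangential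
gradient. -/
theorem exists_ascent {p M L : ℝ} (hp : 0 < p) (hM : 0 ≤ M) (hL : 0 ≤ L)
    (hgM : ∀ u, ‖u‖ = 1 → ‖g u‖ ≤ M)
    (htaylor : ∀ u v : H, ‖u‖ = 1 → ‖v‖ ≤ 2 →
      inner ℝ (g u) u + p * inner ℝ (g u) v - L * ‖v‖ ^ 2 ≤ inner ℝ (g (u + v)) (u + v)) :
    ∃ s σ : ℝ, 0 < σ ∧ ∀ u, ‖u‖ = 1 →
      inner ℝ (g u) u + σ * ‖tangential g u‖ ^ 2 ≤
        inner ℝ (g (ascent g s u)) (ascent g s u) := by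
  -- The first bound gives s‖τ‖ ≤ 1 for the tangential gradient τ. The second lets half of the
  -- linear gain p·s‖τ‖²/2 absorb the losses from normalization and from the Taylor remainder,
  -- leaving σ = s·p/4.
  set s : ℝ := min (1 / (M + 1)) (p / 4 / (p * M / 2 + L + 1)) with hs
  have hs0 : 0 < s := lt_min (by positivity) (by positivity)
  have hs1 : s * (M + 1) ≤ 1 := by
    rw [← le_div_iff₀ (by positivity)]; exact min_le_left _ _
  have hs2 : s * (p * M / 2 + L + 1) ≤ p / 4 := by
    rw [← le_div_iff₀ (by positivity)]; exact min_le_right _ _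
  refine ⟨s, s * (p / 4), by positivity, fun u hu => ?_⟩
  set τ := tangential g u with hτ
  set y := u + s • τ with hy
  have hyn : ‖y‖ ^ 2 = 1 + s ^ 2 * ‖τ‖ ^ 2 := norm_sq_add_tangential hu s
  have hy0 : 0 < ‖y‖ := norm_add_tangential_pos hu s
  have hΦM : |inner ℝ (g u) u| ≤ M := by
    refine (abs_real_inner_le_norm _ _).trans ?_
    rw [hu, mul_one]; exact hgM u hu
  have hτM : ‖τ‖ ≤ M := by
    have h1 : ‖τ‖ ^ 2 ≤ ‖g u‖ * ‖τ‖ := by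
      rw [← inner_tangential' hu]; exact real_inner_le_norm _ _
    have h2 := hgM u hu
    by_contra! h3
    nlinarith [norm_nonneg τ]
  set x := s ^ 2 * ‖τ‖ ^ 2 with hx
  have hx0 : 0 ≤ x := by positivity
  have hx1 : x ≤ 1 := by
    have : s * ‖τ‖ ≤ 1 := by nlinarith [norm_nonneg τ]
    have h2 : x = (s * ‖τ‖) ^ 2 := by rw [hx]; ring
    rw [h2]
    exact pow_le_one₀ (by positivity) this
  have hyle : ‖y‖ ≤ 1 + x / 2 := by
    refine abs_le_of_sq_le_sq' ?_ (by positivity) |>.2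
    nlinarith
  have hyge : 1 ≤ ‖y‖ := by nlinarith
  set r := ‖y‖⁻¹ with hr
  have hry : r * ‖y‖ = 1 := inv_mul_cancel₀ hy0.ne'
  have hr0 : 0 < r := inv_pos.2 hy0
  have hr1 : r ≤ 1 := inv_le_one_of_one_le₀ hyge
  have hrx : 1 - x / 2 ≤ r := by nlinarith
  have hw : ascent g s u = r • y := rfl
  set v := r • y - u with hv
  have hwv : ascent g s u = u + v := by rw [hw, hv]; abel
  have huy : inner ℝ y u = 1 := by
    rw [hy, inner_add_left, inner_smul_left, inner_tangential hu, real_inner_self_eq_norm_sq, hu]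
    simp
  have hvn : ‖v‖ ^ 2 = 2 - 2 * r := by
    have h1 : ‖r • y‖ = 1 := by rw [norm_smul, Real.norm_of_nonneg hr0.le, hry]
    rw [hv, norm_sub_sq_real, h1, hu, inner_smul_left, huy]
    simp; ring
  -- Since 1/√(1+x) ≥ 1 - x/2, the normalized step v is no longer than the tangential one, to within
  -- the quadratic bound x = s²‖τ‖².
  have hv2 : ‖v‖ ^ 2 ≤ x := by rw [hvn]; linarith
  have hvle : ‖v‖ ≤ 2 := by nlinarith [norm_nonneg v]
  have hgv : inner ℝ (g u) v = -(1 - r) * inner ℝ (g u) u + r * s * ‖τ‖ ^ 2 := by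
    rw [hv, hy, smul_add, inner_sub_right, inner_add_right, inner_smul_right, inner_smul_right,
      inner_smul_right, inner_tangential' hu]
    ring
  have h1 := htaylor u v hu hvle
  rw [hwv]
  refine le_trans ?_ h1
  have h2 : -(x / 2 * M) + s * ‖τ‖ ^ 2 / 2 ≤ inner ℝ (g u) v := by
    rw [hgv]
    have h3 : (1 - r) * inner ℝ (g u) u ≤ x / 2 * M := by
      calc (1 - r) * inner ℝ (g u) u ≤ (1 - r) * M :=
            mul_le_mul_of_nonneg_left ((le_abs_self _).trans hΦM) (by linarith)
        _ ≤ x / 2 * M := mul_le_mul_of_nonneg_right (by linarith) hM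
    have h4 : s * ‖τ‖ ^ 2 / 2 ≤ r * s * ‖τ‖ ^ 2 := by
      have : 1 / 2 ≤ r := by linarith
      have h5 : 0 ≤ s * ‖τ‖ ^ 2 := by positivity
      nlinarith
    linarith
  have h6 : L * ‖v‖ ^ 2 ≤ L * x := mul_le_mul_of_nonneg_left hv2 hL
  have h7 : p * (-(x / 2 * M) + s * ‖τ‖ ^ 2 / 2) ≤ p * inner ℝ (g u) v :=
    mul_le_mul_of_nonneg_left h2 hp.le
  have h8 : s * ‖τ‖ ^ 2 * (s * (p * M / 2 + L + 1)) ≤ s * ‖τ‖ ^ 2 * (p / 4) :=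
    mul_le_mul_of_nonneg_left hs2 (by positivity)
  have h9 : s * ‖τ‖ ^ 2 * (s * (p * M / 2 + L + 1)) = p * (x / 2 * M) + L * x + x := by
    rw [hx]; ring
  nlinarith

/-- The Palais–Smale condition at positive levels. -/
theorem exists_eigenvector_of_palaisSmale [CompleteSpace H] {gB gC : H → H}
    (hg : ContinuousOn g (Metric.sphere 0 1)) (hsplit : ∀ u, g u = gB u - gC u)
    (hmono : ∀ u v, 0 ≤ inner ℝ (gC u - gC v) (u - v))
    (hcomp : ∀ u : ℕ → H, (∀ n, ‖u n‖ = 1) → ∃ φ : ℕ → ℕ, StrictMono φ ∧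
      CauchySeq fun n => gB (u (φ n)))
    {c : ℝ} (hc : 0 < c) {u : ℕ → H} (hu : ∀ n, ‖u n‖ = 1)
    (hlevel : Tendsto (fun n => inner ℝ (g (u n)) (u n)) atTop (𝓝 c))
    (htan : Tendsto (fun n => tangential g (u n)) atTop (𝓝 0)) :
    ∃ v : H, ‖v‖ = 1 ∧ g v = c • v := by
  obtain ⟨φ, hφ, hB⟩ := hcomp u hu
  set w : ℕ → H := fun n => u (φ n) with hw
  have hwn : ∀ n, ‖w n‖ = 1 := fun n => hu _
  have hlevel' : Tendsto (fun n => inner ℝ (g (w n)) (w n)) atTop (𝓝 c) :=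
    hlevel.comp hφ.tendsto_atTop
  have htan' : Tendsto (fun n => tangential g (w n)) atTop (𝓝 0) := htan.comp hφ.tendsto_atTop
  have hdev : Tendsto (fun n => (inner ℝ (g (w n)) (w n) - c) • w n) atTop (𝓝 0) := by
    rw [tendsto_zero_iff_norm_tendsto_zero]
    have h1 : ∀ n, ‖(inner ℝ (g (w n)) (w n) - c) • w n‖ = |inner ℝ (g (w n)) (w n) - c| := by
      intro n
      rw [norm_smul, hwn, mul_one, Real.norm_eq_abs]
    simp only [h1]
    have h2 := (hlevel'.sub_const c).abs
    rwa [sub_self, abs_zero] at h2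
  obtain ⟨b, hb⟩ := cauchySeq_tendsto_of_complete hB
  -- This sequence equals gB(w) minus two errors that tend to zero, hence it converges. The map c·Id
  -- + gC is strongly monotone, so the Cauchy property passes from y back to w; this is where c > 0
  -- enters.
  set y : ℕ → H := fun n => c • w n + gC (w n) with hy
  have hyeq : ∀ n, y n = gB (w n) - tangential g (w n) -
      (inner ℝ (g (w n)) (w n) - c) • w n := by
    intro n
    have h1 := hsplit (w n)
    have h2 : gC (w n) = gB (w n) - g (w n) := by rw [h1]; abel
    simp only [hy]
    rw [h2, tangential]
    module
  have hyc : CauchySeq y := by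
    have : Tendsto y atTop (𝓝 (b - 0 - 0)) := by
      rw [funext hyeq]
      exact (hb.sub htan').sub hdev
    exact this.cauchySeq
  have hdist : ∀ m n, c * dist (w m) (w n) ≤ dist (y m) (y n) := by
    intro m n
    rw [dist_eq_norm, dist_eq_norm]
    have h1 : y m - y n = c • (w m - w n) + (gC (w m) - gC (w n)) := by
      simp only [hy]; module
    have h2 : c * ‖w m - w n‖ ^ 2 ≤ ‖y m - y n‖ * ‖w m - w n‖ := by
      refine le_trans ?_ (real_inner_le_norm _ _)
      rw [h1, inner_add_left, inner_smul_left, real_inner_self_eq_norm_sq]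
      have := hmono (w m) (w n)
      simp only [conj_trivial]
      linarith
    rcases (norm_nonneg (w m - w n)).eq_or_lt with h0 | h0
    · rw [← h0]; simp
    · rw [sq, ← mul_assoc] at h2
      exact le_of_mul_le_mul_right h2 h0
  have hwc : CauchySeq w := by
    rw [Metric.cauchySeq_iff] at hyc ⊢
    intro ε hε
    obtain ⟨N, hN⟩ := hyc (c * ε) (by positivity)
    refine ⟨N, fun m hm n hn => ?_⟩
    have := (hdist m n).trans_lt (hN m hm n hn)
    exact lt_of_mul_lt_mul_left this hc.le
  obtain ⟨v, hv⟩ := cauchySeq_tendsto_of_complete hwc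
  have hvn : ‖v‖ = 1 := tendsto_nhds_unique hv.norm (by simp [hwn])
  have hvS : v ∈ Metric.sphere (0 : H) 1 := mem_sphere_zero_iff_norm.2 hvn
  have hvS' : Tendsto w atTop (𝓝[Metric.sphere 0 1] v) :=
    tendsto_nhdsWithin_iff.2 ⟨hv, Eventually.of_forall fun n =>
      mem_sphere_zero_iff_norm.2 (hwn n)⟩
  have h1 : Tendsto (fun n => g (w n)) atTop (𝓝 (g v)) := (hg v hvS).tendsto.comp hvS'
  have h2 : inner ℝ (g v) v = c := tendsto_nhds_unique (h1.inner hv) hlevel'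
  have h3 : tangential g v = 0 :=
    tendsto_nhds_unique ((continuousOn_tangential hg v hvS).tendsto.comp hvS') htan'
  refine ⟨v, hvn, ?_⟩
  rw [tangential, h2, sub_eq_zero] at h3
  exact h3

/-- `a` is a lower bound of the functional on an odd image of the `k`-sphere in the unit sphere. -/
def IsSphereLevel (g : H → H) (k : ℕ) (a : ℝ) : Prop :=
  ∃ h : EuclideanSpace ℝ (Fin (k + 1)) → H, ContinuousOn h (Metric.sphere 0 1) ∧
    (∀ x, h (-x) = -h x) ∧
    ∀ x ∈ Metric.sphere (0 : EuclideanSpace ℝ (Fin (k + 1))) 1,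
      ‖h x‖ = 1 ∧ a ≤ inner ℝ (g (h x)) (h x)

/-- Minimax principle: arbitrarily small positive eigenvalues of `g` on the unit sphere. -/
theorem exists_small_eigenvalue [CompleteSpace H] {gB gC : H → H} {p M L : ℝ}
    (hp : 0 < p) (hM : 0 ≤ M) (hL : 0 ≤ L)
    (hodd : ∀ u, g (-u) = -g u) (hgM : ∀ u, ‖u‖ = 1 → ‖g u‖ ≤ M)
    (htaylor : ∀ u v : H, ‖u‖ = 1 → ‖v‖ ≤ 2 →
      inner ℝ (g u) u + p * inner ℝ (g u) v - L * ‖v‖ ^ 2 ≤ inner ℝ (g (u + v)) (u + v))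
    (hg : ContinuousOn g (Metric.sphere 0 1)) (hsplit : ∀ u, g u = gB u - gC u)
    (hmono : ∀ u v, 0 ≤ inner ℝ (gC u - gC v) (u - v))
    (hcomp : ∀ u : ℕ → H, (∀ n, ‖u n‖ = 1) → ∃ φ : ℕ → ℕ, StrictMono φ ∧
      CauchySeq fun n => gB (u (φ n)))
    (hpos : ∀ k, ∃ a, 0 < a ∧ IsSphereLevel g k a)
    {δ : ℝ} {k : ℕ} (R : H →L[ℝ] (Fin k → ℝ))
    (hR : ∀ u, ‖u‖ = 1 → R u = 0 → inner ℝ (g u) u ≤ δ) :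
    ∃ c, 0 < c ∧ c ≤ δ ∧ ∃ u : H, ‖u‖ = 1 ∧ g u = c • u := by
  set S : Set ℝ := {a | IsSphereLevel g k a} with hS
  have hub : ∀ a ∈ S, a ≤ δ := by
    rintro a ⟨h, hc, ho, hh⟩
    -- The odd image of the k-sphere meets the kernel of R, so no level exceeds δ.
    obtain ⟨x, hx, hx0⟩ := borsuk_ulam k (fun x => R (h x))
      (R.continuous.comp_continuousOn hc) (fun x _ => by rw [ho, map_neg])
    exact (hh x hx).2.trans (hR _ (hh x hx).1 hx0)
  have hbdd : BddAbove S := ⟨δ, hub⟩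
  obtain ⟨a₀, ha₀, ha₀S⟩ := hpos k
  have hne : S.Nonempty := ⟨a₀, ha₀S⟩
  set c := sSup S with hc
  have hc0 : 0 < c := ha₀.trans_le (le_csSup hbdd ha₀S)
  refine ⟨c, hc0, csSup_le hne hub, ?_⟩
  obtain ⟨s, σ, hσ, hasc⟩ := exists_ascent hp hM hL hgM htaylor
  -- If there were no almost critical point near level c, one ascent step would lift a nearly
  -- optimal sphere entirely to level c + 1/(n+1), above the supremum. The step is odd, so the
  -- lifted sphere is still admissible.
  have hex : ∀ n : ℕ, ∃ u : H, ‖u‖ = 1 ∧ c - 1 / ((n : ℝ) + 1) ≤ inner ℝ (g u) u ∧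
      inner ℝ (g u) u + σ * ‖tangential g u‖ ^ 2 ≤ c + 1 / ((n : ℝ) + 1) := by
    intro n
    have hn : (0 : ℝ) < 1 / ((n : ℝ) + 1) := by positivity
    obtain ⟨a, ⟨h, hhc, hho, hh⟩, ha⟩ := exists_lt_of_lt_csSup hne
      (show c - 1 / ((n : ℝ) + 1) < sSup S by linarith)
    by_contra! hcon
    have : c + 1 / ((n : ℝ) + 1) ∈ S := by
      refine ⟨fun x => ascent g s (h x), ?_, ?_, ?_⟩
      · exact (continuousOn_ascent hg s).comp hhc fun x hx =>
          mem_sphere_zero_iff_norm.2 (hh x hx).1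
      · intro x
        simp only [hho, ascent_neg hodd]
      · intro x hx
        obtain ⟨h1, h2⟩ := hh x hx
        exact ⟨norm_ascent h1 s, (hcon (h x) h1 (by linarith)).le.trans (hasc _ h1)⟩
    linarith [le_csSup hbdd this]
  choose u hu1 hu2 hu3 using hex
  have hlim : Tendsto (fun n : ℕ => 1 / ((n : ℝ) + 1)) atTop (𝓝 0) :=
    tendsto_one_div_add_atTop_nhds_zero_nat
  refine exists_eigenvector_of_palaisSmale hg hsplit hmono hcomp hc0 hu1 ?_ ?_
  · refine tendsto_of_tendsto_of_tendsto_of_le_of_le (g := fun n : ℕ => c - 1 / ((n : ℝ) + 1))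
      (h := fun n : ℕ => c + 1 / ((n : ℝ) + 1)) ?_ ?_ hu2 ?_
    · simpa using hlim.const_sub c
    · simpa using hlim.const_add c
    · intro n
      have : 0 ≤ σ * ‖tangential g (u n)‖ ^ 2 := by positivity
      linarith [hu3 n]
  · rw [tendsto_zero_iff_norm_tendsto_zero]
    have h1 : Tendsto (fun n => ‖tangential g (u n)‖ ^ 2) atTop (𝓝 0) := by
      refine squeeze_zero (g := fun n : ℕ => 2 / σ * (1 / ((n : ℝ) + 1))) (fun n => by positivity)
        (fun n => ?_) (by simpa using hlim.const_mul (2 / σ))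
      rw [div_mul_eq_mul_div, le_div_iff₀ hσ]
      linarith [hu2 n, hu3 n]
    have h2 := h1.sqrt
    simpa [Real.sqrt_sq] using h2

end Abstract

/-! ### Compactness from smallness in finite codimension -/

section Compact

variable {H F : Type*} [NormedAddCommGroup H] [InnerProductSpace ℝ H]
  [NormedAddCommGroup F] [NormedSpace ℝ F]

/-- An operator that is small on subspaces of finite codimension is compact. -/
theorem isCompactOperator_of_small_ker [CompleteSpace H] [CompleteSpace F] (T : H →L[ℝ] F)
    (hT : ∀ δ > 0, ∃ (k : ℕ) (R : H →L[ℝ] (Fin k → ℝ)), ∀ v, R v = 0 → ‖T v‖ ≤ δ * ‖v‖) :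
    IsCompactOperator T := by
  have key : ∀ n : ℕ, ∃ S : H →L[ℝ] F, IsCompactOperator S ∧ ‖S - T‖ ≤ 1 / ((n : ℝ) + 1) := by
    intro n
    obtain ⟨k, R, hR⟩ := hT (1 / ((n : ℝ) + 1)) (by positivity)
    set K : Submodule ℝ H := LinearMap.ker R.toLinearMap with hK
    have hKc : IsClosed (K : Set H) := R.isClosed_ker
    have : CompleteSpace K := hKc.completeSpace_coe
    -- R is injective on the orthogonal complement of its kernel, so T composed with the projection
    -- onto that complement has finite rank and approximates T in norm.
    have : FiniteDimensional ℝ Kᗮ := by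
      refine FiniteDimensional.of_injective (R.toLinearMap.comp Kᗮ.subtype) ?_
      rw [← LinearMap.ker_eq_bot, LinearMap.ker_eq_bot']
      intro x hx
      have h1 : (x : H) ∈ K := hx
      have h2 := Submodule.inner_right_of_mem_orthogonal h1 x.2
      exact Subtype.ext (inner_self_eq_zero.1 h2)
    refine ⟨(T.comp Kᗮ.subtypeL).comp Kᗮ.orthogonalProjectionOnto, ?_, ?_⟩
    · have hid : IsCompactOperator (Kᗮ.orthogonalProjectionOnto : H →L[ℝ] Kᗮ) :=
        isCompactOperator_of_locallyCompactSpace_dom _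
      exact hid.clm_comp (T.comp Kᗮ.subtypeL)
    · refine ContinuousLinearMap.opNorm_le_bound _ (by positivity) fun v => ?_
      have h1 : ((T.comp Kᗮ.subtypeL).comp Kᗮ.orthogonalProjectionOnto - T) v =
          -T (K.orthogonalProjectionOnto v : H) := by
        have h2 : (K.orthogonalProjectionOnto v : H) + (Kᗮ.orthogonalProjectionOnto v : H) = v :=
          K.starProjection_add_starProjection_orthogonal v
        have h3 : T v = T (K.orthogonalProjectionOnto v : H) +
            T (Kᗮ.orthogonalProjectionOnto v : H) := by
          rw [← map_add, h2]
        rw [sub_apply, h3]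
        exact sub_add_cancel_right _ _
      rw [h1, norm_neg]
      refine (hR _ (K.orthogonalProjectionOnto v).2).trans ?_
      gcongr
      exact K.norm_orthogonalProjectionOnto_apply_le v
  choose S hS1 hS2 using key
  refine isCompactOperator_of_tendsto (F := S) (l := atTop) ?_ (Eventually.of_forall hS1)
  rw [tendsto_iff_norm_sub_tendsto_zero]
  exact squeeze_zero (fun n => norm_nonneg _) hS2 tendsto_one_div_add_atTop_nhds_zero_nat

theorem exists_cauchySeq_subseq {T : H →L[ℝ] F} (hT : IsCompactOperator T) {u : ℕ → H}
    (hu : ∀ n, ‖u n‖ = 1) : ∃ φ : ℕ → ℕ, StrictMono φ ∧ CauchySeq fun n => T (u (φ n)) := by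
  have h1 := hT.isCompact_closure_image_closedBall 1
  obtain ⟨a, -, φ, hφ, ha⟩ := h1.tendsto_subseq (x := fun n => T (u n)) fun n =>
    subset_closure ⟨u n, by simp [hu n], rfl⟩
  exact ⟨φ, hφ, ha.cauchySeq⟩

end Compact

/-! ### Large solutions from a compact embedding -/

section Force

variable {X : Type*} [MeasurableSpace X] {μ : Measure X} {p : ℝ} [Fact (1 ≤ ENNReal.ofReal p)]
  {q q₁ q₂ : X → ℝ}

theorem force_zero (hp : 2 < p) (hq : Measurable q) (hq1 : ∀ x, |q x| ≤ 1) :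
    force hp hq hq1 (0 : Lp ℝ (ENNReal.ofReal p) μ) = 0 := by
  have h := force_smul hp hq hq1 le_rfl (0 : Lp ℝ (ENNReal.ofReal p) μ)
  rwa [smul_zero, mul_zero, zero_smul] at h

theorem force_sub_weight (hp : 2 < p) (hq : Measurable q) (hq1 : ∀ x, |q x| ≤ 1)
    (h₁ : Measurable q₁) (h₁1 : ∀ x, |q₁ x| ≤ 1) (h₂ : Measurable q₂) (h₂1 : ∀ x, |q₂ x| ≤ 1)
    (h : ∀ x, q x = q₁ x - q₂ x) (U : Lp ℝ (ENNReal.ofReal p) μ) :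
    force hp hq hq1 U = force hp h₁ h₁1 U - force hp h₂ h₂1 U := by
  ext W
  rw [sub_apply, force_apply, force_apply, force_apply,
    ← integral_sub (integrable_force hp h₁ h₁1 U W) (integrable_force hp h₂ h₂1 U W)]
  congr 1
  ext x
  rw [h]
  ring

theorem force_self_eq_norm_rpow (hp : 2 < p) (hq : Measurable q) (hq1 : ∀ x, |q x| ≤ 1)
    {U : Lp ℝ (ENNReal.ofReal p) μ} (hU : ∀ᵐ x ∂μ, q x = 1 ∨ U x = 0) :
    force hp hq hq1 U U = ‖U‖ ^ p := by
  have h1 : force hp hq hq1 U U = ∫ x, |U x| ^ p ∂μ := by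
    rw [force_apply]
    refine integral_congr_ae ?_
    filter_upwards [hU] with x hx
    rw [mul_assoc, oddPow_mul_self hp]
    rcases hx with hx | hx
    · rw [hx, one_mul]
    · rw [hx, abs_zero, Real.zero_rpow (by linarith), mul_zero]
  have hm : AEStronglyMeasurable (fun x => |U x| ^ p) μ :=
    ((Lp.aestronglyMeasurable U).norm.aemeasurable.pow_const p).aestronglyMeasurable
  rw [h1, integral_eq_lintegral_of_nonneg_ae (Eventually.of_forall fun x => by positivity) hm]
  have h2 : ∀ x, ENNReal.ofReal (|U x| ^ p) = ‖U x‖ₑ ^ p := by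
    intro x
    rw [← ENNReal.ofReal_rpow_of_nonneg (abs_nonneg _) (by linarith), ← Real.norm_eq_abs,
      ofReal_norm]
  simp only [h2]
  rw [Lp_lintegral_rpow hp, ENNReal.toReal_ofReal (by positivity)]

variable {H : Type*} [NormedAddCommGroup H] [InnerProductSpace ℝ H] [CompleteSpace H]

/-- The force pulled back to the Hilbert space `H`. -/
noncomputable def field (hp : 2 < p) (hq : Measurable q) (hq1 : ∀ x, |q x| ≤ 1)
    (J : H →L[ℝ] Lp ℝ (ENNReal.ofReal p) μ) (u : H) : H :=
  (InnerProductSpace.toDual ℝ H).symm ((force hp hq hq1 (J u)).comp J)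

theorem inner_field (hp : 2 < p) (hq : Measurable q) (hq1 : ∀ x, |q x| ≤ 1)
    (J : H →L[ℝ] Lp ℝ (ENNReal.ofReal p) μ) (u w : H) :
    inner ℝ (field hp hq hq1 J u) w = force hp hq hq1 (J u) (J w) := by
  rw [field, InnerProductSpace.toDual_symm_apply]
  rfl

theorem field_sub (hp : 2 < p) (hq : Measurable q) (hq1 : ∀ x, |q x| ≤ 1)
    (J : H →L[ℝ] Lp ℝ (ENNReal.ofReal p) μ) (u v : H) :
    field hp hq hq1 J u - field hp hq hq1 J v = (InnerProductSpace.toDual ℝ H).symm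
      ((force hp hq hq1 (J u) - force hp hq hq1 (J v)).comp J) := by
  rw [field, field, ← map_sub, ContinuousLinearMap.sub_comp]

/-- The majorant Z is left free for two uses: Z = J u - J v gives Lipschitz continuity of the full
field, and Z = T (u - v) transfers the compactness of T to the part of the field supported on B. -/
theorem norm_field_sub_le (hp : 2 < p) (hq : Measurable q) (hq1 : ∀ x, |q x| ≤ 1)
    (J : H →L[ℝ] Lp ℝ (ENNReal.ofReal p) μ) {u v : H} (hu : ‖u‖ = 1) (hv : ‖v‖ = 1)
    (Z : Lp ℝ (ENNReal.ofReal p) μ) (hZ : ∀ᵐ x ∂μ, |q x| * |J u x - J v x| ≤ |Z x|) :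
    ‖field hp hq hq1 J u - field hp hq hq1 J v‖ ≤
      (p - 1) * (2 * ‖J‖) ^ (p - 2) * ‖J‖ * ‖Z‖ := by
  have hp1 : (0 : ℝ) ≤ p - 1 := by linarith
  have hp2 : (0 : ℝ) ≤ p - 2 := by linarith
  rw [field_sub, LinearIsometryEquiv.norm_map]
  refine (ContinuousLinearMap.opNorm_comp_le _ _).trans ?_
  have h1 := norm_force_sub_le hp hq hq1 (J u) (J v) Z hZ
  have h2 : ‖J u‖ + ‖J v‖ ≤ 2 * ‖J‖ := by
    have h3 := J.le_opNorm u
    have h4 := J.le_opNorm v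
    rw [hu, mul_one] at h3
    rw [hv, mul_one] at h4
    linarith
  calc _ ≤ (p - 1) * (‖J u‖ + ‖J v‖) ^ (p - 2) * ‖Z‖ * ‖J‖ := by gcongr
    _ ≤ (p - 1) * (2 * ‖J‖) ^ (p - 2) * ‖Z‖ * ‖J‖ := by gcongr
    _ = _ := by ring

/-- A weighted superlinear equation whose positive part is compact has large solutions. -/
theorem exists_large_solution (hp : 2 < p) {B : Set X} (hB : MeasurableSet B)
    (hq : Measurable q) (hqB : ∀ x ∈ B, q x = 1) (hqC : ∀ x ∉ B, q x = -1)
    (J T : H →L[ℝ] Lp ℝ (ENNReal.ofReal p) μ) (hJ : Function.Injective J)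
    (hTJ : ∀ u, ∀ᵐ x ∂μ, x ∈ B → T u x = J u x)
    (hT : ∀ δ > 0, ∃ (k : ℕ) (R : H →L[ℝ] (Fin k → ℝ)), ∀ v, R v = 0 → ‖T v‖ ≤ δ * ‖v‖)
    (hbump : ∀ k : ℕ, ∃ b : Fin (k + 1) → H, Orthonormal ℝ b ∧
      ∀ i, ∀ᵐ x ∂μ, x ∉ B → J (b i) x = 0) (r : ℝ) :
    ∃ v : H, r ≤ ‖v‖ ∧ ∀ w, inner ℝ v w = ∫ x, q x * oddPow p (J v x) * J w x ∂μ := by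
  have hp0 : (0 : ℝ) < p := by linarith
  have hp1 : (0 : ℝ) ≤ p - 1 := by linarith
  have hp2 : (0 : ℝ) < p - 2 := by linarith
  have hq1 : ∀ x, |q x| ≤ 1 := fun x => by
    by_cases hx : x ∈ B
    · simp [hqB x hx]
    · simp [hqC x hx]
  set q₁ : X → ℝ := B.indicator 1 with hq₁
  set q₂ : X → ℝ := Bᶜ.indicator 1 with hq₂
  have m₁ : Measurable q₁ := measurable_one.indicator hB
  have m₂ : Measurable q₂ := measurable_one.indicator hB.compl
  have b₁ : ∀ x, |q₁ x| ≤ 1 := fun x => by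
    by_cases hx : x ∈ B <;> simp [hq₁, hx]
  have b₂ : ∀ x, |q₂ x| ≤ 1 := fun x => by
    by_cases hx : x ∈ B <;> simp [hq₂, hx]
  have n₂ : ∀ x, 0 ≤ q₂ x := fun x => by
    by_cases hx : x ∈ B <;> simp [hq₂, hx]
  have hsub : ∀ x, q x = q₁ x - q₂ x := fun x => by
    by_cases hx : x ∈ B
    · simp [hq₁, hq₂, hx, hqB x hx]
    · simp [hq₁, hq₂, hx, hqC x hx]
  have hTu : ∀ u v, ∀ᵐ x ∂μ, |q₁ x| * |J u x - J v x| ≤ |T (u - v) x| := by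
    intro u v
    filter_upwards [hTJ (u - v), Lp.coeFn_sub (J u) (J v)] with x hx h2
    by_cases hxB : x ∈ B
    · rw [hx hxB, map_sub, h2, Pi.sub_apply]
      simp [hq₁, hxB]
    · simp [hq₁, hxB]
  set g := field hp hq hq1 J with hg
  set gB := field hp m₁ b₁ J with hgB
  set gC := field hp m₂ b₂ J with hgC
  have hJ1 : ∀ u, ‖u‖ = 1 → ‖J u‖ ≤ ‖J‖ := fun u hu => by
    have := J.le_opNorm u
    rwa [hu, mul_one] at this
  have hsplit : ∀ u, g u = gB u - gC u := by
    intro u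
    rw [hg, hgB, hgC, field, field, field, ← map_sub, ← ContinuousLinearMap.sub_comp,
      force_sub_weight hp hq hq1 m₁ b₁ m₂ b₂ hsub]
  have hmono : ∀ u v, 0 ≤ inner ℝ (gC u - gC v) (u - v) := by
    intro u v
    rw [inner_sub_left, hgC, inner_field, inner_field, ← sub_apply, map_sub]
    exact force_sub_apply_sub_nonneg hp m₂ b₂ n₂ _ _
  -- Monotonicity of gC against gC 0 = 0: the complement of B only lowers the functional, so
  -- smallness over B suffices.
  have hfieldzero : ∀ u, inner ℝ (g u) u ≤ inner ℝ (gB u) u := by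
    intro u
    have h1 := hmono u 0
    have h2 : gC 0 = 0 := by
      rw [hgC, field, map_zero, force_zero, ContinuousLinearMap.zero_comp, map_zero]
    rw [h2, sub_zero, sub_zero] at h1
    rw [hsplit, inner_sub_left]
    linarith
  have hcont : ContinuousOn g (Metric.sphere 0 1) := by
    have hlip : LipschitzOnWith (Real.toNNReal ((p - 1) * (2 * ‖J‖) ^ (p - 2) * ‖J‖ * ‖J‖)) g
        (Metric.sphere 0 1) := by
      refine LipschitzOnWith.of_dist_le_mul fun u hu v hv => ?_
      rw [dist_eq_norm, dist_eq_norm, Real.coe_toNNReal _ (by positivity)]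
      refine (norm_field_sub_le hp hq hq1 J (mem_sphere_zero_iff_norm.1 hu)
        (mem_sphere_zero_iff_norm.1 hv) (J u - J v) ?_).trans ?_
      · filter_upwards [Lp.coeFn_sub (J u) (J v)] with x hx
        rw [hx, Pi.sub_apply]
        exact mul_le_of_le_one_left (abs_nonneg _) (hq1 x)
      · rw [mul_assoc _ ‖J‖ ‖u - v‖, ← map_sub]
        gcongr
        exact J.le_opNorm _
    exact hlip.continuousOn
  have hcomp : ∀ u : ℕ → H, (∀ n, ‖u n‖ = 1) → ∃ φ : ℕ → ℕ, StrictMono φ ∧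
      CauchySeq fun n => gB (u (φ n)) := by
    intro u hu
    obtain ⟨φ, hφ, hc⟩ := exists_cauchySeq_subseq (isCompactOperator_of_small_ker T hT) hu
    refine ⟨φ, hφ, ?_⟩
    set C := (p - 1) * (2 * ‖J‖) ^ (p - 2) * ‖J‖ with hC
    have hC0 : 0 ≤ C := by positivity
    rw [Metric.cauchySeq_iff] at hc ⊢
    intro ε hε
    obtain ⟨N, hN⟩ := hc (ε / (C + 1)) (by positivity)
    refine ⟨N, fun m hm n hn => ?_⟩
    have h1 := hN m hm n hn
    rw [dist_eq_norm, ← map_sub] at h1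
    rw [dist_eq_norm]
    refine (norm_field_sub_le hp m₁ b₁ J (hu _) (hu _) _ (hTu _ _)).trans_lt ?_
    rw [lt_div_iff₀ (by positivity)] at h1
    have := norm_nonneg (T (u (φ m) - u (φ n)))
    rw [← hC]
    nlinarith
  -- The sphere is the unit sphere of the span of k + 1 orthonormal bumps, where the functional
  -- equals ‖J u‖^p; its minimum is positive by compactness and injectivity of J.
  have hpos : ∀ k, ∃ a, 0 < a ∧ IsSphereLevel g k a := by
    intro k
    obtain ⟨b, hb, hbB⟩ := hbump k
    let h : EuclideanSpace ℝ (Fin (k + 1)) → H := fun x => ∑ i, x i • b i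
    have hhc : Continuous h := continuous_finsetSum _ fun i _ =>
      (EuclideanSpace.proj (𝕜 := ℝ) i).continuous.smul continuous_const
    have hhn : ∀ x, ‖h x‖ = ‖x‖ := by
      intro x
      rw [← sq_eq_sq₀ (norm_nonneg _) (norm_nonneg _), ← real_inner_self_eq_norm_sq,
        hb.inner_sum, EuclideanSpace.norm_sq_eq]
      simp [sq]
    have hΦ : ∀ x, inner ℝ (g (h x)) (h x) = ‖J (h x)‖ ^ p := by
      intro x
      rw [hg, inner_field, force_self_eq_norm_rpow]
      have h1 : ∀ᵐ y ∂μ, ∀ i, y ∉ B → J (b i) y = 0 := ae_all_iff.2 hbB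
      have h2 : ∀ s : Finset (Fin (k + 1)),
          ∀ᵐ y ∂μ, J (∑ i ∈ s, x i • b i) y = ∑ i ∈ s, x i * J (b i) y := by
        intro s
        induction s using Finset.induction with
        | empty =>
          simp only [Finset.sum_empty, map_zero]
          filter_upwards [Lp.coeFn_zero ℝ (ENNReal.ofReal p) μ] with y hy
          rw [hy, Pi.zero_apply]
        | insert i s hi ih =>
          simp only [Finset.sum_insert hi, map_add, map_smul]
          filter_upwards [ih, Lp.coeFn_add (x i • J (b i)) (J (∑ i ∈ s, x i • b i)),
            Lp.coeFn_smul (x i) (J (b i))] with y h1 h2 h3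
          simp only [map_sum, map_smul] at h1 h2
          rw [map_sum]
          simp only [map_smul]
          rw [h2, Pi.add_apply, h1, h3, Pi.smul_apply, smul_eq_mul]
      filter_upwards [h1, h2 Finset.univ] with y hy1 hy2
      by_cases hyB : y ∈ B
      · exact Or.inl (hqB y hyB)
      · right
        rw [hy2]
        exact Finset.sum_eq_zero fun i _ => by rw [hy1 i hyB, mul_zero]
    have hSne : (Metric.sphere (0 : EuclideanSpace ℝ (Fin (k + 1))) 1).Nonempty :=
      ⟨EuclideanSpace.single 0 1, by simp⟩
    obtain ⟨x₀, hx₀, hmin⟩ := (isCompact_sphere (0 : EuclideanSpace ℝ (Fin (k + 1))) 1).exists_isMinOn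
      hSne (f := fun x => ‖J (h x)‖ ^ p)
      ((J.continuous.comp hhc).norm.rpow_const fun _ => Or.inr hp0.le).continuousOn
    refine ⟨‖J (h x₀)‖ ^ p, ?_, h, hhc.continuousOn, ?_, ?_⟩
    · refine Real.rpow_pos_of_pos (norm_pos_iff.2 fun h0 => ?_) p
      have h1 : h x₀ = 0 := hJ (by rw [h0, map_zero])
      have h2 := hhn x₀
      rw [h1, mem_sphere_zero_iff_norm.1 hx₀, norm_zero] at h2
      exact zero_ne_one h2
    · intro x
      simp [h]
    · intro x hx
      exact ⟨by rw [hhn, mem_sphere_zero_iff_norm.1 hx], by rw [hΦ]; exact hmin hx⟩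
  -- the eigenvalue bound that makes the rescaled eigenvector large
  set r' := max r 1 with hr'
  have hr'1 : 1 ≤ r' := le_max_right _ _
  have hr'0 : 0 < r' := by linarith
  -- An eigenvalue c ≤ δ gives c^(-1/(p-2)) ≥ r'. The maximum with 1 keeps r' positive for every r.
  set δ := (r' ^ (p - 2))⁻¹ with hδ
  have hδ0 : 0 < δ := by positivity
  set C := (p - 1) * (‖J‖ ^ (p - 2)) * ‖J‖ with hC
  have hC0 : 0 ≤ C := by positivity
  obtain ⟨k, R, hR⟩ := hT (δ / (C + 1)) (by positivity)
  have hR' : ∀ u, ‖u‖ = 1 → R u = 0 → inner ℝ (g u) u ≤ δ := by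
    intro u hu hRu
    have h1 := hR u hRu
    rw [hu, mul_one, le_div_iff₀ (by positivity)] at h1
    refine (hfieldzero u).trans ?_
    rw [hgB, inner_field]
    have h2 := norm_force_sub_le hp m₁ b₁ (J u) 0 (T u) (by
      have h4 := hTu u 0
      rwa [map_zero, sub_zero] at h4)
    rw [force_zero, sub_zero, norm_zero, add_zero] at h2
    have h3 := hJ1 u hu
    calc force hp m₁ b₁ (J u) (J u) ≤ ‖force hp m₁ b₁ (J u)‖ * ‖J u‖ :=
          (Real.le_norm_self _).trans (ContinuousLinearMap.le_opNorm _ _)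
      _ ≤ (p - 1) * ‖J u‖ ^ (p - 2) * ‖T u‖ * ‖J u‖ := by gcongr
      _ ≤ (p - 1) * ‖J‖ ^ (p - 2) * ‖T u‖ * ‖J‖ := by gcongr
      _ = C * ‖T u‖ := by rw [hC]; ring
      _ ≤ δ := by nlinarith [norm_nonneg (T u)]
  -- M bounds the field on the unit sphere. L is the constant of `force_taylor`, the factor 4‖J‖
  -- coming from ‖u‖ = 1 and ‖v‖ ≤ 2.
  obtain ⟨c, hc0, hcδ, u, hu, hgu⟩ := exists_small_eigenvalue (p := p)
    (M := ‖J‖ ^ (p - 2) * ‖J‖ * ‖J‖) (L := p * (p - 1) * ((4 * ‖J‖) ^ (p - 2) * ‖J‖ * ‖J‖))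
    (g := g) hp0 (by positivity) (by positivity)
    (by
      intro u
      rw [hg, field, field, map_neg, force_neg, ContinuousLinearMap.neg_comp, map_neg])
    (by
      intro u hu
      rw [hg, field, LinearIsometryEquiv.norm_map]
      refine (ContinuousLinearMap.opNorm_comp_le _ _).trans ?_
      have h1 := norm_force_le hp hq hq1 (J u)
      have h2 := hJ1 u hu
      calc _ ≤ ‖J u‖ ^ (p - 2) * ‖J u‖ * ‖J‖ := by gcongr
        _ ≤ _ := by gcongr)
    (by
      intro u v hu hv
      have h1 := force_taylor hp hq hq1 (J u) (J v)
      rw [hg, inner_field, inner_field, inner_field, map_add]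
      refine le_trans ?_ h1
      have h2 := hJ1 u hu
      have h3 := J.le_opNorm v
      have h4 : ‖J u‖ + ‖J u‖ + ‖J v‖ ≤ 4 * ‖J‖ := by
        have : ‖J‖ * ‖v‖ ≤ ‖J‖ * 2 := by gcongr
        linarith
      have h5 : p * (p - 1) * ((‖J u‖ + ‖J u‖ + ‖J v‖) ^ (p - 2) * ‖J v‖ * ‖J v‖) ≤
          p * (p - 1) * ((4 * ‖J‖) ^ (p - 2) * (‖J‖ * ‖v‖) * (‖J‖ * ‖v‖)) := by gcongr
      have h6 : p * (p - 1) * ((4 * ‖J‖) ^ (p - 2) * (‖J‖ * ‖v‖) * (‖J‖ * ‖v‖)) =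
          p * (p - 1) * ((4 * ‖J‖) ^ (p - 2) * ‖J‖ * ‖J‖) * ‖v‖ ^ 2 := by ring
      linarith)
    hcont hsplit hmono hcomp hpos R hR'
  -- The field is homogeneous of degree p - 1, so t^(p-2) c = 1 turns the eigenvector equation into
  -- the equation for t • u.
  set t := c ^ (-(1 / (p - 2))) with ht
  have ht0 : 0 < t := Real.rpow_pos_of_pos hc0 _
  have htp : t ^ (p - 2) = c⁻¹ := by
    rw [ht, ← Real.rpow_mul hc0.le, neg_mul, one_div_mul_cancel hp2.ne', Real.rpow_neg_one]
  refine ⟨t • u, ?_, fun w => ?_⟩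
  · rw [norm_smul, hu, mul_one, Real.norm_of_nonneg ht0.le]
    refine (le_max_left r 1).trans ?_
    rw [← Real.rpow_le_rpow_iff hr'0.le ht0.le hp2, htp]
    rw [hδ] at hcδ
    exact (le_inv_comm₀ hc0 (by positivity)).1 hcδ
  · rw [← force_apply hp hq hq1, map_smul, force_smul hp hq hq1 ht0.le, htp, smul_apply,
      ← inner_field hp hq hq1 J u w, ← hg, hgu, inner_smul_left, inner_smul_left]
    simp only [conj_trivial, smul_eq_mul]
    field_simp

end Force

/-! ### The translation estimate -/

section Translation

theorem abs_inner_toLp_le {α F : Type*} [MeasurableSpace α] {μ : Measure α}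
    [NormedAddCommGroup F] [InnerProductSpace ℝ F] {f h : α → F} (hf : MemLp f 2 μ)
    (hh : MemLp h 2 μ) :
    |∫ x, inner ℝ (f x) (h x) ∂μ| ≤ (eLpNorm f 2 μ).toReal * (eLpNorm h 2 μ).toReal := by
  have h1 := abs_real_inner_le_norm (hf.toLp f) (hh.toLp h)
  rw [L2.inner_def, Lp.norm_toLp, Lp.norm_toLp] at h1
  refine le_trans (le_of_eq ?_) h1
  congr 1
  refine integral_congr_ae ?_
  filter_upwards [hf.coeFn_toLp, hh.coeFn_toLp] with x hx hx'
  rw [hx, hx']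

variable {N : ℕ}

theorem inner_gradient {φ : Space N → ℝ} (x w : Space N) :
    inner ℝ (gradient φ x) w = fderiv ℝ φ x w := by
  rw [gradient, InnerProductSpace.toDual_symm_apply]

theorem integral_fn_mul_fderiv (v : H1 N) {φ : Space N → ℝ} (h1 : ContDiff ℝ ∞ φ)
    (h2 : HasCompactSupport φ) (w : Space N) :
    ∫ x, fn v x * fderiv ℝ φ x w = -∫ x, φ x * inner ℝ (grad v x) w := by
  have h3 : ∫ x, fn v x • gradient φ x = -∫ x, φ x • grad v x := v.2 φ h1 h2
  have h4 := congrArg (fun y => inner ℝ w y) h3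
  simp only [inner_neg_right] at h4
  rw [← integral_inner (integrable_smul_gradient (fn v) h1 h2),
    ← integral_inner (integrable_test_smul (grad v) h1 h2)] at h4
  simp only [inner_smul_right] at h4
  simp only [real_inner_comm _ w] at h4
  simpa only [inner_gradient] using h4

/-- The weak gradient identity moves the derivative of the convolution from ψ onto v; Cauchy–Schwarz
then bounds that derivative by ‖ψ‖₂‖∇v‖₂ everywhere, and the mean value inequality applies. -/
theorem norm_convolution_fn_sub_le (v : H1 N) {ψ : Space N → ℝ} (h1 : ContDiff ℝ ∞ ψ)
    (h2 : HasCompactSupport ψ) (z : Space N) :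
    |(∫ x, fn v x * ψ (z - x)) - ∫ x, fn v x * ψ (0 - x)| ≤
      (eLpNorm ψ 2 volume).toReal * ‖grad v‖ * ‖z‖ := by
  set F : Space N → ℝ := convolution (fn v) ψ (ContinuousLinearMap.lsmul ℝ ℝ) volume with hF
  have hFdef : ∀ y, F y = ∫ x, fn v x * ψ (y - x) := fun y => by
    rw [hF, convolution_def]; simp
  have hloc : LocallyIntegrable (fn v) volume := (Lp.memLp (fn v)).locallyIntegrable (by norm_num)
  have hd : ∀ y, HasFDerivAt F ((convolution (fn v) (fderiv ℝ ψ)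
      ((ContinuousLinearMap.lsmul ℝ ℝ).precompR (Space N)) volume) y) y := fun y =>
    h2.hasFDerivAt_convolution_right _ hloc (h1.of_le (by simp)) y
  have hψ : MemLp ψ 2 volume := h1.continuous.memLp_of_hasCompactSupport h2
  have hbound : ∀ y, ‖(convolution (fn v) (fderiv ℝ ψ)
      ((ContinuousLinearMap.lsmul ℝ ℝ).precompR (Space N)) volume) y‖ ≤
      (eLpNorm ψ 2 volume).toReal * ‖grad v‖ := by
    intro y
    refine ContinuousLinearMap.opNorm_le_bound _ (by positivity) fun w => ?_
    rw [convolution_precompR_apply _ hloc (h2.fderiv ℝ) (h1.continuous_fderiv (by simp)),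
      convolution_def]
    set φ : Space N → ℝ := fun x => ψ (y - x) with hφ
    have hφ1 : ContDiff ℝ ∞ φ := h1.comp (contDiff_const.sub contDiff_id)
    have hφ2 : HasCompactSupport φ := h2.comp_homeomorph (Homeomorph.subLeft y)
    have hmp : MeasurePreserving (fun x : Space N => y - x) volume volume :=
      Measure.measurePreserving_sub_left volume y
    have hφ3 : MemLp φ 2 volume := hψ.comp_measurePreserving hmp
    have hφn : eLpNorm φ 2 volume = eLpNorm ψ 2 volume :=
      eLpNorm_comp_measurePreserving hψ.1 hmp
    have hfd : ∀ x, fderiv ℝ φ x w = -fderiv ℝ ψ (y - x) w := by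
      intro x
      have h3 : HasFDerivAt φ ((fderiv ℝ ψ (y - x)).comp (-ContinuousLinearMap.id ℝ (Space N))) x :=
        HasFDerivAt.comp x ((h1.differentiable (by simp)).differentiableAt.hasFDerivAt)
          ((hasFDerivAt_id x).const_sub y)
      rw [h3.fderiv]
      simp
    have h4 := integral_fn_mul_fderiv v hφ1 hφ2 w
    simp only [hfd, mul_neg, integral_neg] at h4
    rw [neg_inj] at h4
    simp only [ContinuousLinearMap.lsmul_apply, smul_eq_mul]
    rw [h4, Real.norm_eq_abs]
    have h5 : MemLp (fun x => inner ℝ (grad v x) w) 2 volume :=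
      (Lp.memLp (grad v)).inner_const w
    have h6 := abs_inner_toLp_le hφ3 h5
    have h7 : ∀ x, inner ℝ (φ x) (inner ℝ (grad v x) w) = φ x * inner ℝ (grad v x) w :=
      fun x => by simp [mul_comm]
    simp only [h7] at h6
    refine h6.trans ?_
    rw [hφn, mul_assoc]
    gcongr
    have h8 : eLpNorm (fun x => inner ℝ (grad v x) w) 2 volume ≤
        ENNReal.ofReal ‖w‖ * eLpNorm (grad v) 2 volume := by
      refine eLpNorm_le_mul_eLpNorm_of_ae_le_mul (Filter.Eventually.of_forall fun x => ?_) 2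
      rw [mul_comm]
      exact norm_inner_le_norm _ _
    have h9 := ENNReal.toReal_mono
      (ENNReal.mul_ne_top ENNReal.ofReal_ne_top (Lp.eLpNorm_ne_top (grad v))) h8
    rw [ENNReal.toReal_mul, ENNReal.toReal_ofReal (norm_nonneg _), ← Lp.norm_def] at h9
    linarith
  have h3 := Convex.norm_image_sub_le_of_norm_hasFDerivWithin_le (𝕜 := ℝ) (f := F)
    (s := Set.univ) (x := 0) (y := z) (fun y _ => (hd y).hasFDerivWithinAt) (fun y _ => hbound y)
    convex_univ (Set.mem_univ _) (Set.mem_univ _)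
  rw [hFdef, hFdef, Real.norm_eq_abs] at h3
  simpa only [sub_zero, zero_sub] using h3

theorem memLp_translate_sub (v : H1 N) (z : Space N) :
    MemLp (fun x => fn v (x + z) - fn v x) 2 volume :=
  ((Lp.memLp (fn v)).comp_measurePreserving (measurePreserving_add_right volume z)).sub
    (Lp.memLp (fn v))

/-- By duality: against a reflected test function, the translation difference is the difference of
two values of a convolution. Density of test functions extends the bound to all of L², and pairing
the difference with itself concludes. -/
theorem eLpNorm_translate_sub_le (v : H1 N) (z : Space N) :
    eLpNorm (fun x => fn v (x + z) - fn v x) 2 volume ≤ ENNReal.ofReal (‖z‖ * ‖grad v‖) := by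
  set D : Lp ℝ 2 (volume : Measure (Space N)) := (memLp_translate_sub v z).toLp _ with hD
  have hDae : D =ᵐ[volume] fun x => fn v (x + z) - fn v x := (memLp_translate_sub v z).coeFn_toLp
  set C := ‖z‖ * ‖grad v‖ with hC
  have hC0 : 0 ≤ C := by positivity
  have hdense : ∀ f : Lp ℝ 2 (volume : Measure (Space N)), |inner ℝ D f| ≤ C * ‖f‖ := by
    have hcl : IsClosed {f : Lp ℝ 2 (volume : Measure (Space N)) | |inner ℝ D f| ≤ C * ‖f‖} :=
      isClosed_le (continuous_const.inner continuous_id).abs (continuous_const.mul continuous_norm)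
    intro f
    have hd := Lp.dense_hasCompactSupport_contDiff (F := ℝ) (μ := (volume : Measure (Space N)))
      (p := 2) (by norm_num)
    refine hcl.closure_subset_iff.2 ?_ (hd f)
    rintro f ⟨φ, hfφ, hφ2, hφ1⟩
    set ψ : Space N → ℝ := fun x => φ (-x) with hψ
    have hψ1 : ContDiff ℝ ∞ ψ := hφ1.comp contDiff_neg
    have hψ2 : HasCompactSupport ψ := hφ2.comp_homeomorph (Homeomorph.neg (Space N))
    have hφL : MemLp φ 2 volume := hφ1.continuous.memLp_of_hasCompactSupport hφ2
    have hn : (eLpNorm ψ 2 volume).toReal = ‖f‖ := by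
      rw [Lp.norm_def, eLpNorm_congr_ae hfφ, hψ]
      congr 1
      exact eLpNorm_comp_measurePreserving hφL.1 (Measure.measurePreserving_neg volume)
    have h1 := norm_convolution_fn_sub_le v hψ1 hψ2 z
    rw [hn] at h1
    have hint : ∀ {h : Space N → ℝ}, MemLp h 2 volume → Integrable (fun x => h x * φ x) volume :=
      fun hh => hh.integrable_mul hφL
    have h2 : inner ℝ D f = (∫ x, fn v x * ψ (z - x)) - ∫ x, fn v x * ψ (0 - x) := by
      have e1 : inner ℝ D f = ∫ x, (fn v (x + z) * φ x - fn v x * φ x) := by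
        rw [L2.inner_def]
        refine integral_congr_ae ?_
        filter_upwards [hDae, hfφ] with x hx hx'
        rw [hx, hx']
        simp
        ring
      rw [e1, integral_sub]
      · congr 1
        · rw [← integral_add_right_eq_self (fun x => fn v x * ψ (z - x)) z]
          simp [hψ]
        · simp [hψ]
      · exact hint ((Lp.memLp (fn v)).comp_measurePreserving
          (measurePreserving_add_right volume z))
      · exact hint (Lp.memLp (fn v))
    show |inner ℝ D f| ≤ C * ‖f‖
    rw [h2]
    refine h1.trans (le_of_eq ?_)
    rw [hC]; ring
  have h1 := hdense D
  rw [real_inner_self_eq_norm_sq, abs_of_nonneg (by positivity)] at h1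
  have h2 : ‖D‖ ≤ C := by
    rcases (norm_nonneg D).eq_or_lt with h0 | h0
    · rw [← h0]; exact hC0
    · rw [sq] at h1
      exact le_of_mul_le_mul_right h1 h0
  rw [← eLpNorm_congr_ae hDae]
  rw [← ENNReal.ofReal_toReal (Lp.eLpNorm_ne_top D), ← Lp.norm_def]
  exact ENNReal.ofReal_le_ofReal h2

end Translation

/-! ### Averages over dyadic cubes -/

section Dyadic

variable {N : ℕ}

/-- The index of the dyadic cube of side `2⁻ʲ` containing `x`. -/
noncomputable def cell (j : ℕ) (x : Space N) : Fin N → ℤ := fun i => ⌊(2 : ℝ) ^ j * x i⌋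

/-- The dyadic cube of side `2⁻ʲ` with index `k`. -/
def cube (j : ℕ) (k : Fin N → ℤ) : Set (Space N) := {y | cell j y = k}

/-- The average of `u` over the dyadic cube of side `2⁻ʲ` containing `x`. -/
noncomputable def cubeAvg (j : ℕ) (u : Space N → ℝ) (x : Space N) : ℝ :=
  ⨍ y in cube j (cell j x), u y

theorem measurable_cell (j : ℕ) : Measurable (cell j : Space N → Fin N → ℤ) := by
  refine measurable_pi_lambda _ fun i => ?_
  have h : Measurable fun x : Space N => (2 : ℝ) ^ j * x i :=
    ((EuclideanSpace.proj (𝕜 := ℝ) i).continuous.measurable).const_mul _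
  exact Int.measurable_floor.comp h

theorem measurableSet_cube (j : ℕ) (k : Fin N → ℤ) : MeasurableSet (cube j k) :=
  measurable_cell j (measurableSet_singleton k)

theorem volume_cube (j : ℕ) (k : Fin N → ℤ) :
    volume (cube j k) = ENNReal.ofReal (((2 : ℝ) ^ j)⁻¹ ^ N) := by
  have hp : (0 : ℝ) < 2 ^ j := by positivity
  have h1 : cube j k = (WithLp.ofLp : Space N → Fin N → ℝ) ⁻¹'
      (Set.univ.pi fun i => Set.Ico (k i / 2 ^ j : ℝ) ((k i + 1) / 2 ^ j)) := by
    ext x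
    simp only [cube, cell, Set.mem_ofPred_eq, Set.mem_preimage, Set.mem_univ_pi, Set.mem_Ico,
      funext_iff]
    refine forall_congr' fun i => ?_
    rw [Int.floor_eq_iff, div_le_iff₀ hp, lt_div_iff₀ hp, mul_comm]
  rw [h1, (PiLp.volume_preserving_ofLp (Fin N)).measure_preimage
    (MeasurableSet.univ_pi fun i => measurableSet_Ico).nullMeasurableSet, Real.volume_pi_Ico]
  have h2 : ∀ i, ((k i : ℝ) + 1) / 2 ^ j - k i / 2 ^ j = ((2 : ℝ) ^ j)⁻¹ := fun i => by
    field_simp; ring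
  simp only [h2, Finset.prod_const, Finset.card_univ, Fintype.card_fin]
  rw [ENNReal.ofReal_pow (by positivity)]

theorem measurable_cubeAvg (j : ℕ) (u : Space N → ℝ) : Measurable (cubeAvg j u) := by
  have h : Measurable fun k : Fin N → ℤ => ⨍ y in cube j k, u y := Measurable.of_discrete
  exact h.comp (measurable_cell j)

/-- Nestedness of the dyadic partitions makes the difference of two successive averages constant on
the finer cubes, as the inverse inequality requires. -/
theorem cell_eq_of_cell_succ_eq {j : ℕ} {x y : Space N} (h : cell (j + 1) x = cell (j + 1) y) :
    cell j x = cell j y := by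
  have key : ∀ a b : ℝ, ⌊2 * a⌋ = ⌊2 * b⌋ → ⌊a⌋ = ⌊b⌋ := by
    intro a b hab
    rw [Int.floor_eq_iff]
    have h1 := Int.floor_le b
    have h2 := Int.lt_floor_add_one b
    constructor
    · have h3 : 2 * ⌊b⌋ ≤ ⌊2 * b⌋ := Int.le_floor.2 (by push_cast; linarith)
      rw [← hab, Int.le_floor] at h3
      push_cast at h3
      linarith
    · have h3 : ⌊2 * b⌋ < 2 * (⌊b⌋ + 1) := Int.floor_lt.2 (by push_cast; linarith)
      rw [← hab, Int.floor_lt] at h3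
      push_cast at h3
      linarith
  funext i
  apply key
  have h1 := congrFun h i
  simp only [cell, pow_succ'] at h1
  simpa only [mul_assoc] using h1

theorem abs_sub_le_of_cell_eq {j : ℕ} {x y : Space N} (h : cell j x = cell j y) (i : Fin N) :
    |y i - x i| ≤ ((2 : ℝ) ^ j)⁻¹ := by
  have h1 : ⌊(2 : ℝ) ^ j * y i⌋ = ⌊(2 : ℝ) ^ j * x i⌋ := (congrFun h i).symm
  have h2 := Int.abs_sub_lt_one_of_floor_eq_floor h1
  have hp : (0 : ℝ) < 2 ^ j := by positivity
  rw [← mul_sub, abs_mul, abs_of_pos hp] at h2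
  rw [← one_div, le_div_iff₀ hp, mul_comm]
  exact h2.le

/-- The cube of half side `2⁻ʲ` centred at the origin. -/
def box (N j : ℕ) : Set (Space N) := {z | ∀ i, |z i| ≤ ((2 : ℝ) ^ j)⁻¹}

theorem box_eq (j : ℕ) : box N j = (WithLp.ofLp : Space N → Fin N → ℝ) ⁻¹'
    (Set.univ.pi fun _ => Set.Icc (-((2 : ℝ) ^ j)⁻¹) ((2 : ℝ) ^ j)⁻¹) := by
  ext z
  simp only [box, abs_le, Set.mem_ofPred_eq, Set.mem_preimage, Set.mem_univ_pi, Set.mem_Icc]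

theorem measurableSet_box (j : ℕ) : MeasurableSet (box N j) := by
  rw [box_eq]
  exact (PiLp.volume_preserving_ofLp (Fin N)).measurable
    (MeasurableSet.univ_pi fun i => measurableSet_Icc)

theorem volume_box (j : ℕ) : volume (box N j) = ENNReal.ofReal ((2 * ((2 : ℝ) ^ j)⁻¹) ^ N) := by
  rw [box_eq, (PiLp.volume_preserving_ofLp (Fin N)).measure_preimage
    (MeasurableSet.univ_pi fun i => measurableSet_Icc).nullMeasurableSet, volume_pi_pi]
  simp only [Real.volume_Icc]
  have h2 : ((2 : ℝ) ^ j)⁻¹ - -((2 : ℝ) ^ j)⁻¹ = 2 * ((2 : ℝ) ^ j)⁻¹ := by ring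
  simp only [h2, Finset.prod_const, Finset.card_univ, Fintype.card_fin]
  rw [ENNReal.ofReal_pow (by positivity)]

theorem norm_sq_le_of_mem_box {j : ℕ} {z : Space N} (hz : z ∈ box N j) :
    ‖z‖ ^ 2 ≤ N * (((2 : ℝ) ^ j)⁻¹) ^ 2 := by
  rw [EuclideanSpace.norm_sq_eq]
  calc ∑ i, ‖z i‖ ^ 2 ≤ ∑ _i : Fin N, (((2 : ℝ) ^ j)⁻¹) ^ 2 := by
        refine Finset.sum_le_sum fun i _ => ?_
        exact pow_le_pow_left₀ (norm_nonneg _) (hz i) 2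
    _ = _ := by simp

theorem sq_lintegral_le {α : Type*} [MeasurableSpace α] (μ : Measure α) {f : α → ENNReal}
    (hf : AEMeasurable f μ) : (∫⁻ x, f x ∂μ) ^ 2 ≤ μ Set.univ * ∫⁻ x, f x ^ 2 ∂μ := by
  have h := ENNReal.lintegral_mul_le_Lp_mul_Lq μ Real.HolderConjugate.two_two hf
    (aemeasurable_const (b := (1 : ENNReal)))
  simp only [Pi.mul_apply, mul_one, lintegral_const, ENNReal.rpow_two, one_pow, one_mul] at h
  calc (∫⁻ x, f x ∂μ) ^ 2 ≤ ((∫⁻ x, f x ^ 2 ∂μ) ^ (1 / 2 : ℝ) * μ Set.univ ^ (1 / 2 : ℝ)) ^ 2 := by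
        gcongr
    _ = _ := by
        rw [mul_pow, ← ENNReal.rpow_two, ← ENNReal.rpow_two, ← ENNReal.rpow_mul, ← ENNReal.rpow_mul]
        norm_num
        rw [mul_comm]

/-- The deviation from the average is the average of the differences; Cauchy–Schwarz on the cube
gives the square. -/
theorem enorm_sub_cubeAvg_sq_le (j : ℕ) {u : Space N → ℝ} (hu : Measurable u)
    (hint : ∀ k, IntegrableOn u (cube j k)) (x : Space N) :
    ‖u x - cubeAvg j u x‖ₑ ^ 2 ≤ (ENNReal.ofReal (((2 : ℝ) ^ j)⁻¹ ^ N))⁻¹ *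
      ∫⁻ y in cube j (cell j x), ‖u y - u x‖ₑ ^ 2 := by
  set s := cube j (cell j x) with hs
  set a := ENNReal.ofReal (((2 : ℝ) ^ j)⁻¹ ^ N) with ha
  have hvol : volume s = a := volume_cube j _
  have ha0 : a ≠ 0 := by
    rw [ha, ENNReal.ofReal_ne_zero_iff]; positivity
  have hat : a ≠ ⊤ := ENNReal.ofReal_ne_top
  have hs0 : volume s ≠ 0 := by rwa [hvol]
  have hst : volume s ≠ ⊤ := by rwa [hvol]
  have h1 : cubeAvg j u x - u x = ⨍ y in s, (u y - u x) := by
    rw [cubeAvg, ← hs, setAverage_eq, setAverage_eq,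
      integral_sub (hint _) (integrableOn_const hst), setIntegral_const, smul_sub, smul_smul,
      inv_mul_cancel₀ (by
        rw [Measure.real]
        exact (ENNReal.toReal_pos hs0 hst).ne'), one_smul]
  have hav : (volume.real s)⁻¹ = (a⁻¹).toReal := by
    rw [Measure.real, hvol, ENNReal.toReal_inv]
  have h2 : ‖u x - cubeAvg j u x‖ₑ ≤ a⁻¹ * ∫⁻ y in s, ‖u y - u x‖ₑ := by
    rw [← neg_sub, enorm_neg, h1, setAverage_eq, hav, enorm_smul]
    refine mul_le_mul' (le_of_eq ?_) (enorm_integral_le_lintegral_enorm _)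
    rw [← ofReal_norm, Real.norm_of_nonneg ENNReal.toReal_nonneg,
      ENNReal.ofReal_toReal (ENNReal.inv_ne_top.2 ha0)]
  calc ‖u x - cubeAvg j u x‖ₑ ^ 2 ≤ (a⁻¹ * ∫⁻ y in s, ‖u y - u x‖ₑ) ^ 2 := by gcongr
    _ = a⁻¹ ^ 2 * (∫⁻ y in s, ‖u y - u x‖ₑ) ^ 2 := by rw [mul_pow]
    _ ≤ a⁻¹ ^ 2 * (a * ∫⁻ y in s, ‖u y - u x‖ₑ ^ 2) := by
        gcongr
        have h3 := sq_lintegral_le (volume.restrict s) (f := fun y => ‖u y - u x‖ₑ)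
          (hu.sub_const _).enorm.aemeasurable
        rwa [Measure.restrict_apply_univ, hvol] at h3
    _ = a⁻¹ * ∫⁻ y in s, ‖u y - u x‖ₑ ^ 2 := by
        rw [sq, ← mul_assoc, mul_assoc a⁻¹ a⁻¹ a, ENNReal.inv_mul_cancel ha0 hat, mul_one]

theorem integrableOn_cube (v : H1 N) (j : ℕ) (k : Fin N → ℤ) :
    IntegrableOn (fn v) (cube j k) := by
  have : IsFiniteMeasure (volume.restrict (cube j k)) :=
    ⟨by rw [Measure.restrict_apply_univ, volume_cube]; exact ENNReal.ofReal_lt_top⟩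
  exact ((Lp.memLp (fn v)).restrict (cube j k)).integrable (q := 2) (by norm_num)

theorem lintegral_translate_sub_le (v : H1 N) (z : Space N) :
    ∫⁻ x, ‖fn v (x + z) - fn v x‖ₑ ^ 2 ≤ ENNReal.ofReal (‖z‖ ^ 2 * ‖grad v‖ ^ 2) := by
  have h := eLpNorm_translate_sub_le v z
  have h1 := eLpNorm_eq_lintegral_rpow_enorm_toReal (μ := (volume : Measure (Space N)))
    (f := fun x => fn v (x + z) - fn v x) (p := 2) (by norm_num) (by norm_num)
  have h2 : ∫⁻ x, ‖fn v (x + z) - fn v x‖ₑ ^ 2 =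
      (eLpNorm (fun x => fn v (x + z) - fn v x) 2 volume) ^ 2 := by
    rw [h1, ← ENNReal.rpow_two, ← ENNReal.rpow_mul]
    simp
  rw [h2, ← mul_pow, ENNReal.ofReal_pow (by positivity)]
  gcongr

/-- A Poincaré inequality, summed over all dyadic cubes of one generation. -/
theorem lintegral_sub_cubeAvg_sq_le (v : H1 N) (j : ℕ) :
    ∫⁻ x, ‖fn v x - cubeAvg j (fn v) x‖ₑ ^ 2 ≤
      ENNReal.ofReal (2 ^ N * N * (((2 : ℝ) ^ j)⁻¹) ^ 2 * ‖grad v‖ ^ 2) := by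
  set u : Space N → ℝ := (fn v : Space N → ℝ) with hu
  have hum : Measurable u := (Lp.stronglyMeasurable (fn v)).measurable
  set a := ENNReal.ofReal (((2 : ℝ) ^ j)⁻¹ ^ N) with ha
  have ha0 : a ≠ 0 := by
    rw [ha, ENNReal.ofReal_ne_zero_iff]; positivity
  have hat : a ≠ ⊤ := ENNReal.ofReal_ne_top
  have hmeas : Measurable (Function.uncurry fun (x z : Space N) =>
      (box N j).indicator (fun z => ‖u (x + z) - u x‖ₑ ^ 2) z) := by
    have h1 : Measurable fun q : Space N × Space N => ‖u (q.1 + q.2) - u q.1‖ₑ ^ 2 :=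
      ((hum.comp measurable_add).sub (hum.comp measurable_fst)).enorm.pow_const 2
    exact h1.indicator (measurable_snd (measurableSet_box j))
  -- The cube of x lies in x + `box N j`, so after Tonelli only translations by z in the box remain.
  -- The factor 2^N is the ratio of the volumes of box and cube.
  calc ∫⁻ x, ‖u x - cubeAvg j u x‖ₑ ^ 2
      ≤ ∫⁻ x, a⁻¹ * ∫⁻ z, (box N j).indicator (fun z => ‖u (x + z) - u x‖ₑ ^ 2) z := by
        refine lintegral_mono fun x => (enorm_sub_cubeAvg_sq_le j hum
          (integrableOn_cube v j) x).trans ?_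
        refine mul_le_mul_right ?_ _
        rw [← lintegral_indicator (measurableSet_cube j _),
          ← lintegral_add_left_eq_self (μ := volume) _ x]
        refine lintegral_mono fun z => ?_
        by_cases hz : x + z ∈ cube j (cell j x)
        · have hz' : z ∈ box N j := fun i => by
            have := abs_sub_le_of_cell_eq (show cell j x = cell j (x + z) from hz.symm) i
            simpa using this
          rw [Set.indicator_of_mem hz, Set.indicator_of_mem hz']
        · rw [Set.indicator_of_notMem hz]
          exact zero_le
    _ = a⁻¹ * ∫⁻ z, ∫⁻ x, (box N j).indicator (fun z => ‖u (x + z) - u x‖ₑ ^ 2) z := by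
        rw [lintegral_const_mul' _ _ (ENNReal.inv_ne_top.2 ha0),
          lintegral_lintegral_swap hmeas.aemeasurable]
    _ ≤ a⁻¹ * ∫⁻ z, (box N j).indicator (fun _ =>
          ENNReal.ofReal (N * (((2 : ℝ) ^ j)⁻¹) ^ 2 * ‖grad v‖ ^ 2)) z := by
        gcongr with z
        by_cases hz : z ∈ box N j
        · simp only [Set.indicator_of_mem hz]
          refine (lintegral_translate_sub_le v z).trans (ENNReal.ofReal_le_ofReal ?_)
          gcongr
          exact norm_sq_le_of_mem_box hz
        · simp [Set.indicator_of_notMem hz]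
    _ = _ := by
        rw [lintegral_indicator (measurableSet_box j), lintegral_const,
          Measure.restrict_apply_univ, volume_box, mul_pow,
          ENNReal.ofReal_mul (p := 2 ^ N) (by positivity), ← ha, mul_left_comm, mul_comm _ a, ← mul_assoc a⁻¹ a, ENNReal.inv_mul_cancel ha0 hat,
          one_mul, ← ENNReal.ofReal_mul (by positivity)]
        congr 1
        ring

/-- An inverse inequality for functions that are constant on the dyadic cubes of a generation. -/
theorem eLpNorm_le_of_const_on_cubes {p : ℝ} (hp : 2 < p) (j : ℕ) {f : Space N → ℝ}
    (hfm : Measurable f) (hf : ∀ x y, cell j x = cell j y → f x = f y) :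
    eLpNorm f (ENNReal.ofReal p) volume ≤
      ENNReal.ofReal (((2 : ℝ) ^ j) ^ (N * (1 / 2 - 1 / p))) * eLpNorm f 2 volume := by
  have hp0 : 0 < p := by linarith
  set S := ∫⁻ x, ‖f x‖ₑ ^ 2 with hS
  set a := ENNReal.ofReal (((2 : ℝ) ^ j)⁻¹ ^ N) with ha
  have ha0 : a ≠ 0 := by
    rw [ha, ENNReal.ofReal_ne_zero_iff]; positivity
  have hat : a ≠ ⊤ := ENNReal.ofReal_ne_top
  -- The L² mass on the single cube of x already controls the value there; the L^p bound then
  -- follows by interpolation between L^∞ and L².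
  have hpt : ∀ x, ‖f x‖ₑ ≤ (a⁻¹ * S) ^ (1 / 2 : ℝ) := by
    intro x
    have h1 : ‖f x‖ₑ ^ 2 * a ≤ S := by
      calc ‖f x‖ₑ ^ 2 * a = ∫⁻ _y in cube j (cell j x), ‖f x‖ₑ ^ 2 := by
            rw [lintegral_const, Measure.restrict_apply_univ, volume_cube]
        _ = ∫⁻ y in cube j (cell j x), ‖f y‖ₑ ^ 2 := by
            refine setLIntegral_congr_fun (measurableSet_cube j _) fun y hy => ?_
            simp only [hf x y (Eq.symm hy)]
        _ ≤ S := setLIntegral_le_lintegral _ _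
    have h2 : ‖f x‖ₑ ^ 2 ≤ a⁻¹ * S := by
      rw [mul_comm, ← div_eq_mul_inv, ENNReal.le_div_iff_mul_le (Or.inl ha0) (Or.inl hat)]
      exact h1
    calc ‖f x‖ₑ = (‖f x‖ₑ ^ 2) ^ (1 / 2 : ℝ) := by
          rw [← ENNReal.rpow_two, ← ENNReal.rpow_mul]; norm_num
      _ ≤ _ := by gcongr
  have h2 : eLpNorm f 2 volume = S ^ (1 / 2 : ℝ) := by
    rw [eLpNorm_eq_lintegral_rpow_enorm_toReal (by norm_num) (by norm_num)]
    simp [hS]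
  have h3 : eLpNorm f (ENNReal.ofReal p) volume = (∫⁻ x, ‖f x‖ₑ ^ p) ^ (1 / p) := by
    rw [eLpNorm_eq_lintegral_rpow_enorm_toReal (by simpa using hp0) ENNReal.ofReal_ne_top,
      ENNReal.toReal_ofReal hp0.le]
  have hθ : 0 ≤ 1 / 2 - 1 / p := by
    have : 1 / p ≤ 1 / 2 := one_div_le_one_div_of_le (by norm_num) hp.le
    linarith
  have h4 : ∫⁻ x, ‖f x‖ₑ ^ p ≤ ((a⁻¹ * S) ^ (1 / 2 : ℝ)) ^ (p - 2) * S := by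
    rw [hS]
    calc ∫⁻ x, ‖f x‖ₑ ^ p ≤ ∫⁻ x, ((a⁻¹ * S) ^ (1 / 2 : ℝ)) ^ (p - 2) * ‖f x‖ₑ ^ 2 := by
          refine lintegral_mono fun x => ?_
          have e : ‖f x‖ₑ ^ p = ‖f x‖ₑ ^ (p - 2) * ‖f x‖ₑ ^ 2 := by
            rw [← ENNReal.rpow_two, ← ENNReal.rpow_add_of_nonneg _ _ (by linarith) (by norm_num)]
            ring_nf
          simp only [e]
          exact mul_le_mul_left (ENNReal.rpow_le_rpow (hpt x) (by linarith)) _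
      _ = _ := lintegral_const_mul _ (hfm.enorm.pow_const 2)
  have h5 : (a⁻¹) ^ (1 / 2 - 1 / p) =
      ENNReal.ofReal (((2 : ℝ) ^ j) ^ (N * (1 / 2 - 1 / p))) := by
    rw [ha, ← ENNReal.ofReal_inv_of_pos (by positivity), ENNReal.ofReal_rpow_of_nonneg
      (by positivity) hθ, inv_pow, inv_inv, Real.rpow_mul (by positivity), Real.rpow_natCast]
  rw [h3, h2, ← h5]
  calc (∫⁻ x, ‖f x‖ₑ ^ p) ^ (1 / p)
      ≤ (((a⁻¹ * S) ^ (1 / 2 : ℝ)) ^ (p - 2) * S) ^ (1 / p) := by gcongr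
    _ = (a⁻¹) ^ (1 / 2 - 1 / p) * (S ^ (1 / 2 - 1 / p) * S ^ (1 / p)) := by
        rw [ENNReal.mul_rpow_of_nonneg _ _ (by positivity), ← ENNReal.rpow_mul, ← ENNReal.rpow_mul,
          ← mul_assoc (a⁻¹ ^ (1 / 2 - 1 / p)), ← ENNReal.mul_rpow_of_nonneg a⁻¹ S hθ]
        congr 2
        field_simp
    _ = _ := by
        rw [← ENNReal.rpow_add_of_nonneg _ _ hθ (by positivity), sub_add_cancel]

end Dyadic

/-! ### The subcritical Sobolev embedding -/

section Sobolev

variable {N : ℕ}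

theorem norm_sq_eq_add (v : H1 N) : ‖v‖ ^ 2 = ‖fn v‖ ^ 2 + ‖grad v‖ ^ 2 :=
  WithLp.prod_norm_sq_eq_of_L2 v.1

theorem norm_fn_le (v : H1 N) : ‖fn v‖ ≤ ‖v‖ := by
  refine abs_le_of_sq_le_sq' ?_ (norm_nonneg _) |>.2
  rw [norm_sq_eq_add]
  exact le_add_of_nonneg_right (by positivity)

theorem norm_grad_le (v : H1 N) : ‖grad v‖ ≤ ‖v‖ := by
  refine abs_le_of_sq_le_sq' ?_ (norm_nonneg _) |>.2
  rw [norm_sq_eq_add]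
  exact le_add_of_nonneg_left (by positivity)

/-- The constant of the Poincaré inequality on dyadic cubes. -/
noncomputable def poincareConst (N : ℕ) : ℝ := √(2 ^ N * N)

theorem eLpNorm_two_sub_cubeAvg_le (v : H1 N) (j : ℕ) :
    eLpNorm (fun x => fn v x - cubeAvg j (fn v) x) 2 volume ≤
      ENNReal.ofReal (poincareConst N * ((2 : ℝ) ^ j)⁻¹ * ‖v‖) := by
  have h1 := lintegral_sub_cubeAvg_sq_le v j
  have h2 := eLpNorm_eq_lintegral_rpow_enorm_toReal (μ := (volume : Measure (Space N)))
    (f := fun x => fn v x - cubeAvg j (fn v) x) (p := 2) (by norm_num) (by norm_num)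
  simp only [ENNReal.toReal_ofNat, ENNReal.rpow_two] at h2
  have h3 : (2 : ℝ) ^ N * N * (((2 : ℝ) ^ j)⁻¹) ^ 2 * ‖grad v‖ ^ 2 =
      (poincareConst N * ((2 : ℝ) ^ j)⁻¹ * ‖grad v‖) ^ 2 := by
    rw [mul_pow, mul_pow, poincareConst, Real.sq_sqrt (by positivity)]
  have h0 : 0 ≤ poincareConst N := Real.sqrt_nonneg _
  rw [h2]
  calc _ ≤ (ENNReal.ofReal ((poincareConst N * ((2 : ℝ) ^ j)⁻¹ * ‖grad v‖) ^ 2)) ^ (1 / 2 : ℝ) := by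
        rw [← h3]; gcongr
    _ = ENNReal.ofReal (poincareConst N * ((2 : ℝ) ^ j)⁻¹ * ‖grad v‖) := by
        rw [ENNReal.ofReal_pow (by positivity), ← ENNReal.rpow_two, ← ENNReal.rpow_mul]
        norm_num
    _ ≤ _ := by
        apply ENNReal.ofReal_le_ofReal
        gcongr
        exact norm_grad_le v

theorem aestronglyMeasurable_cubeAvg (v : H1 N) (j : ℕ) :
    AEStronglyMeasurable (cubeAvg j (fn v)) volume :=
  (measurable_cubeAvg j (fn v)).aestronglyMeasurable

theorem cubeAvg_congr {j : ℕ} {u : Space N → ℝ} {x y : Space N} (h : cell j x = cell j y) :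
    cubeAvg j u x = cubeAvg j u y := by
  rw [cubeAvg, cubeAvg, h]

variable {p : ℝ}

/-- The scaling exponent of the inverse inequality between `L^p` and `L^2`. -/
noncomputable def gap (N : ℕ) (p : ℝ) : ℝ := N * (1 / 2 - 1 / p)

/-- The Poincaré inequality gives 2^(-j) in L², and the inverse inequality at generation j + 1 costs
2^((j+1)·gap); the ratio of the resulting geometric series is 2^gap / 2. -/
theorem eLpNorm_cubeAvg_succ_sub_le (hp : 2 < p) (v : H1 N) (j : ℕ) :
    eLpNorm (fun x => cubeAvg (j + 1) (fn v) x - cubeAvg j (fn v) x) (ENNReal.ofReal p) volume ≤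
      ENNReal.ofReal (2 * poincareConst N * 2 ^ gap N p * (2 ^ gap N p / 2) ^ j * ‖v‖) := by
  have h0 : 0 ≤ poincareConst N := Real.sqrt_nonneg _
  have h1 := eLpNorm_le_of_const_on_cubes hp (j + 1)
    (f := fun x => cubeAvg (j + 1) (fn v) x - cubeAvg j (fn v) x)
    ((measurable_cubeAvg _ _).sub (measurable_cubeAvg _ _)) (fun x y hxy => by
      simp only [cubeAvg_congr hxy, cubeAvg_congr (cell_eq_of_cell_succ_eq hxy)])
  refine h1.trans ?_
  have h2 : eLpNorm (fun x => cubeAvg (j + 1) (fn v) x - cubeAvg j (fn v) x) 2 volume ≤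
      ENNReal.ofReal (2 * poincareConst N * ((2 : ℝ) ^ j)⁻¹ * ‖v‖) := by
    have e : (fun x => cubeAvg (j + 1) (fn v) x - cubeAvg j (fn v) x) =
        (fun x => fn v x - cubeAvg j (fn v) x) - fun x => fn v x - cubeAvg (j + 1) (fn v) x := by
      ext x; simp
    rw [e]
    refine (eLpNorm_sub_le ((Lp.aestronglyMeasurable _).sub (aestronglyMeasurable_cubeAvg v j))
      ((Lp.aestronglyMeasurable _).sub (aestronglyMeasurable_cubeAvg v (j + 1)))
      (by norm_num)).trans ?_
    refine (add_le_add (eLpNorm_two_sub_cubeAvg_le v j)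
      (eLpNorm_two_sub_cubeAvg_le v (j + 1))).trans ?_
    rw [← ENNReal.ofReal_add (by positivity) (by positivity)]
    apply ENNReal.ofReal_le_ofReal
    have h3 : ((2 : ℝ) ^ (j + 1))⁻¹ ≤ ((2 : ℝ) ^ j)⁻¹ := by
      rw [pow_succ]
      refine inv_anti₀ (by positivity) ?_
      have : (0 : ℝ) < 2 ^ j := by positivity
      linarith
    have h4 : poincareConst N * ((2 : ℝ) ^ (j + 1))⁻¹ * ‖v‖ ≤
        poincareConst N * ((2 : ℝ) ^ j)⁻¹ * ‖v‖ := by gcongr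
    linarith
  refine (mul_le_mul_right h2 _).trans (le_of_eq ?_)
  rw [← ENNReal.ofReal_mul (by positivity)]
  congr 1
  rw [← gap, ← Real.rpow_pow_comm (by norm_num), div_pow, pow_succ]
  ring

theorem eLpNorm_cubeAvg_add_sub_le [Fact (1 ≤ ENNReal.ofReal p)] (hp : 2 < p) (hgap : gap N p < 1)
    (v : H1 N) (j n : ℕ) :
    eLpNorm (fun x => cubeAvg (j + n) (fn v) x - cubeAvg j (fn v) x) (ENNReal.ofReal p) volume ≤
      ENNReal.ofReal (2 * poincareConst N * 2 ^ gap N p / (1 - 2 ^ gap N p / 2) *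
        ((2 ^ gap N p / 2) ^ j - (2 ^ gap N p / 2) ^ (j + n)) * ‖v‖) := by
  have h0 : 0 ≤ poincareConst N := Real.sqrt_nonneg _
  set ρ : ℝ := 2 ^ gap N p / 2 with hρ
  have hρ0 : 0 ≤ ρ := by positivity
  have hρ1 : ρ < 1 := by
    rw [hρ, div_lt_one (by norm_num)]
    calc (2 : ℝ) ^ gap N p < 2 ^ (1 : ℝ) := Real.rpow_lt_rpow_of_exponent_lt (by norm_num) hgap
      _ = 2 := Real.rpow_one 2
  have hd : 0 < 1 - ρ := by linarith
  set C := 2 * poincareConst N * 2 ^ gap N p with hC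
  have hC0 : 0 ≤ C := by positivity
  induction n with
  | zero => simp
  | succ n ih =>
    have e : (fun x => cubeAvg (j + (n + 1)) (fn v) x - cubeAvg j (fn v) x) =
        (fun x => cubeAvg (j + n + 1) (fn v) x - cubeAvg (j + n) (fn v) x) +
          fun x => cubeAvg (j + n) (fn v) x - cubeAvg j (fn v) x := by
      ext x; simp [add_assoc]
    rw [e]
    refine (eLpNorm_add_le ((aestronglyMeasurable_cubeAvg v _).sub
      (aestronglyMeasurable_cubeAvg v _)) ((aestronglyMeasurable_cubeAvg v _).sub
      (aestronglyMeasurable_cubeAvg v _)) Fact.out).trans ?_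
    refine (add_le_add (eLpNorm_cubeAvg_succ_sub_le hp v (j + n)) ih).trans ?_
    have hmono : ρ ^ (j + n) ≤ ρ ^ j := pow_le_pow_of_le_one hρ0 hρ1.le (by omega)
    rw [← hρ, ← hC, ← ENNReal.ofReal_add (by positivity)
      (mul_nonneg (mul_nonneg (by positivity) (by linarith)) (norm_nonneg _))]
    apply le_of_eq
    congr 1
    have : C * ρ ^ (j + n) = C / (1 - ρ) * (ρ ^ (j + n) - ρ ^ (j + (n + 1))) := by
      rw [← add_assoc, pow_succ]
      field_simp
    rw [this]
    ring

/-- Dyadic averages approximate `H^1` functions in `L^p`, uniformly on bounded sets. -/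
theorem exists_eLpNorm_sub_cubeAvg_le [Fact (1 ≤ ENNReal.ofReal p)] (hp : 2 < p)
    (hgap : gap N p < 1) :
    ∃ C ρ : ℝ, 0 ≤ C ∧ 0 ≤ ρ ∧ ρ < 1 ∧ ∀ (v : H1 N) (j : ℕ),
      eLpNorm (fun x => fn v x - cubeAvg j (fn v) x) (ENNReal.ofReal p) volume ≤
        ENNReal.ofReal (C * ρ ^ j * ‖v‖) := by
  have h0 : 0 ≤ poincareConst N := Real.sqrt_nonneg _
  set ρ : ℝ := 2 ^ gap N p / 2 with hρ
  have hρ0 : 0 ≤ ρ := by positivity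
  have hρ1 : ρ < 1 := by
    rw [hρ, div_lt_one (by norm_num)]
    calc (2 : ℝ) ^ gap N p < 2 ^ (1 : ℝ) := Real.rpow_lt_rpow_of_exponent_lt (by norm_num) hgap
      _ = 2 := Real.rpow_one 2
  have hd : 0 < 1 - ρ := by linarith
  refine ⟨2 * poincareConst N * 2 ^ gap N p / (1 - ρ), ρ, by positivity, hρ0, hρ1, fun v j => ?_⟩
  -- Convergence in L² yields almost everywhere convergence along a subsequence, and Fatou's lemma
  -- passes the telescoped L^p bound to the limit without assuming v in L^p.
  have hlim : Tendsto (fun n => eLpNorm (cubeAvg (j + n) (fn v) - (fn v : Space N → ℝ)) 2 volume)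
      atTop (𝓝 0) := by
    have hb : Tendsto (fun n : ℕ => ENNReal.ofReal (poincareConst N * ((2 : ℝ) ^ (j + n))⁻¹ * ‖v‖))
        atTop (𝓝 0) := by
      rw [← ENNReal.ofReal_zero]
      refine ENNReal.tendsto_ofReal ?_
      have h1 : Tendsto (fun n : ℕ => ((2 : ℝ)⁻¹) ^ (n + j)) atTop (𝓝 0) :=
        (tendsto_add_atTop_iff_nat j).2
          (tendsto_pow_atTop_nhds_zero_of_lt_one (by norm_num) (by norm_num))
      have h2 := (h1.const_mul (poincareConst N)).mul_const ‖v‖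
      simp only [mul_zero, zero_mul] at h2
      refine h2.congr fun n => ?_
      rw [inv_pow, add_comm]
    refine tendsto_of_tendsto_of_tendsto_of_le_of_le tendsto_const_nhds hb (fun _ => zero_le)
      fun n => ?_
    rw [eLpNorm_sub_comm]
    exact eLpNorm_two_sub_cubeAvg_le v (j + n)
  obtain ⟨ns, -, hns⟩ := (tendstoInMeasure_of_tendsto_eLpNorm (by norm_num)
    (fun n => aestronglyMeasurable_cubeAvg v (j + n)) (Lp.aestronglyMeasurable (fn v))
    hlim).exists_seq_tendsto_ae
  have hfatou := Lp.eLpNorm_lim_le_liminf_eLpNorm (p := ENNReal.ofReal p)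
    (f := fun n x => cubeAvg (j + ns n) (fn v) x - cubeAvg j (fn v) x)
    (fun n => (aestronglyMeasurable_cubeAvg v _).sub (aestronglyMeasurable_cubeAvg v _))
    (fun x => fn v x - cubeAvg j (fn v) x)
    (by filter_upwards [hns] with x hx using hx.sub_const _)
  refine hfatou.trans ?_
  refine liminf_le_of_frequently_le' (Frequently.of_forall fun n => ?_)
  refine (eLpNorm_cubeAvg_add_sub_le hp hgap v j (ns n)).trans (ENNReal.ofReal_le_ofReal ?_)
  rw [← hρ]
  gcongr
  have : 0 ≤ ρ ^ (j + ns n) := by positivity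
  linarith

/-- Split off the averages over unit cubes: there the inverse inequality has constant 1, and the
remainder is the case j = 0 of the approximation bound. -/
theorem exists_eLpNorm_fn_le [Fact (1 ≤ ENNReal.ofReal p)] (hp : 2 < p) (hgap : gap N p < 1) :
    ∃ C : ℝ, 0 ≤ C ∧ ∀ v : H1 N,
      eLpNorm (fn v) (ENNReal.ofReal p) volume ≤ ENNReal.ofReal (C * ‖v‖) := by
  obtain ⟨C, ρ, hC, -, -, hb⟩ := exists_eLpNorm_sub_cubeAvg_le (N := N) hp hgap
  have h0 : 0 ≤ poincareConst N := Real.sqrt_nonneg _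
  refine ⟨C + (1 + poincareConst N), by positivity, fun v => ?_⟩
  have h1 := hb v 0
  have h2 : eLpNorm (cubeAvg 0 (fn v)) (ENNReal.ofReal p) volume ≤
      ENNReal.ofReal ((1 + poincareConst N) * ‖v‖) := by
    refine (eLpNorm_le_of_const_on_cubes hp 0 (measurable_cubeAvg 0 _)
      fun x y hxy => cubeAvg_congr hxy).trans ?_
    rw [pow_zero, Real.one_rpow, ENNReal.ofReal_one, one_mul]
    have e : cubeAvg 0 (fn v) = (fn v : Space N → ℝ) - fun x => fn v x - cubeAvg 0 (fn v) x := by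
      ext x; simp
    rw [e]
    refine (eLpNorm_sub_le (Lp.aestronglyMeasurable _) ((Lp.aestronglyMeasurable _).sub
      (aestronglyMeasurable_cubeAvg v 0)) (by norm_num)).trans ?_
    have h3 : eLpNorm (fn v) 2 volume ≤ ENNReal.ofReal ‖v‖ := by
      rw [← ENNReal.ofReal_toReal (Lp.eLpNorm_ne_top (fn v)), ← Lp.norm_def]
      exact ENNReal.ofReal_le_ofReal (norm_fn_le v)
    refine (add_le_add h3 (eLpNorm_two_sub_cubeAvg_le v 0)).trans ?_
    rw [← ENNReal.ofReal_add (by positivity) (by positivity)]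
    apply ENNReal.ofReal_le_ofReal
    rw [pow_zero, inv_one]
    linarith
  have e : (fn v : Space N → ℝ) = (fun x => fn v x - cubeAvg 0 (fn v) x) + cubeAvg 0 (fn v) := by
    ext x; simp
  rw [e]
  refine (eLpNorm_add_le ((Lp.aestronglyMeasurable _).sub (aestronglyMeasurable_cubeAvg v 0))
    (aestronglyMeasurable_cubeAvg v 0) Fact.out).trans ((add_le_add h1 h2).trans ?_)
  rw [← ENNReal.ofReal_add (by positivity) (by positivity)]
  apply ENNReal.ofReal_le_ofReal
  rw [pow_zero]
  linarith

theorem gap_lt_one (hN : 1 ≤ N) (hp : 2 < p) (hp' : 3 ≤ N → p < 2 * (N : ℝ) / ((N : ℝ) - 2)) :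
    gap N p < 1 := by
  have hp0 : 0 < p := by linarith
  have hN0 : (1 : ℝ) ≤ N := by exact_mod_cast hN
  have h1 : (N : ℝ) * (p - 2) < 2 * p := by
    rcases le_or_gt 3 N with h | h
    · have h3 : (3 : ℝ) ≤ N := by exact_mod_cast h
      have := hp' h
      rw [lt_div_iff₀ (by linarith)] at this
      linarith
    · have h2 : (N : ℝ) ≤ 2 := by exact_mod_cast (by omega : N ≤ 2)
      nlinarith
  rw [gap]
  have h2 : (N : ℝ) * (1 / 2 - 1 / p) = N * (p - 2) / (2 * p) := by field_simp
  rw [h2, div_lt_one (by positivity)]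
  exact h1

end Sobolev

/-! ### Operators on `H^1` -/

section Operators

variable {N : ℕ}

/-- The inclusion of `H^1` into `L^2`. -/
noncomputable def fnL (N : ℕ) : H1 N →L[ℝ] Lp ℝ 2 (volume : Measure (Space N)) :=
  LinearMap.mkContinuous
    { toFun := fn
      map_add' := fun _ _ => rfl
      map_smul' := fun _ _ => rfl } 1 (fun v => by rw [one_mul]; exact norm_fn_le v)

theorem fnL_apply (v : H1 N) : fnL N v = fn v := rfl

theorem fn_add (v w : H1 N) : fn (v + w) = fn v + fn w := rfl

theorem fn_smul (c : ℝ) (v : H1 N) : fn (c • v) = c • fn v := rfl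

theorem inner_eq_add (v w : H1 N) :
    inner ℝ v w = inner ℝ (fn v) (fn w) + inner ℝ (grad v) (grad w) :=
  WithLp.prod_inner_apply v.1 w.1

theorem inner_eq_integral (v w : H1 N) :
    inner ℝ v w = ∫ x, (inner ℝ (grad v x) (grad w x) + fn v x * fn w x) := by
  rw [inner_eq_add, L2.inner_def, L2.inner_def, integral_add (L2.integrable_inner _ _)]
  · rw [add_comm]
    simp [mul_comm]
  · exact (Lp.memLp (fn v)).integrable_mul (Lp.memLp (fn w))

theorem memLp_gradient {φ : Space N → ℝ} (h1 : ContDiff ℝ ∞ φ) (h2 : HasCompactSupport φ) :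
    MemLp (gradient φ) 2 (volume : Measure (Space N)) :=
  (continuous_gradient h1).memLp_of_hasCompactSupport (hasCompactSupport_gradient h2)

theorem memLp_test {φ : Space N → ℝ} (h1 : ContDiff ℝ ∞ φ) (h2 : HasCompactSupport φ) :
    MemLp φ 2 (volume : Measure (Space N)) :=
  h1.continuous.memLp_of_hasCompactSupport h2

theorem memLp_inner_gradient {φ : Space N → ℝ} (h1 : ContDiff ℝ ∞ φ) (h2 : HasCompactSupport φ)
    (e : Space N) : MemLp (fun x => inner ℝ (gradient φ x) e) 2 (volume : Measure (Space N)) :=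
  (memLp_gradient h1 h2).inner_const e

theorem memLp_test_smul {φ : Space N → ℝ} (h1 : ContDiff ℝ ∞ φ) (h2 : HasCompactSupport φ)
    (e : Space N) : MemLp (fun x => φ x • e) 2 (volume : Measure (Space N)) :=
  (h1.continuous.smul continuous_const).memLp_of_hasCompactSupport h2.smul_right

/-- Testing the weak gradient identity against constant vectors turns it into equalities between
continuous L² pairings, so the subspace is closed. -/
instance completeSpace_H1 : CompleteSpace (H1 N) := by
  have hcl : IsClosed (H1 N : Set (WithLp 2
      (Lp ℝ 2 (volume : Measure (Space N)) × Lp (Space N) 2 (volume : Measure (Space N))))) := by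
    have hset : (H1 N : Set (WithLp 2
        (Lp ℝ 2 (volume : Measure (Space N)) × Lp (Space N) 2 (volume : Measure (Space N))))) =
        ⋂ (φ : Space N → ℝ) (h1 : ContDiff ℝ ∞ φ) (h2 : HasCompactSupport φ) (e : Space N),
          {w | inner ℝ ((memLp_inner_gradient h1 h2 e).toLp _) w.fst =
            -inner ℝ ((memLp_test_smul h1 h2 e).toLp _) w.snd} := by
      ext w
      simp only [Set.mem_iInter, Set.mem_ofPred_eq]
      refine forall_congr' fun φ => forall_congr' fun h1 => forall_congr' fun h2 => ?_
      have key : ∀ e : Space N,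
          inner ℝ e (∫ x, w.fst x • gradient φ x) =
            inner ℝ ((memLp_inner_gradient h1 h2 e).toLp _) w.fst ∧
          inner ℝ e (∫ x, φ x • w.snd x) =
            inner ℝ ((memLp_test_smul h1 h2 e).toLp _) w.snd := by
        intro e
        rw [← integral_inner (integrable_smul_gradient w.fst h1 h2),
          ← integral_inner (integrable_test_smul w.snd h1 h2), L2.inner_def, L2.inner_def]
        constructor
        · refine integral_congr_ae ?_
          filter_upwards [(memLp_inner_gradient h1 h2 e).coeFn_toLp] with x hx
          rw [hx, inner_smul_right, real_inner_comm]
          simp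
        · refine integral_congr_ae ?_
          filter_upwards [(memLp_test_smul h1 h2 e).coeFn_toLp] with x hx
          rw [hx, inner_smul_right, inner_smul_left]
          simp
      constructor
      · intro h e
        rw [← (key e).1, ← (key e).2, h, inner_neg_right]
      · intro h
        refine ext_inner_left ℝ fun e => ?_
        rw [inner_neg_right, (key e).1, (key e).2]
        exact h e
    rw [hset]
    refine isClosed_iInter fun φ => isClosed_iInter fun h1 => isClosed_iInter fun h2 =>
      isClosed_iInter fun e => isClosed_eq ?_ ?_
    · exact continuous_const.inner (WithLp.prod_continuous_ofLp 2 _ _).fst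
    · exact (continuous_const.inner (WithLp.prod_continuous_ofLp 2 _ _).snd).neg
  exact hcl.completeSpace_coe

variable {p : ℝ} [Fact (1 ≤ ENNReal.ofReal p)]

/-- The Sobolev embedding of `H^1` into `L^p`. -/
theorem exists_embedding (hp : 2 < p) (hgap : gap N p < 1) :
    ∃ J : H1 N →L[ℝ] Lp ℝ (ENNReal.ofReal p) (volume : Measure (Space N)),
      ∀ v, J v =ᵐ[volume] fn v := by
  obtain ⟨C, hC, hb⟩ := exists_eLpNorm_fn_le (N := N) hp hgap
  have hm : ∀ v : H1 N, MemLp (fn v) (ENNReal.ofReal p) volume := fun v =>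
    ⟨Lp.aestronglyMeasurable (fn v), (hb v).trans_lt ENNReal.ofReal_lt_top⟩
  obtain ⟨F, hFae, hbound⟩ :
      ∃ F : H1 N → Lp ℝ (ENNReal.ofReal p) (volume : Measure (Space N)),
        (∀ v, F v =ᵐ[volume] fn v) ∧ ∀ v, ‖F v‖ ≤ C * ‖v‖ := by
    refine ⟨fun v => (hm v).toLp _, fun v => (hm v).coeFn_toLp, fun v => ?_⟩
    rw [Lp.norm_toLp]
    exact ENNReal.toReal_le_of_le_ofReal (by positivity) (hb v)
  have hadd : ∀ v w, F (v + w) = F v + F w := by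
    intro v w
    refine Lp.ext ?_
    filter_upwards [hFae (v + w), hFae v, hFae w, Lp.coeFn_add (fn v) (fn w),
      Lp.coeFn_add (F v) (F w)] with x h1 h2 h3 h4 h5
    rw [h1, h5, Pi.add_apply, h2, h3, fn_add, h4, Pi.add_apply]
  have hsmul : ∀ (c : ℝ) (v), F (c • v) = c • F v := by
    intro c v
    refine Lp.ext ?_
    filter_upwards [hFae (c • v), hFae v, Lp.coeFn_smul c (fn v), Lp.coeFn_smul c (F v)]
      with x h1 h2 h3 h4
    rw [h1, h4, Pi.smul_apply, h2, fn_smul, h3, Pi.smul_apply]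
  exact ⟨LinearMap.mkContinuous ⟨⟨F, hadd⟩, hsmul⟩ C hbound, hFae⟩

/-- Restriction to a measurable set, as an operator on `L^p`. -/
theorem exists_restriction {X : Type*} [MeasurableSpace X] (μ : Measure X) {B : Set X}
    (hB : MeasurableSet B) :
    ∃ P : Lp ℝ (ENNReal.ofReal p) μ →L[ℝ] Lp ℝ (ENNReal.ofReal p) μ,
      ∀ f, P f =ᵐ[μ] B.indicator f := by
  have hm : ∀ f : Lp ℝ (ENNReal.ofReal p) μ, MemLp (B.indicator f) (ENNReal.ofReal p) μ :=
    fun f => (Lp.memLp f).indicator hB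
  set F : Lp ℝ (ENNReal.ofReal p) μ → Lp ℝ (ENNReal.ofReal p) μ :=
    fun f => (hm f).toLp _ with hF
  have hFae : ∀ f, F f =ᵐ[μ] B.indicator f := fun f => (hm f).coeFn_toLp
  have hadd : ∀ f h, F (f + h) = F f + F h := by
    intro f h
    refine Lp.ext ?_
    filter_upwards [hFae (f + h), hFae f, hFae h, Lp.coeFn_add f h,
      Lp.coeFn_add (F f) (F h)] with x h1 h2 h3 h4 h5
    rw [h1, h5, Pi.add_apply, h2, h3]
    by_cases hx : x ∈ B
    · rw [Set.indicator_of_mem hx, Set.indicator_of_mem hx, Set.indicator_of_mem hx, h4,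
        Pi.add_apply]
    · rw [Set.indicator_of_notMem hx, Set.indicator_of_notMem hx, Set.indicator_of_notMem hx,
        add_zero]
  have hsmul : ∀ (c : ℝ) (f), F (c • f) = c • F f := by
    intro c f
    refine Lp.ext ?_
    filter_upwards [hFae (c • f), hFae f, Lp.coeFn_smul c f, Lp.coeFn_smul c (F f)]
      with x h1 h2 h3 h4
    rw [h1, h4, Pi.smul_apply, h2]
    by_cases hx : x ∈ B
    · rw [Set.indicator_of_mem hx, Set.indicator_of_mem hx, h3, Pi.smul_apply]
    · rw [Set.indicator_of_notMem hx, Set.indicator_of_notMem hx, smul_zero]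
  have hbound : ∀ f, ‖F f‖ ≤ 1 * ‖f‖ := fun f => by
    rw [hF, Lp.norm_toLp, one_mul, Lp.norm_def]
    exact ENNReal.toReal_mono (Lp.eLpNorm_ne_top f) (eLpNorm_indicator_le _)
  exact ⟨LinearMap.mkContinuous ⟨⟨F, hadd⟩, hsmul⟩ 1 hbound, hFae⟩

theorem finite_cell_image {B : Set (Space N)} (hB : Bornology.IsBounded B) (j : ℕ) :
    (cell j '' B).Finite := by
  obtain ⟨r, hr⟩ := hB.exists_norm_le
  obtain ⟨m, hm⟩ := exists_nat_ge ((2 : ℝ) ^ j * r)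
  refine (Set.finite_Icc (fun _ : Fin N => -((m : ℤ) + 1)) fun _ => (m : ℤ)).subset ?_
  rintro _ ⟨x, hx, rfl⟩
  have hxi : ∀ i, |(2 : ℝ) ^ j * x i| ≤ m := fun i => by
    rw [abs_mul, abs_of_pos (by positivity)]
    refine le_trans ?_ hm
    have h1 : |x i| ≤ ‖x‖ := PiLp.norm_apply_le x i
    have := h1.trans (hr x hx)
    gcongr
  refine ⟨fun i => ?_, fun i => ?_⟩
  · refine Int.le_floor.2 ?_
    push_cast
    linarith [(abs_le.1 (hxi i)).1]
  · refine (Int.cast_le (R := ℝ)).1 ?_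
    push_cast
    exact (Int.floor_le _).trans (abs_le.1 (hxi i)).2

/-- The integral over a dyadic cube, as a functional on `H^1`. -/
theorem exists_integral_cube (j : ℕ) (c : Fin N → ℤ) :
    ∃ l : H1 N →L[ℝ] ℝ, ∀ v, l v = ∫ y in cube j c, fn v y := by
  have hvt : volume (cube j c) ≠ ⊤ := by
    rw [volume_cube]; exact ENNReal.ofReal_ne_top
  refine ⟨(innerSL ℝ (indicatorConstLp 2 (measurableSet_cube j c) hvt (1 : ℝ))).comp (fnL N),
    fun v => ?_⟩
  rw [ContinuousLinearMap.comp_apply, fnL_apply, innerSL_apply_apply,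
    L2.inner_indicatorConstLp_one]

/-- On a bounded set, the dyadic averages vanish on a subspace of finite codimension. -/
theorem exists_codim_cubeAvg {B : Set (Space N)} (hB : Bornology.IsBounded B) (j : ℕ) :
    ∃ (k : ℕ) (R : H1 N →L[ℝ] (Fin k → ℝ)), ∀ v, R v = 0 → ∀ x ∈ B, cubeAvg j (fn v) x = 0 := by
  obtain ⟨K, hK⟩ : ∃ K : Finset (Fin N → ℤ), ∀ x ∈ B, cell j x ∈ K :=
    ⟨(finite_cell_image hB j).toFinset, fun x hx => by simpa using ⟨x, hx, rfl⟩⟩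
  choose l hl using exists_integral_cube (N := N) j
  refine ⟨K.card, ContinuousLinearMap.pi fun i => l (K.equivFin.symm i), fun v hv x hx => ?_⟩
  have h1 : l (K.equivFin.symm (K.equivFin ⟨cell j x, hK x hx⟩)) v = 0 :=
    congrFun hv (K.equivFin ⟨cell j x, hK x hx⟩)
  rw [Equiv.symm_apply_apply, hl] at h1
  rw [cubeAvg, setAverage_eq, h1, smul_zero]

/-- On a bounded set, the embedding into `L^p` is small on subspaces of finite codimension. -/
theorem exists_small_codim (hp : 2 < p) (hgap : gap N p < 1) {B : Set (Space N)}
    (hB : Bornology.IsBounded B)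
    {T : H1 N →L[ℝ] Lp ℝ (ENNReal.ofReal p) (volume : Measure (Space N))}
    (hT : ∀ v, T v =ᵐ[volume] B.indicator (fn v)) {δ : ℝ} (hδ : 0 < δ) :
    ∃ (k : ℕ) (R : H1 N →L[ℝ] (Fin k → ℝ)), ∀ v, R v = 0 → ‖T v‖ ≤ δ * ‖v‖ := by
  obtain ⟨C, ρ, hC, hρ0, hρ1, hb⟩ := exists_eLpNorm_sub_cubeAvg_le (N := N) hp hgap
  -- At this generation the approximation error is at most δ‖v‖; where R v = 0 the averages vanish
  -- on B, so this error dominates v there.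
  obtain ⟨j, hj⟩ := exists_pow_lt_of_lt_one (show 0 < δ / (C + 1) by positivity) hρ1
  have hCρ : C * ρ ^ j ≤ δ := by
    rw [lt_div_iff₀ (by positivity)] at hj
    have : 0 ≤ ρ ^ j := by positivity
    nlinarith
  obtain ⟨k, R, hR⟩ := exists_codim_cubeAvg hB j
  refine ⟨k, R, fun v hv => ?_⟩
  have h4 : eLpNorm (T v) (ENNReal.ofReal p) volume ≤ ENNReal.ofReal (C * ρ ^ j * ‖v‖) := by
    refine le_trans (eLpNorm_mono_ae ?_) (hb v j)
    filter_upwards [hT v] with x hx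
    rw [hx]
    by_cases hxB : x ∈ B
    · simp [hxB, hR v hv x hxB]
    · simp [hxB]
  rw [Lp.norm_def]
  have h5 : 0 ≤ C * ρ ^ j * ‖v‖ := by positivity
  exact (ENNReal.toReal_le_of_le_ofReal h5 h4).trans
    (mul_le_mul_of_nonneg_right hCρ (norm_nonneg v))

end Operators

/-! ### Disjoint bumps -/

section Bumps

variable {N : ℕ}

/-- A test function as an element of `H^1`. -/
noncomputable def ofTest {φ : Space N → ℝ} (h1 : ContDiff ℝ ∞ φ) (h2 : HasCompactSupport φ) :
    H1 N :=
  ⟨WithLp.toLp 2 ((memLp_test h1 h2).toLp φ, (memLp_gradient h1 h2).toLp (gradient φ)), by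
    intro ψ g1 g2
    have e1 : ∫ x, (memLp_test h1 h2).toLp φ x • gradient ψ x = ∫ x, φ x • gradient ψ x := by
      refine integral_congr_ae ?_
      filter_upwards [(memLp_test h1 h2).coeFn_toLp] with x hx
      rw [hx]
    have e2 : ∫ x, ψ x • (memLp_gradient h1 h2).toLp (gradient φ) x =
        ∫ x, ψ x • gradient φ x := by
      refine integral_congr_ae ?_
      filter_upwards [(memLp_gradient h1 h2).coeFn_toLp] with x hx
      rw [hx]
    show ∫ x, (memLp_test h1 h2).toLp φ x • gradient ψ x =
      -∫ x, ψ x • (memLp_gradient h1 h2).toLp (gradient φ) x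
    rw [e1, e2]
    have i1 : Integrable (fun x => φ x • gradient ψ x) :=
      (h1.continuous.smul (continuous_gradient g1)).integrable_of_hasCompactSupport h2.smul_right
    have i2 : Integrable (fun x => ψ x • gradient φ x) :=
      (g1.continuous.smul (continuous_gradient h1)).integrable_of_hasCompactSupport g2.smul_right
    have i3 : Integrable (fun x => φ x * ψ x) :=
      (h1.continuous.mul g1.continuous).integrable_of_hasCompactSupport h2.mul_right
    refine ext_inner_left ℝ fun e => ?_
    rw [inner_neg_right, ← integral_inner i1, ← integral_inner i2]
    have j1 : ∀ x, inner ℝ e (φ x • gradient ψ x) = φ x * fderiv ℝ ψ x e := fun x => by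
      rw [inner_smul_right, real_inner_comm, inner_gradient]
    have j2 : ∀ x, inner ℝ e (ψ x • gradient φ x) = fderiv ℝ φ x e * ψ x := fun x => by
      rw [inner_smul_right, real_inner_comm, inner_gradient, mul_comm]
    have i1' := i1.const_inner (𝕜 := ℝ) e
    have i2' := i2.const_inner (𝕜 := ℝ) e
    simp only [j1, j2] at i1' i2' ⊢
    exact integral_mul_fderiv_eq_neg_fderiv_mul_of_integrable i2' i1' i3
      (fun x _ => (h1.differentiable (by simp)).differentiableAt)
      (fun x _ => (g1.differentiable (by simp)).differentiableAt)⟩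

theorem fn_ofTest {φ : Space N → ℝ} (h1 : ContDiff ℝ ∞ φ) (h2 : HasCompactSupport φ) :
    fn (ofTest h1 h2) =ᵐ[volume] φ :=
  (memLp_test h1 h2).coeFn_toLp

theorem grad_ofTest {φ : Space N → ℝ} (h1 : ContDiff ℝ ∞ φ) (h2 : HasCompactSupport φ) :
    grad (ofTest h1 h2) =ᵐ[volume] gradient φ :=
  (memLp_gradient h1 h2).coeFn_toLp

/-- A zero of a nonnegative function is a minimum. Hence bumps with disjoint nonvanishing sets are
orthogonal in H¹ even if their closed supports touch. -/
theorem gradient_eq_zero_of_nonneg {φ : Space N → ℝ} (h0 : ∀ x, 0 ≤ φ x) {x : Space N}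
    (hx : φ x = 0) : gradient φ x = 0 := by
  have h : IsLocalMin φ x := Eventually.of_forall fun y => by rw [hx]; exact h0 y
  rw [gradient, h.fderiv_eq_zero, map_zero]

/-- A nonempty open set carries infinitely many bumps with disjoint supports. -/
theorem exists_disjoint_bumps (hN : 1 ≤ N) {B : Set (Space N)} (hBo : IsOpen B)
    (hBne : B.Nonempty) :
    ∃ f : ℕ → Space N → ℝ, (∀ n, ContDiff ℝ ∞ (f n)) ∧ (∀ n x, 0 ≤ f n x) ∧
      (∀ n, Function.support (f n) ⊆ B) ∧ (∀ n, (Function.support (f n)).Nonempty) ∧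
      ∀ m n, m ≠ n → ∀ x, f m x = 0 ∨ f n x = 0 := by
  have hnt : Nontrivial (Space N) := by
    have : Nonempty (Fin N) := ⟨⟨0, hN⟩⟩
    infer_instance
  obtain ⟨x₀, hx₀⟩ := hBne
  -- Dimension at least one is needed here; an infinite Hausdorff space contains infinitely many
  -- disjoint nonempty open sets.
  have hinf : Infinite B := (infinite_of_mem_nhds x₀ (hBo.mem_nhds hx₀)).to_subtype
  obtain ⟨U, hUi, hUo, hUd⟩ := exists_seq_infinite_isOpen_pairwise_disjoint B
  have hex : ∀ n, ∃ f : Space N → ℝ, Function.support f = Subtype.val '' U n ∧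
      ContDiff ℝ ∞ f ∧ ∀ x, 0 ≤ f x := by
    intro n
    obtain ⟨f, h1, h2, h3⟩ :=
      (hBo.isOpenMap_subtype_val _ (hUo n)).exists_contDiff_support_eq (n := ⊤)
    exact ⟨f, h1, h2, fun x => (h3 ⟨x, rfl⟩).1⟩
  choose f hfs hfc hf0 using hex
  refine ⟨f, hfc, hf0, fun n => ?_, fun n => ?_, fun m n hmn x => ?_⟩
  · rw [hfs]
    rintro _ ⟨x, -, rfl⟩
    exact x.2
  · rw [hfs]
    exact (hUi n).nonempty.image _
  · by_contra! h
    have h1 : x ∈ Function.support (f m) := h.1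
    have h2 : x ∈ Function.support (f n) := h.2
    rw [hfs] at h1 h2
    exact Set.disjoint_left.1
      ((Set.disjoint_image_iff Subtype.val_injective).2 (hUd hmn)) h1 h2

theorem ofTest_ne_zero {φ : Space N → ℝ} (h1 : ContDiff ℝ ∞ φ) (h2 : HasCompactSupport φ)
    (hne : (Function.support φ).Nonempty) : ofTest h1 h2 ≠ 0 := by
  intro h0
  have h3 : fn (ofTest h1 h2) = 0 := by rw [h0]; rfl
  have h4 := fn_ofTest h1 h2
  rw [h3] at h4
  have h5 : φ = fun _ => (0 : ℝ) :=
    (h1.continuous.ae_eq_iff_eq volume continuous_const).1 (h4.symm.trans (Lp.coeFn_zero _ _ _))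
  obtain ⟨y, hy⟩ := hne
  exact hy (by rw [h5])

theorem inner_ofTest_eq_zero {φ ψ : Space N → ℝ} (h1 : ContDiff ℝ ∞ φ) (h2 : HasCompactSupport φ)
    (g1 : ContDiff ℝ ∞ ψ) (g2 : HasCompactSupport ψ) (hφ : ∀ x, 0 ≤ φ x) (hψ : ∀ x, 0 ≤ ψ x)
    (hd : ∀ x, φ x = 0 ∨ ψ x = 0) : inner ℝ (ofTest h1 h2) (ofTest g1 g2) = 0 := by
  rw [inner_eq_integral]
  refine integral_eq_zero_of_ae ?_
  filter_upwards [fn_ofTest h1 h2, fn_ofTest g1 g2, grad_ofTest h1 h2, grad_ofTest g1 g2]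
    with x e1 e2 e3 e4
  rw [e1, e2, e3, e4]
  rcases hd x with hx | hx
  · rw [hx, gradient_eq_zero_of_nonneg hφ hx]
    simp
  · rw [hx, gradient_eq_zero_of_nonneg hψ hx]
    simp

theorem orthonormal_normalize {ι H : Type*} [NormedAddCommGroup H] [InnerProductSpace ℝ H]
    {c : ι → H} (hc : ∀ n, c n ≠ 0) (horth : ∀ m n, m ≠ n → inner ℝ (c m) (c n) = 0) :
    Orthonormal ℝ fun n => ‖c n‖⁻¹ • c n := by
  refine ⟨fun n => ?_, fun m n hmn => ?_⟩
  · rw [norm_smul, norm_inv, norm_norm, inv_mul_cancel₀ (norm_ne_zero_iff.2 (hc n))]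
  · show inner ℝ (‖c m‖⁻¹ • c m) (‖c n‖⁻¹ • c n) = 0
    rw [real_inner_smul_left, real_inner_smul_right, horth m n hmn, mul_zero, mul_zero]

theorem exists_orthonormal_bumps (hN : 1 ≤ N) {B : Set (Space N)} (hBo : IsOpen B)
    (hBb : Bornology.IsBounded B) (hBne : B.Nonempty) :
    ∃ b : ℕ → H1 N, Orthonormal ℝ b ∧ ∀ i, ∀ᵐ x, x ∉ B → fn (b i) x = 0 := by
  obtain ⟨c, hc, horth, hcB⟩ : ∃ c : ℕ → H1 N, (∀ n, c n ≠ 0) ∧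
      (∀ m n, m ≠ n → inner ℝ (c m) (c n) = 0) ∧ ∀ n, ∀ᵐ x, x ∉ B → fn (c n) x = 0 := by
    obtain ⟨f, hfc, hf0, hfB, hfne, hfd⟩ := exists_disjoint_bumps hN hBo hBne
    have hfk : ∀ n, HasCompactSupport (f n) := fun n =>
      HasCompactSupport.of_support_subset_isCompact hBb.isCompact_closure
        ((hfB n).trans subset_closure)
    refine ⟨fun n => ofTest (hfc n) (hfk n), fun n => ofTest_ne_zero _ _ (hfne n),
      fun m n hmn => inner_ofTest_eq_zero _ _ _ _ (hf0 m) (hf0 n) (hfd m n hmn), fun n => ?_⟩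
    filter_upwards [fn_ofTest (hfc n) (hfk n)] with x h1 hx
    rw [h1]
    by_contra h
    exact hx (hfB n h)
  refine ⟨fun n => ‖c n‖⁻¹ • c n, orthonormal_normalize hc horth, fun n => ?_⟩
  rw [fn_smul]
  filter_upwards [Lp.coeFn_smul ‖c n‖⁻¹ (fn (c n)), hcB n] with x h1 h2 hx
  rw [h1, Pi.smul_apply, h2 hx, smul_zero]

end Bumps

/-! ### Unbounded sequences of solutions -/

section Main

variable {N : ℕ}

/-- Injectivity of an embedding of `H^1` that does not change the underlying function. -/
theorem injective_of_ae_eq_fn {p : ENNReal}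
    {J : H1 N → Lp ℝ p (volume : Measure (Space N))} (hJ : ∀ v, J v =ᵐ[volume] fn v) :
    Function.Injective J := fun v w hvw => by
  have h := hJ w
  rw [← hvw] at h
  exact H1.ext_fn (Lp.ext ((hJ v).symm.trans h))

set_option maxHeartbeats 800000 in
/-- Large weak solutions for a coefficient equal to `1` on `B` and to `-1` outside `B`. -/
theorem exists_large_weak_solution (hN : 1 ≤ N) {B : Set (Space N)} (hBo : IsOpen B)
    (hBb : Bornology.IsBounded B) (hBne : B.Nonempty) {p : ℝ} (hp : 2 < p) (hgap : gap N p < 1)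
    {q : Space N → ℝ} (hq : Measurable q) (hqB : ∀ x ∈ B, q x = 1) (hqC : ∀ x ∉ B, q x = -1)
    (r : ℝ) :
    ∃ v : H1 N, r ≤ ‖v‖ ∧ ∀ w : H1 N,
      Integrable (fun x => q x * |fn v x| ^ (p - 2) * fn v x * fn w x) ∧
      inner ℝ v w = ∫ x, q x * |fn v x| ^ (p - 2) * fn v x * fn w x := by
  have hfact : Fact (1 ≤ ENNReal.ofReal p) := ⟨by
    rw [ENNReal.one_le_ofReal]; linarith⟩
  have hq1 : ∀ x, |q x| ≤ 1 := fun x => by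
    by_cases hx : x ∈ B
    · simp [hqB x hx]
    · simp [hqC x hx]
  obtain ⟨J, hJ⟩ := exists_embedding (N := N) hp hgap
  obtain ⟨T, hT⟩ : ∃ T : H1 N →L[ℝ] Lp ℝ (ENNReal.ofReal p) (volume : Measure (Space N)),
      ∀ v, T v =ᵐ[volume] B.indicator (fn v) := by
    obtain ⟨P, hP⟩ := exists_restriction (p := p) (volume : Measure (Space N)) hBo.measurableSet
    refine ⟨P.comp J, fun v => ?_⟩
    filter_upwards [hP (J v), hJ v] with x h1 h2
    rw [ContinuousLinearMap.comp_apply, h1, Set.indicator, Set.indicator, h2]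
  have hTJ : ∀ u, ∀ᵐ x, x ∈ B → T u x = J u x := fun u => by
    filter_upwards [hT u, hJ u] with x h1 h2 hx
    rw [h1, h2, Set.indicator_of_mem hx]
  have hbump : ∀ k : ℕ, ∃ b : Fin (k + 1) → H1 N, Orthonormal ℝ b ∧
      ∀ i, ∀ᵐ x, x ∉ B → J (b i) x = 0 := fun k => by
    obtain ⟨b, hb, hbB⟩ := exists_orthonormal_bumps hN hBo hBb hBne
    refine ⟨fun i => b i, hb.comp _ Fin.val_injective, fun i => ?_⟩
    filter_upwards [hbB i, hJ (b i)] with x h1 h2 hx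
    rw [h2, h1 hx]
  obtain ⟨v, hv, hsol⟩ := exists_large_solution hp hBo.measurableSet hq hqB hqC J T
    (injective_of_ae_eq_fn hJ) hTJ (fun δ hδ => exists_small_codim hp hgap hBb hT hδ) hbump r
  refine ⟨v, hv, fun w => ?_⟩
  have hae : (fun x => q x * oddPow p (J v x) * J w x) =ᵐ[volume]
      fun x => q x * |fn v x| ^ (p - 2) * fn v x * fn w x := by
    filter_upwards [hJ v, hJ w] with x h1 h2
    rw [h1, h2, oddPow]
    ring
  refine ⟨(integrable_force hp hq hq1 (J v) (J w)).congr hae, ?_⟩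
  rw [hsol w]
  exact integral_congr_ae hae

theorem exists_large_isSolution (hN : 1 ≤ N) {Ω : Set (Space N)} (hΩo : IsOpen Ω)
    (hΩb : Bornology.IsBounded Ω) (hΩne : Ω.Nonempty) {p : ℝ} (hp : 2 < p)
    (hp' : 3 ≤ N → p < 2 * (N : ℝ) / ((N : ℝ) - 2)) {ε : ℝ} (hε : 0 < ε) (r : ℝ) :
    ∃ v : H1 N, r ≤ ‖v‖ ∧ IsSolution Ω ε p v := by
  -- B is the dilate εΩ, the set where the rescaled coefficient equals 1.
  set B : Set (Space N) := (fun x => ε⁻¹ • x) ⁻¹' Ω with hB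
  have hBo : IsOpen B := hΩo.preimage (continuous_const_smul ε⁻¹)
  have hBb : Bornology.IsBounded B := by
    obtain ⟨R, hR⟩ := hΩb.exists_norm_le
    refine isBounded_iff_forall_norm_le.2 ⟨ε * R, fun x hx => ?_⟩
    have h1 := hR _ hx
    rw [norm_smul, norm_inv, Real.norm_of_nonneg hε.le, inv_mul_le_iff₀ hε] at h1
    exact h1
  have hBne : B.Nonempty := by
    obtain ⟨y, hy⟩ := hΩne
    refine ⟨ε • y, ?_⟩
    simpa [hB, smul_smul, inv_mul_cancel₀ hε.ne'] using hy
  have hqB : ∀ x ∈ B, Qeps Ω ε x = 1 := fun x hx => if_pos hx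
  have hqC : ∀ x ∉ B, Qeps Ω ε x = -1 := fun x hx => if_neg hx
  have hq : Measurable (Qeps Ω ε) := by
    classical
    have : Qeps Ω ε = B.piecewise (fun _ => (1 : ℝ)) (fun _ => -1) := by
      ext x
      by_cases hx : x ∈ B
      · rw [hqB x hx, Set.piecewise_eq_of_mem _ _ _ hx]
      · rw [hqC x hx, Set.piecewise_eq_of_notMem _ _ _ hx]
    rw [this]
    exact measurable_const.piecewise hBo.measurableSet measurable_const
  obtain ⟨v, hv, hsol⟩ := exists_large_weak_solution hN hBo hBb hBne hp (gap_lt_one hN hp hp')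
    hq hqB hqC r
  exact ⟨v, hv, fun w => ⟨(hsol w).1, (inner_eq_integral v w).symm.trans (hsol w).2⟩⟩

end Main

end SelfFocusing

theorem theorem1p1 (N : ℕ) (hN : 1 ≤ N)
    (Ω : Set (SelfFocusing.Space N)) (hΩo : IsOpen Ω) (hΩb : Bornology.IsBounded Ω)
    (hΩne : Ω.Nonempty)
    (p : ℝ) (hp : 2 < p) (hp' : 3 ≤ N → p < 2 * (N : ℝ) / ((N : ℝ) - 2))
    (ε : ℝ) (hε : 0 < ε) :
    {v : SelfFocusing.H1 N | SelfFocusing.IsSolution Ω ε p v}.Infinite ∧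
    ∃ v : ℕ → SelfFocusing.H1 N,
      (∀ k, SelfFocusing.IsSolution Ω ε p (v k)) ∧
      ¬ Bornology.IsBounded (Set.range v) := by
  choose v hv hsol using fun k : ℕ =>
    SelfFocusing.exists_large_isSolution hN hΩo hΩb hΩne hp hp' hε (k : ℝ)
  have hunb : ¬ Bornology.IsBounded (Set.range v) := by
    intro hbd
    obtain ⟨C, hC⟩ := hbd.exists_norm_le
    obtain ⟨k, hk⟩ := exists_nat_gt C
    linarith [hv k, hC (v k) ⟨k, rfl⟩]
  -- A finite set of solutions would be bounded, but it would contain the sequence with ‖v k‖ ≥ k.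
  refine ⟨fun hfin => hunb (hfin.isBounded.subset ?_), v, hsol, hunb⟩
  rintro _ ⟨k, rfl⟩
  exact hsol k
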